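/- Let $(X_{ij})_{(i,j)\in\mathbb Z^2}$ be centered, square-integrable real random variables on a probability space $(\Omega,\mathcal A,\mathbb P)$, with $\sigma_{ij}^2=\mathbb E(X_{ij}^2)$. Let $(Y_{ij})_{i,j\ge 1}$ be independent Gaussian random variables on the same space, with mean $0$ and $\mathbb E(Y_{ij}^2)=\sigma_{ij}^2$, the family $(Y_{ij})$ being independent of the family $(X_{ij})$. For $n\ge 1$ let $\mathbb X_n$ be the symmetric $n\times n$ matrix with entries $n^{-1/2}X_{ij}$ for $1\le j\le i\le n$ and $n^{-1/2}X_{ji}$ for $1\le i<j\le n$, with eigenvalues $\lambda_1\le\dots\le\lambda_n$, and let $\mathbf F^{\mathbb X_n}(t)=\frac1n\#\{k:\lambda_k\le t\}$. Define $\mathbb Y_n$ and $\mathbf F^{\mathbb Y_n}$ in the same way from $(Y_{ij})$. For integers $i\ge j$ and $a\ge 0$ let $\mathcal F_{ij}^a$ be the $\sigma$-algebra generated by all $X_{uv}$ with $(u,v)\in\mathbb Z^2$, $v\le u$, $\max(|u-i|,|v-j|)\ge a$, and either $u<i$, or $u=i$ and $v\le j$. Assume the following. 1. $\mathbb E(X_{ij}\mid\mathcal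 F_{ij}^1)=0$ almost surely for all $1\le j\le i$. 2. There are a constant $C$ and a non-decreasing function $h:[0,\infty)\to[1,\infty)$ such that $x\mapsto x^{-1}h(x)$ is non-increasing on $(0,\infty)$, $\sum_{n\ge1}(nh(n))^{-1}<\infty$, and $\mathbb E\big(X_{ij}^2h(|X_{ij}|)\big)\le C$ for all $1\le j\le i$. 3. Almost surely, $$\lim_{a\to\infty}\limsup_{n\to\infty}\frac1{n^2}\sum_{1\le j\le i\le n}\big|\mathbb E(X_{ij}^2-\sigma_{ij}^2\mid\mathcal F_{ij}^a)\big|=0 .$$ For distribution functions $G,F$ let $d(G,F)=\inf\{\varepsilon>0: G(x-\varepsilon)-\varepsilon\le F(x)\le G(x+\varepsilon)+\varepsilon\text{ for all }x\in\mathbb R\}$ be the Lévy distance. Let $\mathbf F$ be a nonrandom (probability) distribution function such that $d(\mathbf F^{\mathbb Y_n},\mathbf F)\to0$ almost surely. Then $d(\mathbf F^{\mathbb X_n},\mathbf F)\to0$ almost surely. -/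

import Mathlib

open MeasureTheory ProbabilityTheory Filter Topology
open scoped ENNReal

noncomputable section

/-- The `n × n` symmetric matrix built from the lower triangle of the array `x` (whose relevant
indices are `1, 2, …`): the `(i, j)` entry is `x i j` if `j ≤ i`, and `x j i` if `i < j`,
for `1 ≤ i, j ≤ n`, and the matrix is then divided by `√n`. -/
def wignerMatrix (x : ℕ → ℕ → ℝ) (n : ℕ) : Matrix (Fin n) (Fin n) ℝ :=
  Matrix.of fun i j =>
    (√(n : ℝ))⁻¹ * (if j ≤ i then x ((i : ℕ) + 1) ((j : ℕ) + 1) else x ((j : ℕ) + 1) ((i : ℕ) + 1))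

theorem wignerMatrix_isHermitian (x : ℕ → ℕ → ℝ) (n : ℕ) : (wignerMatrix x n).IsHermitian := by
  ext i j
  simp only [wignerMatrix, Matrix.conjTranspose_apply, Matrix.of_apply, star_trivial]
  rcases lt_trichotomy i j with h | h | h
  · simp [h.le, not_le.mpr h]
  · simp [h]
  · simp [h.le, not_le.mpr h]

/-- The empirical distribution function `t ↦ (1/n) #{k : λ_k ≤ t}` of the eigenvalues
(with multiplicity) of a Hermitian matrix. -/
def spectralDF {n : ℕ} {A : Matrix (Fin n) (Fin n) ℝ} (hA : A.IsHermitian) (t : ℝ) : ℝ :=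
  (n : ℝ)⁻¹ * (Finset.univ.filter fun k : Fin n => hA.eigenvalues k ≤ t).card

/-- The Lévy distance between two distribution functions. -/
def levyDist (F G : ℝ → ℝ) : ℝ :=
  sInf {ε : ℝ | 0 < ε ∧ ∀ x : ℝ, F (x - ε) - ε ≤ G x ∧ G x ≤ F (x + ε) + ε}

/-- Distribution functions of probability measures on the line. -/
structure IsDistributionFunction (F : ℝ → ℝ) : Prop where
  mono : Monotone F
  right_continuous : ∀ x, ContinuousWithinAt F (Set.Ici x) x
  tendsto_atBot : Tendsto F atBot (𝓝 0)
  tendsto_atTop : Tendsto F atTop (𝓝 1)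

/-- The indices `(u, v)` that are at most `(i, j)` in the lexicographic order of `ℤ × ℤ` and at
sup-distance at least `a` from `(i, j)`. -/
def lexPast (i j : ℤ) (a : ℕ) : Set (ℤ × ℤ) :=
  {p | (a : ℤ) ≤ max |p.1 - i| |p.2 - j| ∧ (p.1 < i ∨ (p.1 = i ∧ p.2 ≤ j))}

/-- For `j ≤ i`, the sigma-algebra generated by the `X u v` with `v ≤ u` and `(u, v)` in
`lexPast i j a`. -/
@[reducible] def pastSigma {Ω : Type*} (X : ℤ → ℤ → Ω → ℝ) (i j : ℤ) (a : ℕ) : MeasurableSpace Ω :=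
  ⨆ p : {p : ℤ × ℤ // p ∈ lexPast i j a ∧ p.2 ≤ p.1},
    MeasurableSpace.comap (X p.1.1 p.1.2) (borel ℝ)

/-- The average `n⁻² ∑_{1 ≤ j ≤ i ≤ n} |E(X_{ij}² - E(X_{ij}²) | F_{ij}^a)|`,
a random variable. -/
def condVarAverage {Ω : Type*} [MeasurableSpace Ω] (P : Measure Ω) (X : ℤ → ℤ → Ω → ℝ)
    (a n : ℕ) (ω : Ω) : ℝ :=
  ((n : ℝ) ^ 2)⁻¹ * ∑ i ∈ Finset.Icc 1 n, ∑ j ∈ Finset.Icc 1 i,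
    |(P[fun ω' => X i j ω' ^ 2 - ∫ ω'', X i j ω'' ^ 2 ∂P | pastSigma X i j a]) ω|

end

/-! By Stieltjes inversion it is enough to control the imaginary part of the normalized resolvent
trace, `spectralStat`, at countably many points `z` of the upper half plane.

Lindeberg's replacement is run pathwise in `X`. Order the lower triangle lexicographically. The
`q`-th hybrid freezes the entries before `q` at their observed values and averages the remaining
ones over the Gaussian law (`tailMean`). With `s = n ^ (-1/2)`, a Taylor expansion in one entry
writes the difference of consecutive hybrids as a weight of size `s ^ 3` times `X_q`, plus a weight
of size `s ^ 4` times `X_q ^ 2 - σ_q ^ 2`, plus an error of size `s ^ 4 * (min (X_q ^ 2) (|X_q| ^ 3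
* s) + s)`. Both weights depend only on entries before `q`. The resulting inequality,
`abs_lindeberg_le`, holds for every sequence, so no expectation over `X` is taken and almost sure
convergence stays within reach.

The linear sum is a martingale (`ae_tendsto_sum_mul_martingale_diff`). Truncate at a level of order
`n ^ (1/8)`: the bounded part has an eighth moment of order `n ^ (-2)` by an Azuma bound, and the
large part has a second moment of order `1 / (n h(n ^ (1/8)))`, summable by Cauchy condensation.

In the quadratic sum the weight also sees the neighbours of `q`, which the sigma-algebra at distance
`a` ignores. Setting them to zero makes the weight measurable at negligible cost. The truncated
squares are then centred by conditional expectations. For `a > 1` the sigma-algebras need not be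
nested along the enumeration, but they are nested for rows `a` apart, so splitting rows modulo `a`
restores martingale sums (`ae_tendsto_sum_mul_sq_sub_condExp`). Large values vanish on average by a
dyadic argument. What survives is the averaged conditional variance of the third assumption, removed
by choosing `a` large after `n` has gone to infinity.

Thus the statistic of `X` is asymptotic to the Gaussian mean, which converges by dominated
convergence to the Cauchy transform of `F`. `tendsto_levyDist_of_cauchyMean` turns this back into
Lévy convergence. -/

noncomputable section

/-! ### Resolvents of real symmetric matrices and trace bounds. -/

section Resolvent

open scoped Matrix.Norms.L2Operator

variable {n : ℕ}

/-- The resolvent `(A - z)⁻¹` of a real matrix at a complex number. -/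
def resolventMatrix (A : Matrix (Fin n) (Fin n) ℝ) (z : ℂ) : Matrix (Fin n) (Fin n) ℂ :=
  (A.map Complex.ofReal - Matrix.diagonal fun _ => z)⁻¹

/-- The real spectral theorem is transported entrywise to `ℂ`, so the complex resolvent is
diagonalized by the same real eigenvalues that enter `spectralDF`. -/
theorem Matrix.IsHermitian.exists_unitary_map_ofReal {A : Matrix (Fin n) (Fin n) ℝ}
    (hA : A.IsHermitian) : ∃ U ∈ unitary (Matrix (Fin n) (Fin n) ℂ),
      A.map Complex.ofReal =
        U * Matrix.diagonal (fun i => (hA.eigenvalues i : ℂ)) * star U := by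
  set V : Matrix (Fin n) (Fin n) ℝ := hA.eigenvectorUnitary.1 with hV
  have hV1 : star V * V = 1 := Unitary.coe_star_mul_self hA.eigenvectorUnitary
  have hV2 : V * star V = 1 := Unitary.coe_mul_star_self hA.eigenvectorUnitary
  have hstar : ∀ B : Matrix (Fin n) (Fin n) ℝ,
      star (B.map Complex.ofReal) = (star B).map Complex.ofReal := by
    intro B; ext i j; simp [Matrix.star_apply]
  have hmul : ∀ B D : Matrix (Fin n) (Fin n) ℝ,
      (B * D).map Complex.ofReal = B.map Complex.ofReal * D.map Complex.ofReal := fun B D =>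
    Matrix.map_mul (f := Complex.ofRealHom)
  have hone : (1 : Matrix (Fin n) (Fin n) ℝ).map Complex.ofReal = 1 :=
    Matrix.map_one _ Complex.ofReal_zero Complex.ofReal_one
  refine ⟨V.map Complex.ofReal, ?_, ?_⟩
  · rw [Unitary.mem_iff, hstar, ← hmul, ← hmul, hV1, hV2]
    exact ⟨hone, hone⟩
  · have h := hA.spectral_theorem
    rw [Unitary.conjStarAlgAut_apply] at h
    conv_lhs => rw [h]
    rw [hmul, hmul, hstar, Matrix.diagonal_map Complex.ofReal_zero]
    rfl

/-- The eigenvalues are real, so `Im z > 0` keeps every `λ - z` nonzero. The norm bound, the trace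
formula and the resolvent identity are all read off from this diagonalization. -/
theorem resolventMatrix_eq {A : Matrix (Fin n) (Fin n) ℝ} (hA : A.IsHermitian) {z : ℂ}
    (hz : 0 < z.im) :
    ∃ U ∈ unitary (Matrix (Fin n) (Fin n) ℂ),
      A.map Complex.ofReal - Matrix.diagonal (fun _ => z) =
        U * Matrix.diagonal (fun i => (hA.eigenvalues i : ℂ) - z) * star U ∧
      IsUnit (A.map Complex.ofReal - Matrix.diagonal (fun _ => z)).det ∧
      resolventMatrix A z =
        U * Matrix.diagonal (fun i => ((hA.eigenvalues i : ℂ) - z)⁻¹) * star U := by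
  obtain ⟨U, hU, h⟩ := hA.exists_unitary_map_ofReal
  have h1 : star U * U = 1 := (Unitary.mem_iff.mp hU).1
  have h2 : U * star U = 1 := (Unitary.mem_iff.mp hU).2
  have hne : ∀ i, (hA.eigenvalues i : ℂ) - z ≠ 0 := by
    intro i hi
    have := congrArg Complex.im hi
    simp at this
    linarith
  have heq : A.map Complex.ofReal - Matrix.diagonal (fun _ => z) =
        U * Matrix.diagonal (fun i => (hA.eigenvalues i : ℂ) - z) * star U := by
    have hd : Matrix.diagonal (fun i => (hA.eigenvalues i : ℂ) - z) =
        Matrix.diagonal (fun i => (hA.eigenvalues i : ℂ)) - Matrix.diagonal (fun _ => z) :=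
      (Matrix.diagonal_sub _ _).symm
    have hc : (Matrix.diagonal (fun _ => z) : Matrix (Fin n) (Fin n) ℂ) =
        z • (1 : Matrix (Fin n) (Fin n) ℂ) := by
      rw [Matrix.smul_one_eq_diagonal]
    rw [hd, mul_sub, sub_mul, ← h, hc, mul_smul_comm, smul_mul_assoc, mul_one, h2]
  have hinv : (A.map Complex.ofReal - Matrix.diagonal (fun _ => z)) *
      (U * Matrix.diagonal (fun i => ((hA.eigenvalues i : ℂ) - z)⁻¹) * star U) = 1 := by
    rw [heq]
    calc _ = U * (Matrix.diagonal (fun i => (hA.eigenvalues i : ℂ) - z) * (star U * U) *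
          Matrix.diagonal (fun i => ((hA.eigenvalues i : ℂ) - z)⁻¹)) * star U := by
            simp only [mul_assoc]
      _ = 1 := by
            rw [h1, mul_one, Matrix.diagonal_mul_diagonal]
            simp [hne, h2]
  exact ⟨U, hU, heq, (Matrix.isUnit_iff_isUnit_det _).mp (IsUnit.of_mul_eq_one _ hinv),
    Matrix.inv_eq_right_inv hinv⟩

theorem norm_resolventMatrix_le {A : Matrix (Fin n) (Fin n) ℝ} (hA : A.IsHermitian) {z : ℂ}
    (hz : 0 < z.im) : ‖resolventMatrix A z‖ ≤ z.im⁻¹ := by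
  obtain ⟨U, hU, -, -, h⟩ := resolventMatrix_eq hA hz
  have h3 := CStarRing.norm_mul_coe_unitary
    (U * Matrix.diagonal (fun i => ((hA.eigenvalues i : ℂ) - z)⁻¹)) (star ⟨U, hU⟩)
  have h4 := CStarRing.norm_coe_unitary_mul ⟨U, hU⟩
    (Matrix.diagonal (fun i => ((hA.eigenvalues i : ℂ) - z)⁻¹))
  rw [h]
  calc _ = _ := h3
    _ = _ := h4
    _ ≤ _ := by
      rw [Matrix.l2_opNorm_diagonal, pi_norm_le_iff_of_nonneg (by positivity)]
      intro i
      rw [norm_inv]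
      have := Complex.abs_im_le_norm ((hA.eigenvalues i : ℂ) - z)
      simp only [Complex.sub_im, Complex.ofReal_im, zero_sub, abs_neg, abs_of_pos hz] at this
      gcongr

theorem trace_resolventMatrix {A : Matrix (Fin n) (Fin n) ℝ} (hA : A.IsHermitian) {z : ℂ}
    (hz : 0 < z.im) :
    (resolventMatrix A z).trace = ∑ i, ((hA.eigenvalues i : ℂ) - z)⁻¹ := by
  obtain ⟨U, hU, -, -, h⟩ := resolventMatrix_eq hA hz
  rw [h, Matrix.trace_mul_comm, ← mul_assoc, (Unitary.mem_iff.mp hU).1, one_mul,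
    Matrix.trace_diagonal]

theorem resolventMatrix_sub {A B : Matrix (Fin n) (Fin n) ℝ} (hA : A.IsHermitian)
    (hB : B.IsHermitian) {z : ℂ} (hz : 0 < z.im) :
    resolventMatrix B z - resolventMatrix A z =
      -(resolventMatrix A z * (B - A).map Complex.ofReal * resolventMatrix B z) := by
  obtain ⟨-, -, -, huA, -⟩ := resolventMatrix_eq hA hz
  obtain ⟨-, -, -, huB, -⟩ := resolventMatrix_eq hB hz
  have hsub : (B - A).map Complex.ofReal =
      (B.map Complex.ofReal - Matrix.diagonal (fun _ => z)) -
      (A.map Complex.ofReal - Matrix.diagonal (fun _ => z)) := by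
    ext i j; simp
  have h1 : resolventMatrix A z * (A.map Complex.ofReal - Matrix.diagonal (fun _ => z)) = 1 :=
    Matrix.nonsing_inv_mul _ huA
  have h2 : (B.map Complex.ofReal - Matrix.diagonal (fun _ => z)) * resolventMatrix B z = 1 :=
    Matrix.mul_nonsing_inv _ huB
  rw [hsub, mul_sub, sub_mul, h1, mul_assoc, h2]
  simp

theorem Matrix.norm_apply_le_l2_opNorm (B : Matrix (Fin n) (Fin n) ℂ) (i j : Fin n) :
    ‖B i j‖ ≤ ‖B‖ := by
  have h := Matrix.l2_opNorm_mulVec B (EuclideanSpace.single j (1 : ℂ))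
  rw [PiLp.norm_single, norm_one, mul_one] at h
  refine le_trans ?_ h
  have h2 := PiLp.norm_apply_le ((EuclideanSpace.equiv (Fin n) ℂ).symm
    (B.mulVec (EuclideanSpace.single j (1 : ℂ)))) i
  refine le_trans (le_of_eq ?_) h2
  simp

theorem Matrix.norm_single_l2_le (i j : Fin n) (a : ℂ) :
    ‖(Matrix.single i j a : Matrix (Fin n) (Fin n) ℂ)‖ ≤ ‖a‖ := by
  rw [Matrix.l2_opNorm_def]
  refine ContinuousLinearMap.opNorm_le_bound _ (norm_nonneg _) fun x => ?_
  have : ((Matrix.toEuclideanLin (𝕜 := ℂ) (m := Fin n) (n := Fin n)).trans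
      LinearMap.toContinuousLinearMap (Matrix.single i j a)) x =
      EuclideanSpace.single i (a * x j) := by
    ext k
    simp [Matrix.toLpLin_apply, Matrix.single_mulVec, Function.update_apply]
  rw [this, PiLp.norm_single, norm_mul]
  gcongr
  exact PiLp.norm_apply_le x j

/-- The sum of the absolute values of the entries. -/
def entrySum (E : Matrix (Fin n) (Fin n) ℝ) : ℝ := ∑ i, ∑ j, |E i j|

theorem norm_map_ofReal_le_entrySum (E : Matrix (Fin n) (Fin n) ℝ) :
    ‖E.map Complex.ofReal‖ ≤ entrySum E := by
  rw [Matrix.matrix_eq_sum_single (E.map Complex.ofReal)]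
  refine (norm_sum_le _ _).trans (Finset.sum_le_sum fun i _ => ?_)
  refine (norm_sum_le _ _).trans (Finset.sum_le_sum fun j _ => ?_)
  refine (Matrix.norm_single_l2_le _ _ _).trans ?_
  simp

/-- A perturbation with few nonzero entries meets only few entries of `B`, each at most `‖B‖`. The
trace thus loses no factor `n`, and the normalization `n⁻¹` remains a gain in every Taylor
coefficient. -/
theorem norm_trace_mul_le_entrySum (B : Matrix (Fin n) (Fin n) ℂ) (E : Matrix (Fin n) (Fin n) ℝ) :
    ‖(E.map Complex.ofReal * B).trace‖ ≤ entrySum E * ‖B‖ := by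
  simp only [Matrix.trace, Matrix.diag, Matrix.mul_apply, entrySum, Finset.sum_mul]
  refine (norm_sum_le _ _).trans (Finset.sum_le_sum fun i _ => ?_)
  refine (norm_sum_le _ _).trans (Finset.sum_le_sum fun j _ => ?_)
  rw [norm_mul]
  simp only [Matrix.map_apply, Complex.norm_real, Real.norm_eq_abs]
  gcongr
  exact Matrix.norm_apply_le_l2_opNorm B j i

/-- The imaginary part of the normalized trace. -/
def imTrace (B : Matrix (Fin n) (Fin n) ℂ) : ℝ := (n : ℝ)⁻¹ * B.trace.im

theorem imTrace_add (B D : Matrix (Fin n) (Fin n) ℂ) : imTrace (B + D) = imTrace B + imTrace D := by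
  simp [imTrace, mul_add]

theorem imTrace_sub (B D : Matrix (Fin n) (Fin n) ℂ) : imTrace (B - D) = imTrace B - imTrace D := by
  simp [imTrace, mul_sub]

theorem imTrace_ofReal_smul (t : ℝ) (B : Matrix (Fin n) (Fin n) ℂ) :
    imTrace ((t : ℂ) • B) = t * imTrace B := by
  simp [imTrace]; ring

theorem abs_imTrace_mul_mul_le (B D : Matrix (Fin n) (Fin n) ℂ) (E : Matrix (Fin n) (Fin n) ℝ) :
    |imTrace (B * E.map Complex.ofReal * D)| ≤ (n : ℝ)⁻¹ * (entrySum E * (‖D‖ * ‖B‖)) := by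
  rw [imTrace, abs_mul, abs_of_nonneg (by positivity : (0 : ℝ) ≤ (n : ℝ)⁻¹)]
  gcongr
  refine (Complex.abs_im_le_norm _).trans ?_
  rw [mul_assoc, Matrix.trace_mul_comm, mul_assoc]
  refine (norm_trace_mul_le_entrySum _ _).trans ?_
  have : 0 ≤ entrySum E := Finset.sum_nonneg fun i _ => Finset.sum_nonneg fun j _ => abs_nonneg _
  gcongr
  exact norm_mul_le _ _

theorem abs_imTrace_le (B : Matrix (Fin n) (Fin n) ℂ) : |imTrace B| ≤ ‖B‖ := by
  rcases Nat.eq_zero_or_pos n with rfl | hn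
  · simp [imTrace]
  rw [imTrace, abs_mul, abs_of_nonneg (by positivity : (0 : ℝ) ≤ (n : ℝ)⁻¹)]
  rw [inv_mul_le_iff₀ (by positivity)]
  refine (Complex.abs_im_le_norm _).trans ((norm_sum_le _ _).trans ?_)
  refine (Finset.sum_le_sum fun i _ => Matrix.norm_apply_le_l2_opNorm B i i).trans ?_
  simp

end Resolvent

/-! ### Taylor expansion of the resolvent trace along a line of matrices. -/

section ResolventExpansion

open scoped Matrix.Norms.L2Operator

variable {n : ℕ}

theorem entrySum_nonneg (E : Matrix (Fin n) (Fin n) ℝ) : 0 ≤ entrySum E :=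
  Finset.sum_nonneg fun _ _ => Finset.sum_nonneg fun _ _ => abs_nonneg _

/-- The first derivative at `t = 0` of `imTrace (resolventMatrix (A + t • E) z)`. -/
def resolventCoeffOne (A E : Matrix (Fin n) (Fin n) ℝ) (z : ℂ) : ℝ :=
  -imTrace (resolventMatrix A z * E.map Complex.ofReal * resolventMatrix A z)

/-- Half the second derivative at `t = 0` of `imTrace (resolventMatrix (A + t • E) z)`. -/
def resolventCoeffTwo (A E : Matrix (Fin n) (Fin n) ℝ) (z : ℂ) : ℝ :=
  imTrace (resolventMatrix A z * E.map Complex.ofReal *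
    (resolventMatrix A z * E.map Complex.ofReal * resolventMatrix A z))

variable {A E : Matrix (Fin n) (Fin n) ℝ} {z : ℂ}

theorem norm_mul_map_mul_le (hA : A.IsHermitian) (hz : 0 < z.im)
    {B : Matrix (Fin n) (Fin n) ℂ} {b : ℝ} (hB : ‖B‖ ≤ b) :
    ‖resolventMatrix A z * E.map Complex.ofReal * B‖ ≤ z.im⁻¹ * entrySum E * b := by
  have := entrySum_nonneg E
  refine (norm_mul_le _ _).trans (mul_le_mul ((norm_mul_le _ _).trans ?_) hB (norm_nonneg _)
    (by positivity))
  exact mul_le_mul (norm_resolventMatrix_le hA hz) (norm_map_ofReal_le_entrySum E) (norm_nonneg _)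
    (by positivity)

theorem abs_imTrace_resolvent_mul_le (hA : A.IsHermitian) (hz : 0 < z.im)
    {B : Matrix (Fin n) (Fin n) ℂ} {b : ℝ} (hB : ‖B‖ ≤ b) :
    |imTrace (resolventMatrix A z * E.map Complex.ofReal * B)| ≤
      (n : ℝ)⁻¹ * (entrySum E * (b * z.im⁻¹)) := by
  refine (abs_imTrace_mul_mul_le _ _ _).trans ?_
  have := entrySum_nonneg E
  have := (norm_nonneg B).trans hB
  gcongr
  exact norm_resolventMatrix_le hA hz

theorem abs_resolventCoeffOne_le (hA : A.IsHermitian) (hz : 0 < z.im)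
    :
    |resolventCoeffOne A E z| ≤ (n : ℝ)⁻¹ * (entrySum E * (z.im⁻¹ * z.im⁻¹)) := by
  rw [resolventCoeffOne, abs_neg]
  exact abs_imTrace_resolvent_mul_le hA hz (norm_resolventMatrix_le hA hz)

theorem abs_resolventCoeffTwo_le (hA : A.IsHermitian) (hz : 0 < z.im)
    :
    |resolventCoeffTwo A E z| ≤
      (n : ℝ)⁻¹ * (entrySum E * (z.im⁻¹ * entrySum E * z.im⁻¹ * z.im⁻¹)) :=
  abs_imTrace_resolvent_mul_le hA hz
    (norm_mul_map_mul_le hA hz (norm_resolventMatrix_le hA hz))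

theorem resolventMatrix_add_smul (hA : A.IsHermitian) (hz : 0 < z.im)
    (t : ℝ) (hE : E.IsHermitian) :
    resolventMatrix (A + t • E) z = resolventMatrix A z -
      (t : ℂ) • (resolventMatrix A z * E.map Complex.ofReal * resolventMatrix (A + t • E) z) := by
  have hB : (A + t • E).IsHermitian := hA.add (by
    rw [Matrix.IsHermitian, Matrix.conjTranspose_smul, hE.eq]; simp)
  have h := resolventMatrix_sub hA hB hz
  have h2 : (A + t • E - A).map Complex.ofReal = (t : ℂ) • E.map Complex.ofReal := by
    ext i j; simp
  rw [h2, mul_smul_comm, smul_mul_assoc] at h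
  rw [sub_eq_iff_eq_add] at h
  conv_lhs => rw [h]
  abel

theorem isHermitian_add_smul (hA : A.IsHermitian) (hE : E.IsHermitian)
    (t : ℝ) : (A + t • E).IsHermitian :=
  hA.add (by rw [Matrix.IsHermitian, Matrix.conjTranspose_smul, hE.eq]; simp)

/-- Two applications of the resolvent identity give an exact remainder, with the perturbed resolvent
only in the last position; no differentiation is needed. -/
theorem imTrace_resolvent_expansion (hA : A.IsHermitian) (hE : E.IsHermitian) (hz : 0 < z.im)
    (t : ℝ) :
    imTrace (resolventMatrix (A + t • E) z) - imTrace (resolventMatrix A z)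
        - resolventCoeffOne A E z * t =
      t ^ 2 * imTrace (resolventMatrix A z * E.map Complex.ofReal *
        (resolventMatrix A z * E.map Complex.ofReal * resolventMatrix (A + t • E) z)) := by
  have h := resolventMatrix_add_smul hA hz t hE
  set S := resolventMatrix (A + t • E) z
  set R := resolventMatrix A z with hR
  have e1 : S = R - (t : ℂ) • (R * E.map Complex.ofReal * R) +
      ((t ^ 2 : ℝ) : ℂ) • (R * E.map Complex.ofReal * (R * E.map Complex.ofReal * S)) := by
    have e2 : R * E.map Complex.ofReal * S = R * E.map Complex.ofReal * R -
        (t : ℂ) • (R * E.map Complex.ofReal * (R * E.map Complex.ofReal * S)) := by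
      conv_lhs => rw [h]
      rw [mul_sub, mul_smul_comm]
    conv_lhs => rw [h, e2]
    rw [smul_sub, smul_smul, sq, Complex.ofReal_mul]
    abel
  conv_lhs => rw [e1]
  rw [imTrace_add, imTrace_sub, imTrace_ofReal_smul, imTrace_ofReal_smul, resolventCoeffOne, ← hR]
  ring

/-- The exact quadratic remainder and the second-order term are bounded separately, hence the factor
`2`. This form serves large `t`, where only second moments are available. -/
theorem abs_taylor_le_sq (hA : A.IsHermitian) (hE : E.IsHermitian) (hz : 0 < z.im)
    (t : ℝ) :
    |imTrace (resolventMatrix (A + t • E) z) - imTrace (resolventMatrix A z)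
        - resolventCoeffOne A E z * t - resolventCoeffTwo A E z * t ^ 2| ≤
      2 * ((n : ℝ)⁻¹ * (entrySum E * (z.im⁻¹ * entrySum E * z.im⁻¹ * z.im⁻¹))) * t ^ 2 := by
  rw [imTrace_resolvent_expansion hA hE hz t, mul_comm, ← sub_mul, abs_mul,
    abs_of_nonneg (sq_nonneg t), two_mul]
  refine mul_le_mul_of_nonneg_right ((abs_sub _ _).trans (add_le_add ?_ ?_)) (sq_nonneg t)
  · exact abs_imTrace_resolvent_mul_le hA hz (norm_mul_map_mul_le hA hz
      (norm_resolventMatrix_le (isHermitian_add_smul hA hE t) hz))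
  · exact abs_resolventCoeffTwo_le hA hz

/-- A third use of the resolvent identity, on the difference of the two quadratic terms, gains the
factor needed for small `t`. -/
theorem abs_taylor_le_cube (hA : A.IsHermitian) (hE : E.IsHermitian) (hz : 0 < z.im)
    (t : ℝ) :
    |imTrace (resolventMatrix (A + t • E) z) - imTrace (resolventMatrix A z)
        - resolventCoeffOne A E z * t - resolventCoeffTwo A E z * t ^ 2| ≤
      (n : ℝ)⁻¹ * (entrySum E *
        (z.im⁻¹ * entrySum E * (z.im⁻¹ * entrySum E * z.im⁻¹) * z.im⁻¹)) * |t| ^ 3 := by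
  rw [imTrace_resolvent_expansion hA hE hz t, mul_comm (resolventCoeffTwo A E z), ← mul_sub,
    resolventCoeffTwo, ← imTrace_sub, ← mul_sub, ← mul_sub]
  have h := resolventMatrix_add_smul hA hz t hE
  have h2 : resolventMatrix (A + t • E) z - resolventMatrix A z = ((-t : ℝ) : ℂ) •
      (resolventMatrix A z * E.map Complex.ofReal * resolventMatrix (A + t • E) z) := by
    conv_lhs => rw [h]
    simp
  rw [h2, mul_smul_comm, mul_smul_comm, imTrace_ofReal_smul, abs_mul, abs_mul, abs_neg, abs_pow]
  have := abs_imTrace_resolvent_mul_le (E := E) hA hz (norm_mul_map_mul_le (E := E) hA hz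
    (norm_mul_map_mul_le (E := E) hA hz
      (norm_resolventMatrix_le (isHermitian_add_smul hA hE t) hz)))
  calc _ = |imTrace (resolventMatrix A z * E.map Complex.ofReal * (resolventMatrix A z *
          E.map Complex.ofReal * (resolventMatrix A z * E.map Complex.ofReal *
          resolventMatrix (A + t • E) z)))| * |t| ^ 3 := by ring
    _ ≤ _ := by gcongr

theorem abs_resolventCoeffTwo_sub_le (hA : A.IsHermitian) (hz : 0 < z.im)
    {F : Matrix (Fin n) (Fin n) ℝ} (hF : F.IsHermitian)
    (t : ℝ) :
    |resolventCoeffTwo (A + t • F) E z - resolventCoeffTwo A E z| ≤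
      3 * ((n : ℝ)⁻¹ * (entrySum E * (z.im⁻¹ * entrySum E * z.im⁻¹ *
        (z.im⁻¹ * entrySum F * z.im⁻¹)))) * |t| := by
  have hB := isHermitian_add_smul hA hF t
  have h := resolventMatrix_add_smul hA hz t hF
  have h2 : resolventMatrix (A + t • F) z - resolventMatrix A z = ((-t : ℝ) : ℂ) •
      (resolventMatrix A z * F.map Complex.ofReal * resolventMatrix (A + t • F) z) := by
    conv_lhs => rw [h]
    simp
  have hRS := norm_mul_map_mul_le (E := F) hA hz (norm_resolventMatrix_le hB hz)
  have hR0 := norm_resolventMatrix_le hA hz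
  have hS0 := norm_resolventMatrix_le hB hz
  rw [resolventCoeffTwo, resolventCoeffTwo]
  set S := resolventMatrix (A + t • F) z
  set R := resolventMatrix A z
  set D := R * F.map Complex.ofReal * S
  set G := E.map Complex.ofReal with hG
  have hf := entrySum_nonneg F
  have he := entrySum_nonneg E
  have hG0 : ‖G‖ ≤ entrySum E := norm_map_ofReal_le_entrySum E
  -- The three resolvents are exchanged one at a time; each exchange produces a factor `-t • D`,
  -- hence the constant `3`.
  have key : S * G * (S * G * S) - R * G * (R * G * R) =
      ((-t : ℝ) : ℂ) • (S * G * (S * G * D) + S * G * (D * G * R) + D * G * (R * G * R)) := by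
    have e : ((-t : ℝ) : ℂ) • (S * G * (S * G * D) + S * G * (D * G * R) + D * G * (R * G * R)) =
        S * G * (S * G * (((-t : ℝ) : ℂ) • D)) + S * G * ((((-t : ℝ) : ℂ) • D) * G * R) +
          (((-t : ℝ) : ℂ) • D) * G * (R * G * R) := by
      simp only [mul_smul_comm, smul_mul_assoc, smul_add]
    rw [e, ← h2]
    noncomm_ring
  rw [← imTrace_sub, key, imTrace_ofReal_smul, imTrace_add, imTrace_add, abs_mul, abs_neg,
    mul_comm |t|]
  refine mul_le_mul_of_nonneg_right ?_ (abs_nonneg t)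
  have b1 : |imTrace (S * G * (S * G * D))| ≤ _ := abs_imTrace_mul_mul_le S (S * G * D) E
  have b2 : |imTrace (S * G * (D * G * R))| ≤ _ := abs_imTrace_mul_mul_le S (D * G * R) E
  have b3 : |imTrace (D * G * (R * G * R))| ≤ _ := abs_imTrace_mul_mul_le D (R * G * R) E
  have hv : 0 < z.im⁻¹ := by positivity
  set v := z.im⁻¹
  set d := v * entrySum F * v with hd
  have hd0 : 0 ≤ d := by positivity
  have m3 : ∀ {P Q : Matrix (Fin n) (Fin n) ℂ} {p q : ℝ}, ‖P‖ ≤ p → ‖Q‖ ≤ q →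
      ‖P * G * Q‖ ≤ p * entrySum E * q := by
    intro P Q p q hP hQ
    have := (norm_nonneg P).trans hP
    exact (norm_mul_le _ _).trans (mul_le_mul ((norm_mul_le _ _).trans
      (mul_le_mul hP hG0 (norm_nonneg _) this)) hQ (norm_nonneg _) (by positivity))
  have c1 : ‖S * G * D‖ * ‖S‖ ≤ (v * entrySum E * d) * v :=
    mul_le_mul (m3 hS0 hRS) hS0 (norm_nonneg _) (by positivity)
  have c2 : ‖D * G * R‖ * ‖S‖ ≤ (d * entrySum E * v) * v :=
    mul_le_mul (m3 hRS hR0) hS0 (norm_nonneg _) (by positivity)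
  have c3 : ‖R * G * R‖ * ‖D‖ ≤ (v * entrySum E * v) * d :=
    mul_le_mul (m3 hR0 hR0) hRS (norm_nonneg _) (by positivity)
  have hn : (0 : ℝ) ≤ (n : ℝ)⁻¹ := by positivity
  refine (abs_add_three _ _ _).trans ((add_le_add (add_le_add b1 b2) b3).trans ?_)
  have w : ∀ {r : ℝ}, r ≤ v * entrySum E * v * d →
      (n : ℝ)⁻¹ * (entrySum E * r) ≤ (n : ℝ)⁻¹ * (entrySum E * (v * entrySum E * v * d)) := by
    intro r hr; gcongr
  have w1 := w (r := ‖S * G * D‖ * ‖S‖) (c1.trans (le_of_eq (by ring)))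
  have w2 := w (r := ‖D * G * R‖ * ‖S‖) (c2.trans (le_of_eq (by ring)))
  have w3 := w (r := ‖R * G * R‖ * ‖D‖) (c3.trans (le_of_eq (by ring)))
  linarith

end ResolventExpansion

/-! ### Lexicographic enumeration of the lower triangle. -/

section Enumeration

/-- The triangular numbers. -/
def triNum (n : ℕ) : ℕ := ∑ k ∈ Finset.range n, (k + 1)

theorem triNum_succ (n : ℕ) : triNum (n + 1) = triNum n + (n + 1) := Finset.sum_range_succ _ _

theorem triNum_mono : Monotone triNum := monotone_nat_of_le_succ fun n => by
  rw [triNum_succ]; omega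

theorem triNum_le_sq (n : ℕ) : triNum n ≤ n ^ 2 := by
  induction n with
  | zero => simp [triNum]
  | succ n ih => rw [triNum_succ]; nlinarith

/-- The enumeration of `{(i, j) | 1 ≤ j ≤ i}` in lexicographic order. -/
def lexEnum : ℕ → ℕ × ℕ
  | 0 => (1, 1)
  | q + 1 => if (lexEnum q).2 < (lexEnum q).1 then ((lexEnum q).1, (lexEnum q).2 + 1)
      else ((lexEnum q).1 + 1, 1)

/-- The inverse of `lexEnum`. -/
def lexIndex (i j : ℕ) : ℕ := triNum (i - 1) + (j - 1)

theorem lexEnum_spec (q : ℕ) : 1 ≤ (lexEnum q).2 ∧ (lexEnum q).2 ≤ (lexEnum q).1 ∧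
    lexIndex (lexEnum q).1 (lexEnum q).2 = q := by
  induction q with
  | zero => simp [lexEnum, lexIndex, triNum]
  | succ q ih =>
    obtain ⟨h1, h2, h3⟩ := ih
    rw [lexEnum]
    split_ifs with h
    · refine ⟨by simp, h, ?_⟩
      simp only [lexIndex] at h3 ⊢
      omega
    · refine ⟨le_rfl, by simp, ?_⟩
      simp only [lexIndex] at h3 ⊢
      have h4 : (lexEnum q).1 + 1 - 1 = ((lexEnum q).1 - 1) + 1 := by omega
      rw [h4, triNum_succ]
      omega

theorem lexEnum_triNum_add {i j : ℕ} (h : j ≤ i) : lexEnum (triNum i + j) = (i + 1, j + 1) := by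
  induction i generalizing j with
  | zero =>
    obtain rfl : j = 0 := by omega
    simp [triNum, lexEnum]
  | succ i ih =>
    induction j with
    | zero =>
      rw [triNum_succ, add_zero, ← add_assoc, lexEnum, ih le_rfl]
      simp
    | succ j ihj =>
      rw [← add_assoc, lexEnum, ihj (by omega)]
      simp only
      rw [if_pos (by omega)]

theorem lexEnum_lexIndex {i j : ℕ} (hj : 1 ≤ j) (hij : j ≤ i) : lexEnum (lexIndex i j) = (i, j) := by
  rw [lexIndex, lexEnum_triNum_add (by omega)]
  ext <;> simp <;> omega

theorem lexIndex_lt {i j n : ℕ} (hj : 1 ≤ j) (hij : j ≤ i) (hi : i ≤ n) :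
    lexIndex i j < triNum n := by
  have h : triNum (i - 1 + 1) ≤ triNum n := triNum_mono (by omega)
  rw [triNum_succ] at h
  simp only [lexIndex]
  omega

theorem lexEnum_lt {p q : ℕ} (h : p < q) : (lexEnum p).1 < (lexEnum q).1 ∨
    ((lexEnum p).1 = (lexEnum q).1 ∧ (lexEnum p).2 < (lexEnum q).2) := by
  induction q, h using Nat.le_induction with
  | base => rw [lexEnum]; split_ifs <;> simp
  | succ q hq ih => rw [lexEnum]; split_ifs <;> simp <;> omega

theorem sum_range_triNum {M : Type*} [AddCommMonoid M] (g : ℕ → ℕ → M) (n : ℕ) :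
    ∑ q ∈ Finset.range (triNum n), g (lexEnum q).1 (lexEnum q).2 =
      ∑ i ∈ Finset.Icc 1 n, ∑ j ∈ Finset.Icc 1 i, g i j := by
  induction n with
  | zero => simp [triNum]
  | succ n ih =>
    rw [triNum_succ, Finset.sum_range_add, ih, Finset.sum_Icc_succ_top (by omega)]
    congr 1
    rw [← Finset.Ico_add_one_right_eq_Icc, Finset.sum_Ico_eq_sum_range]
    refine Finset.sum_congr (by simp) fun j hj => ?_
    rw [lexEnum_triNum_add (by simp at hj; omega), add_comm 1 j]

end Enumeration

/-! ### The spectral statistic as a function of the sequence of entries. -/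

section SpectralStatistic

/-- The symmetric matrix whose lower triangle is filled in lexicographic order. -/
def seqMatrix (n : ℕ) (x : ℕ → ℝ) : Matrix (Fin n) (Fin n) ℝ :=
  wignerMatrix (fun i j => x (lexIndex i j)) n

theorem seqMatrix_isHermitian (n : ℕ) (x : ℕ → ℝ) : (seqMatrix n x).IsHermitian :=
  wignerMatrix_isHermitian _ n

theorem seqMatrix_comp_lexEnum (n : ℕ) (x : ℕ → ℕ → ℝ) :
    seqMatrix n (fun q => x (lexEnum q).1 (lexEnum q).2) = wignerMatrix x n := by
  ext i j
  simp only [seqMatrix, wignerMatrix, Matrix.of_apply]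
  split_ifs with h
  · rw [lexEnum_lexIndex (by omega) (by simpa using h)]
  · rw [lexEnum_lexIndex (by omega) (by have := not_le.mp h; simpa using this.le)]

theorem seqMatrix_congr {n : ℕ} {x y : ℕ → ℝ} (h : ∀ q < triNum n, x q = y q) :
    seqMatrix n x = seqMatrix n y := by
  ext i j
  simp only [seqMatrix, wignerMatrix, Matrix.of_apply]
  split_ifs with hij
  · rw [h _ (lexIndex_lt (by omega) (by simpa using hij) i.2)]
  · rw [h _ (lexIndex_lt (by omega) (by have := not_le.mp hij; simpa using this.le) j.2)]

theorem seqMatrix_update (n : ℕ) (x : ℕ → ℝ) (q : ℕ) (t : ℝ) :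
    seqMatrix n (Function.update x q t) =
      seqMatrix n (Function.update x q 0) + t • seqMatrix n (Pi.single q 1) := by
  ext i j
  simp only [seqMatrix, wignerMatrix, Matrix.of_apply, Matrix.add_apply, Matrix.smul_apply,
    Function.update_apply, Pi.single_apply, smul_eq_mul]
  split_ifs <;> ring

/-- One coordinate fills at most two symmetric positions of the matrix, each with the value `n ^
(-1/2)`. -/
theorem entrySum_seqMatrix_single_le (n q : ℕ) :
    entrySum (seqMatrix n (Pi.single q 1)) ≤ 2 * (√(n : ℝ))⁻¹ := by
  have hone : ∀ a : ℕ, ∑ i : Fin n, (if (i : ℕ) + 1 = a then (1 : ℝ) else 0) ≤ 1 := by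
    intro a
    rw [Finset.sum_ite, Finset.sum_const_zero, add_zero, Finset.sum_const, nsmul_eq_mul, mul_one]
    have : (Finset.univ.filter fun i : Fin n => (i : ℕ) + 1 = a).card ≤ 1 := by
      rw [Finset.card_le_one]
      intro i hi j hj
      simp at hi hj
      omega
    exact_mod_cast this
  have hprod : ∀ a b : ℕ, ∑ i : Fin n, ∑ j : Fin n,
      (if (i : ℕ) + 1 = a then (1 : ℝ) else 0) * (if (j : ℕ) + 1 = b then (1 : ℝ) else 0) ≤ 1 := by
    intro a b
    rw [← Finset.sum_mul_sum]
    exact mul_le_one₀ (hone a) (Finset.sum_nonneg fun _ _ => by split_ifs <;> simp) (hone b)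
  have hs : (0 : ℝ) ≤ (√(n : ℝ))⁻¹ := by positivity
  have hent : ∀ i j : Fin n, |seqMatrix n (Pi.single q 1) i j| ≤ (√(n : ℝ))⁻¹ *
      ((if (i : ℕ) + 1 = (lexEnum q).1 then (1 : ℝ) else 0) *
        (if (j : ℕ) + 1 = (lexEnum q).2 then (1 : ℝ) else 0) +
      (if (i : ℕ) + 1 = (lexEnum q).2 then (1 : ℝ) else 0) *
        (if (j : ℕ) + 1 = (lexEnum q).1 then (1 : ℝ) else 0)) := by
    intro i j
    simp only [seqMatrix, wignerMatrix, Matrix.of_apply, abs_mul, abs_of_nonneg hs]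
    gcongr
    have hnn : ∀ (p : Prop) [Decidable p], (0 : ℝ) ≤ if p then 1 else 0 := by
      intro p _; split_ifs <;> simp
    by_cases h : j ≤ i
    · rw [if_pos h]
      by_cases hq : lexIndex (i + 1) (j + 1) = q
      · have h1 := lexEnum_lexIndex (i := i + 1) (j := j + 1) (by omega) (by simpa using h)
        rw [hq, Prod.ext_iff] at h1
        rw [hq, Pi.single_eq_same, abs_one, if_pos h1.1.symm, if_pos h1.2.symm, mul_one]
        exact le_add_of_nonneg_right (mul_nonneg (hnn _) (hnn _))
      · rw [Pi.single_eq_of_ne hq, abs_zero]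
        exact add_nonneg (mul_nonneg (hnn _) (hnn _)) (mul_nonneg (hnn _) (hnn _))
    · rw [if_neg h]
      by_cases hq : lexIndex (j + 1) (i + 1) = q
      · have h1 := lexEnum_lexIndex (i := j + 1) (j := i + 1) (by omega)
          (by have := not_le.mp h; simpa using this.le)
        rw [hq, Prod.ext_iff] at h1
        rw [hq, Pi.single_eq_same, abs_one, if_pos h1.1.symm, if_pos h1.2.symm, mul_one]
        exact le_add_of_nonneg_left (mul_nonneg (hnn _) (hnn _))
      · rw [Pi.single_eq_of_ne hq, abs_zero]
        exact add_nonneg (mul_nonneg (hnn _) (hnn _)) (mul_nonneg (hnn _) (hnn _))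
  refine (Finset.sum_le_sum fun i _ => Finset.sum_le_sum fun j _ => hent i j).trans ?_
  simp only [← Finset.mul_sum, Finset.sum_add_distrib]
  simp only [Finset.mul_sum]
  rw [mul_comm]
  simp only [← Finset.mul_sum]
  gcongr
  have h1 := hprod (lexEnum q).1 (lexEnum q).2
  have h2 := hprod (lexEnum q).2 (lexEnum q).1
  simp only [← Finset.mul_sum] at h1 h2
  linarith

/-- A real function `T` of a sequence with uniform second-order Taylor expansions in each
coordinate at `0`; the scale `s` plays the role of `n ^ (-1/2)` for functions of an array of size
`n ^ 2`. -/
structure HasTaylorBounds (s K : ℝ) (T : (ℕ → ℝ) → ℝ) (c₁ c₂ : ℕ → (ℕ → ℝ) → ℝ) : Prop where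
  scale_nonneg : 0 ≤ s
  const_nonneg : 0 ≤ K
  measurable : Measurable T
  measurable_one : ∀ q, Measurable (c₁ q)
  measurable_two : ∀ q, Measurable (c₂ q)
  bound : ∀ x, |T x| ≤ K
  bound_one : ∀ q x, |c₁ q x| ≤ K * s ^ 3
  bound_two : ∀ q x, |c₂ q x| ≤ K * s ^ 4
  update_one : ∀ q x t, c₁ q (Function.update x q t) = c₁ q x
  update_two : ∀ q x t, c₂ q (Function.update x q t) = c₂ q x
  taylor : ∀ q x t, |T (Function.update x q t) - T (Function.update x q 0) - c₁ q x * t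
    - c₂ q x * t ^ 2| ≤ K * s ^ 4 * min (t ^ 2) (|t| ^ 3 * s)
  lipschitz_two : ∀ q x p t, |c₂ q (Function.update x p t) - c₂ q (Function.update x p 0)| ≤
    K * s ^ 4 * min 1 (|t| * s)

/-- The imaginary part of the Stieltjes transform of the spectral distribution. -/
def spectralStat (n : ℕ) (z : ℂ) (x : ℕ → ℝ) : ℝ := imTrace (resolventMatrix (seqMatrix n x) z)

/-- The first-order coefficient of `spectralStat`. -/
def spectralStatOne (n : ℕ) (z : ℂ) (q : ℕ) (x : ℕ → ℝ) : ℝ :=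
  resolventCoeffOne (seqMatrix n (Function.update x q 0)) (seqMatrix n (Pi.single q 1)) z

/-- The second-order coefficient of `spectralStat`. -/
def spectralStatTwo (n : ℕ) (z : ℂ) (q : ℕ) (x : ℕ → ℝ) : ℝ :=
  resolventCoeffTwo (seqMatrix n (Function.update x q 0)) (seqMatrix n (Pi.single q 1)) z

/-- By the adjugate formula the resolvent is rational in the entries, and its determinant never
vanishes when `Im z > 0`. -/
theorem continuous_resolventMatrix_seqMatrix (n : ℕ) {z : ℂ} (hz : 0 < z.im) :
    Continuous fun x => resolventMatrix (seqMatrix n x) z := by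
  have hM : Continuous fun x : ℕ → ℝ =>
      (seqMatrix n x).map Complex.ofReal - Matrix.diagonal (fun _ => z) := by
    refine Continuous.sub ?_ continuous_const
    refine continuous_matrix fun i j => ?_
    simp only [Matrix.map_apply, seqMatrix, wignerMatrix, Matrix.of_apply]
    split_ifs <;> fun_prop
  simp only [resolventMatrix, Matrix.inv_def, Ring.inverse_eq_inv']
  refine Continuous.smul (hM.matrix_det.inv₀ fun x => ?_) hM.matrix_adjugate
  obtain ⟨-, -, -, hu, -⟩ := resolventMatrix_eq (seqMatrix_isHermitian n x) hz
  exact hu.ne_zero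

theorem continuous_imTrace (n : ℕ) :
    Continuous (imTrace : Matrix (Fin n) (Fin n) ℂ → ℝ) := by
  unfold imTrace
  exact continuous_const.mul (Complex.continuous_im.comp (Continuous.matrix_trace continuous_id))

/-- A constant for the Taylor bounds of `spectralStat`. -/
def spectralStatConst (z : ℂ) : ℝ :=
  z.im⁻¹ + 24 * z.im⁻¹ ^ 2 + 24 * z.im⁻¹ ^ 3 + 24 * z.im⁻¹ ^ 4

/-- Counting powers of `s`: the normalized trace contributes `s ^ 2` and each occurrence of the
perturbation one more `s`, which gives `s ^ 3`, `s ^ 4` and `s ^ 5` at orders one, two and three. -/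
theorem hasTaylorBounds_spectralStat (n : ℕ) {z : ℂ} (hz : 0 < z.im) :
    HasTaylorBounds (√(n : ℝ))⁻¹ (spectralStatConst z) (spectralStat n z) (spectralStatOne n z)
      (spectralStatTwo n z) := by
  have hw : 0 < z.im⁻¹ := by positivity
  have hcont := continuous_resolventMatrix_seqMatrix n hz
  have hupd : ∀ q : ℕ, Continuous fun x : ℕ → ℝ => Function.update x q 0 := fun q =>
    continuous_id.update q continuous_const
  have hs : (0 : ℝ) ≤ (√(n : ℝ))⁻¹ := by positivity
  -- This also holds at `n = 0`, where both sides are `0`.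
  have hn : (n : ℝ)⁻¹ = (√(n : ℝ))⁻¹ ^ 2 := by
    rw [inv_pow, Real.sq_sqrt (Nat.cast_nonneg n)]
  have hH := seqMatrix_isHermitian n
  have hE := entrySum_seqMatrix_single_le n
  have hE0 : ∀ q, 0 ≤ entrySum (seqMatrix n (Pi.single q 1)) := fun q => entrySum_nonneg _
  unfold spectralStatConst
  set w := z.im⁻¹
  set s := (√(n : ℝ))⁻¹
  have hK : ∀ {a b : ℝ}, 0 ≤ b → a ≤ w + 24 * w ^ 2 + 24 * w ^ 3 + 24 * w ^ 4 →
      a * b ≤ (w + 24 * w ^ 2 + 24 * w ^ 3 + 24 * w ^ 4) * b := fun hb hab => by gcongr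
  have w2 : 0 ≤ w ^ 2 := by positivity
  have w3 : 0 ≤ w ^ 3 := by positivity
  have w4 : 0 ≤ w ^ 4 := by positivity
  have btwo : ∀ q x, |spectralStatTwo n z q x| ≤ 4 * w ^ 3 * s ^ 4 := by
    intro q x
    refine (abs_resolventCoeffTwo_le (hH _) hz).trans ?_
    rw [hn]
    have := hE q
    have := hE0 q
    calc _ ≤ s ^ 2 * ((2 * s) * (w * (2 * s) * w * w)) := by gcongr
      _ = _ := by ring
  refine ⟨hs, by positivity, ?_, ?_, ?_, ?_, ?_, ?_, ?_, ?_, ?_, ?_⟩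
  · exact ((continuous_imTrace n).comp hcont).measurable
  · intro q
    refine Continuous.measurable ?_
    unfold spectralStatOne resolventCoeffOne
    have h := hcont.comp (hupd q)
    exact ((continuous_imTrace n).comp ((h.mul continuous_const).mul h)).neg
  · intro q
    refine Continuous.measurable ?_
    unfold spectralStatTwo resolventCoeffTwo
    have h := hcont.comp (hupd q)
    exact ((continuous_imTrace n).comp
      ((h.mul continuous_const).mul ((h.mul continuous_const).mul h)))
  · intro x
    refine (abs_imTrace_le _).trans ((norm_resolventMatrix_le (hH x) hz).trans ?_)
    linarith
  · intro q x
    refine (abs_resolventCoeffOne_le (hH _) hz).trans ?_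
    rw [hn]
    have := hE q
    calc _ ≤ s ^ 2 * ((2 * s) * (w * w)) := by gcongr
      _ = (2 * w ^ 2) * s ^ 3 := by ring
      _ ≤ _ := hK (by positivity) (by linarith)
  · intro q x
    exact (btwo q x).trans (hK (by positivity) (by linarith))
  · intro q x t
    simp [spectralStatOne]
  · intro q x t
    simp [spectralStatTwo]
  · intro q x t
    rw [mul_min_of_nonneg _ _ (by positivity), le_min_iff]
    have := hE q
    have := hE0 q
    unfold spectralStat spectralStatOne spectralStatTwo
    rw [seqMatrix_update n x q t]
    constructor
    · refine (abs_taylor_le_sq (hH _) (hH _) hz t).trans ?_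
      rw [hn]
      calc _ ≤ 2 * (s ^ 2 * ((2 * s) * (w * (2 * s) * w * w))) * t ^ 2 := by gcongr
        _ = (8 * w ^ 3) * (s ^ 4 * t ^ 2) := by ring
        _ ≤ _ := hK (by positivity) (by linarith)
        _ = _ := by ring
    · refine (abs_taylor_le_cube (hH _) (hH _) hz t).trans ?_
      rw [hn]
      calc _ ≤ s ^ 2 * ((2 * s) * (w * (2 * s) * (w * (2 * s) * w) * w)) * |t| ^ 3 := by gcongr
        _ = (8 * w ^ 4) * (s ^ 4 * (|t| ^ 3 * s)) := by ring
        _ ≤ _ := hK (by positivity) (by linarith)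
        _ = _ := by ring
  · intro q x p t
    rw [mul_min_of_nonneg _ _ (by positivity), le_min_iff]
    constructor
    · refine (abs_sub _ _).trans ((add_le_add (btwo _ _) (btwo _ _)).trans ?_)
      rw [mul_one]
      calc _ = (8 * w ^ 3) * s ^ 4 := by ring
        _ ≤ _ := hK (by positivity) (by linarith)
    -- The coefficient at `q` ignores its own coordinate, so only `p ≠ q` needs the perturbation
    -- bound.
    · by_cases hpq : p = q
      · subst hpq
        have : spectralStatTwo n z p (Function.update x p t) =
            spectralStatTwo n z p (Function.update x p 0) := by simp [spectralStatTwo]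
        rw [this, sub_self, abs_zero]
        positivity
      · unfold spectralStatTwo
        rw [Function.update_comm hpq, Function.update_comm hpq, seqMatrix_update n _ p t]
        refine (abs_resolventCoeffTwo_sub_le (hH _) hz (hH _) t).trans ?_
        rw [hn]
        have := hE q
        have := hE0 q
        have := hE p
        have := hE0 p
        calc _ ≤ 3 * (s ^ 2 * ((2 * s) * (w * (2 * s) * w * (w * (2 * s) * w)))) * |t| := by gcongr
          _ = (24 * w ^ 4) * (s ^ 4 * (|t| * s)) := by ring
          _ ≤ _ := hK (by positivity) (by linarith)
          _ = _ := by ring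

end SpectralStatistic

/-! ### Pathwise Lindeberg replacement. -/

section Lindeberg

/-- The sequence with the entries of `x` before `q` and those of `y` from `q` on. -/
def glue (q : ℕ) (x y : ℕ → ℝ) : ℕ → ℝ := fun p => if p < q then x p else y p

theorem glue_succ (q : ℕ) (x y : ℕ → ℝ) :
    glue (q + 1) x y = Function.update (glue q x y) q (x q) := by
  ext p
  by_cases h : p = q
  · subst h; simp [glue]
  · have : p < q + 1 ↔ p < q := by omega
    simp [glue, h, this]

theorem glue_eq_update (q : ℕ) (x y : ℕ → ℝ) :
    glue q x y = Function.update (glue q x y) q (y q) := by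
  ext p
  by_cases h : p = q
  · subst h; simp [glue]
  · simp [h]

theorem glue_update_left (q p : ℕ) (x y : ℕ → ℝ) (t : ℝ) (h : p < q) :
    glue q (Function.update x p t) y = Function.update (glue q x y) p t := by
  ext r
  by_cases hr : r = p
  · subst hr; simp [glue, h]
  · simp [glue, hr]

theorem glue_congr {q : ℕ} {x x' : ℕ → ℝ} (y : ℕ → ℝ) (h : ∀ p < q, x p = x' p) :
    glue q x y = glue q x' y := by
  ext p
  simp only [glue]
  split_ifs with hp
  · exact h p hp
  · rfl

theorem measurable_glue (q : ℕ) : Measurable fun z : (ℕ → ℝ) × (ℕ → ℝ) => glue q z.1 z.2 := by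
  refine measurable_pi_iff.mpr fun p => ?_
  simp only [glue]
  split_ifs
  · exact (measurable_pi_apply p).comp measurable_fst
  · exact (measurable_pi_apply p).comp measurable_snd

variable {Ω : Type*} [MeasurableSpace Ω] (P : Measure Ω) (Y : ℕ → Ω → ℝ)

/-- The mean of `c` over the entries from `q` on, distributed as those of `Y`, the entries
before `q` being fixed. -/
def tailMean (q : ℕ) (c : (ℕ → ℝ) → ℝ) (x : ℕ → ℝ) : ℝ :=
  ∫ ω, c (glue q x fun p => Y p ω) ∂P

variable {P Y}

/-- This is the source of adaptedness: evaluated along `X`, such a mean involves only entries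
earlier than `q`. -/
theorem tailMean_congr {q : ℕ} {x x' : ℕ → ℝ} (c : (ℕ → ℝ) → ℝ) (h : ∀ p < q, x p = x' p) :
    tailMean P Y q c x = tailMean P Y q c x' := by
  simp only [tailMean, glue_congr _ h]

theorem measurable_comp_glue (hY : ∀ p, Measurable (Y p)) {c : (ℕ → ℝ) → ℝ} (hc : Measurable c)
    (q : ℕ) (x : ℕ → ℝ) : Measurable fun ω => c (glue q x fun p => Y p ω) :=
  hc.comp ((measurable_glue q).comp (measurable_const.prodMk (measurable_pi_iff.mpr hY)))

theorem integrable_comp_glue [IsProbabilityMeasure P] (hY : ∀ p, Measurable (Y p))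
    {c : (ℕ → ℝ) → ℝ} (hc : Measurable c) {b : ℝ} (hb : ∀ x, |c x| ≤ b) (q : ℕ) (x : ℕ → ℝ) :
    Integrable (fun ω => c (glue q x fun p => Y p ω)) P :=
  Integrable.of_bound (measurable_comp_glue hY hc q x).aestronglyMeasurable b
    (Eventually.of_forall fun _ => hb _)

theorem abs_tailMean_le [IsProbabilityMeasure P] {c : (ℕ → ℝ) → ℝ} {b : ℝ}
    (hb : ∀ x, |c x| ≤ b) (q : ℕ) (x : ℕ → ℝ) : |tailMean P Y q c x| ≤ b := by
  have := norm_integral_le_of_norm_le_const (μ := P) (C := b)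
    (f := fun ω => c (glue q x fun p => Y p ω)) (Eventually.of_forall fun ω => hb _)
  simpa [tailMean] using this

theorem measurable_tailMean [IsProbabilityMeasure P] (hY : ∀ p, Measurable (Y p))
    {c : (ℕ → ℝ) → ℝ} (hc : Measurable c) (q : ℕ) : Measurable (tailMean P Y q c) := by
  have h : StronglyMeasurable fun z : (ℕ → ℝ) × Ω => c (glue q z.1 fun p => Y p z.2) := by
    refine Measurable.stronglyMeasurable (hc.comp ((measurable_glue q).comp
      (f := fun z : (ℕ → ℝ) × Ω => (z.1, fun p => Y p z.2)) ?_))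
    exact measurable_fst.prodMk ((measurable_pi_iff.mpr hY).comp measurable_snd)
  exact h.integral_prod_right.measurable

variable {s K : ℝ} {T : (ℕ → ℝ) → ℝ} {c₁ c₂ : ℕ → (ℕ → ℝ) → ℝ}

theorem abs_tailMean_two_update_sub_le [IsProbabilityMeasure P] (hY : ∀ p, Measurable (Y p))
    (hT : HasTaylorBounds s K T c₁ c₂) (q p : ℕ) (x : ℕ → ℝ) (t : ℝ) :
    |tailMean P Y q (c₂ q) (Function.update x p t) -
      tailMean P Y q (c₂ q) (Function.update x p 0)| ≤ K * s ^ 4 * min 1 (|t| * s) := by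
  have hK := hT.const_nonneg
  have hs := hT.scale_nonneg
  by_cases h : p < q
  · have hi := integrable_comp_glue (P := P) hY (hT.measurable_two q) (hT.bound_two q) q
    simp only [tailMean]
    rw [← integral_sub (hi _) (hi _)]
    simp only [glue_update_left _ _ _ _ _ h]
    have := norm_integral_le_of_norm_le_const (μ := P) (C := K * s ^ 4 * min 1 (|t| * s))
      (f := fun ω => c₂ q (Function.update (glue q x fun p => Y p ω) p t) -
        c₂ q (Function.update (glue q x fun p => Y p ω) p 0))
      (Eventually.of_forall fun ω => hT.lipschitz_two q (glue q x fun p => Y p ω) p t)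
    simpa using this
  · rw [tailMean_congr (x' := Function.update x p 0), sub_self, abs_zero]
    · positivity
    · intro r hr
      have : r ≠ p := by omega
      simp [this]

/-- The sequence `x` with the entries in `S` replaced by `0`. -/
def zeroOn (S : Finset ℕ) (x : ℕ → ℝ) : ℕ → ℝ := fun p => if p ∈ S then 0 else x p

/-- The entries of `S` are set to zero one by one, each at the cost given by the Lipschitz bound. -/
theorem abs_tailMean_two_zeroOn_sub_le [IsProbabilityMeasure P] (hY : ∀ p, Measurable (Y p))
    (hT : HasTaylorBounds s K T c₁ c₂) (q : ℕ) (S : Finset ℕ) (x : ℕ → ℝ) :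
    |tailMean P Y q (c₂ q) x - tailMean P Y q (c₂ q) (zeroOn S x)| ≤
      K * s ^ 4 * ∑ p ∈ S, min 1 (|x p| * s) := by
  induction S using Finset.induction_on with
  | empty =>
    have : zeroOn ∅ x = x := by ext p; simp [zeroOn]
    simp [this]
  | insert a S ha ih =>
    have h1 : zeroOn S x = Function.update (zeroOn S x) a (x a) := by
      ext p
      by_cases hp : p = a
      · subst hp; simp [zeroOn, ha]
      · simp [hp]
    have h2 : zeroOn (insert a S) x = Function.update (zeroOn S x) a 0 := by
      ext p
      by_cases hp : p = a
      · subst hp; simp [zeroOn]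
      · simp [hp, zeroOn]
    have h3 := abs_tailMean_two_update_sub_le (P := P) hY hT q a (zeroOn S x) (x a)
    rw [← h1, ← h2] at h3
    rw [Finset.sum_insert ha, mul_add, add_comm]
    exact (abs_sub_le _ _ _).trans (add_le_add ih h3)

/-- Since `c` ignores coordinate `q`, its value at the glued sequence is a function of the `Y p`
with `p ≠ q`, and these are independent of `Y q`. -/
theorem integral_mul_glue_eq [IsProbabilityMeasure P] (hY : ∀ p, Measurable (Y p))
    (hindep : iIndepFun Y P) {c : (ℕ → ℝ) → ℝ} (hc : Measurable c) {q : ℕ}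
    (hcq : ∀ x t, c (Function.update x q t) = c x) (x : ℕ → ℝ) {f : ℝ → ℝ} (hf : Measurable f) :
    ∫ ω, c (glue q x fun p => Y p ω) * f (Y q ω) ∂P =
      tailMean P Y q c x * ∫ ω, f (Y q ω) ∂P := by
  have h1 : Indep (⨆ p ∈ ({q}ᶜ : Set ℕ), MeasurableSpace.comap (Y p) inferInstance)
      (⨆ p ∈ ({q} : Set ℕ), MeasurableSpace.comap (Y p) inferInstance) P :=
    indep_iSup_of_disjoint (fun p => (hY p).comap_le) hindep disjoint_compl_left
  have h2 : IndepFun (fun ω => c (glue q x fun p => Y p ω)) (fun ω => f (Y q ω)) P := by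
    refine indep_of_indep_of_le_left (indep_of_indep_of_le_right h1 ?_) ?_
    · rw [← measurable_iff_comap_le]
      refine hf.comp (Measurable.mono (comap_measurable (Y q)) ?_ le_rfl)
      exact le_iSup₂_of_le q rfl le_rfl
    · rw [← measurable_iff_comap_le]
      -- Overwriting coordinate `q` by `0` changes nothing and makes measurability with respect to
      -- the other variables visible.
      have h3 : (fun ω => c (glue q x fun p => Y p ω)) =
          fun ω => c (Function.update (glue q x fun p => Y p ω) q 0) := by
        ext ω; rw [hcq]
      rw [h3]
      refine hc.comp ((@measurable_pi_iff _ _ _ (_) _ _).mpr fun p => ?_)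
      by_cases hp : p = q
      · subst hp; simp
      · simp only [Function.update_of_ne hp, glue]
        split_ifs
        · exact measurable_const
        · exact Measurable.mono (comap_measurable (Y p))
            (le_iSup₂_of_le (f := fun p (_ : p ∈ ({q}ᶜ : Set ℕ)) =>
              MeasurableSpace.comap (Y p) inferInstance) p hp le_rfl) le_rfl
  exact h2.integral_fun_mul_eq_mul_integral
    (measurable_comp_glue hY hc q x).aestronglyMeasurable (hf.comp (hY q)).aestronglyMeasurable

/-- Both hybrids are expanded around the same sequence with coordinate `q` set to zero. The Gaussian
linear term has mean zero, and its quadratic term contributes the variance by independence. -/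
theorem abs_tailMean_succ_sub_le [IsProbabilityMeasure P] (hY : ∀ p, Measurable (Y p))
    (hindep : iIndepFun Y P) (hT : HasTaylorBounds s K T c₁ c₂) {q : ℕ} {m : ℝ}
    (hY3 : MemLp (Y q) 3 P) (hmean : ∫ ω, Y q ω ∂P = 0) (hm : ∫ ω, |Y q ω| ^ 3 ∂P ≤ m)
    (x : ℕ → ℝ) :
    |tailMean P Y (q + 1) T x - tailMean P Y q T x - tailMean P Y q (c₁ q) x * x q
      - tailMean P Y q (c₂ q) x * (x q ^ 2 - ∫ ω, Y q ω ^ 2 ∂P)| ≤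
      K * s ^ 4 * (min (x q ^ 2) (|x q| ^ 3 * s) + m * s) := by
  have hK := hT.const_nonneg
  have hs := hT.scale_nonneg
  have hY1 : Integrable (Y q) P := hY3.integrable (by norm_num)
  have hY2 : Integrable (fun ω => Y q ω ^ 2) P :=
    (hY3.mono_exponent (p := 2) (by norm_num)).integrable_sq
  have hY3' : Integrable (fun ω => |Y q ω| ^ 3) P := by
    simpa using hY3.integrable_norm_pow (by norm_num)
  have i1 := integrable_comp_glue (P := P) hY hT.measurable hT.bound (q + 1) x
  have i2 := integrable_comp_glue (P := P) hY hT.measurable hT.bound q x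
  have ic1 := integrable_comp_glue (P := P) hY (hT.measurable_one q) (hT.bound_one q) q x
  have ic2 := integrable_comp_glue (P := P) hY (hT.measurable_two q) (hT.bound_two q) q x
  have ic1Y : Integrable (fun ω => c₁ q (glue q x fun p => Y p ω) * Y q ω) P :=
    hY1.bdd_mul ic1.aestronglyMeasurable (Eventually.of_forall fun ω => hT.bound_one q _)
  have ic2Y : Integrable (fun ω => c₂ q (glue q x fun p => Y p ω) * Y q ω ^ 2) P :=
    hY2.bdd_mul ic2.aestronglyMeasurable (Eventually.of_forall fun ω => hT.bound_two q _)
  have e1 := integral_mul_glue_eq hY hindep (hT.measurable_one q) (hT.update_one q) x measurable_id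
  have e2 := integral_mul_glue_eq hY hindep (hT.measurable_two q) (hT.update_two q) x
    (measurable_id.pow_const 2)
  simp only [id] at e1 e2
  rw [hmean, mul_zero] at e1
  -- The Gaussian Taylor terms are inserted under the integral, so that the integrand is the
  -- difference of two Taylor remainders.
  have hdiff : tailMean P Y (q + 1) T x - tailMean P Y q T x - tailMean P Y q (c₁ q) x * x q
      - tailMean P Y q (c₂ q) x * (x q ^ 2 - ∫ ω, Y q ω ^ 2 ∂P) =
      ∫ ω, (T (glue (q + 1) x fun p => Y p ω) - T (glue q x fun p => Y p ω)
        - c₁ q (glue q x fun p => Y p ω) * x q - c₂ q (glue q x fun p => Y p ω) * x q ^ 2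
        + c₁ q (glue q x fun p => Y p ω) * Y q ω
        + c₂ q (glue q x fun p => Y p ω) * Y q ω ^ 2) ∂P := by
    have h := integral_add' ((((i1.sub i2).sub (ic1.mul_const (x q))).sub
      (ic2.mul_const (x q ^ 2))).add ic1Y) ic2Y
    rw [integral_add' (((i1.sub i2).sub (ic1.mul_const _)).sub (ic2.mul_const _)) ic1Y,
      integral_sub' ((i1.sub i2).sub (ic1.mul_const _)) (ic2.mul_const _),
      integral_sub' (i1.sub i2) (ic1.mul_const _), integral_sub' i1 i2, integral_mul_const,
      integral_mul_const, e1, e2] at h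
    refine Eq.trans ?_ h.symm
    simp only [tailMean]
    ring
  rw [hdiff]
  refine (abs_integral_le_integral_abs).trans ?_
  have hle : ∀ ω, |T (glue (q + 1) x fun p => Y p ω) - T (glue q x fun p => Y p ω)
        - c₁ q (glue q x fun p => Y p ω) * x q - c₂ q (glue q x fun p => Y p ω) * x q ^ 2
        + c₁ q (glue q x fun p => Y p ω) * Y q ω
        + c₂ q (glue q x fun p => Y p ω) * Y q ω ^ 2| ≤
      K * s ^ 4 * (min (x q ^ 2) (|x q| ^ 3 * s)) + K * s ^ 4 * (|Y q ω| ^ 3 * s) := by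
    intro ω
    set g := glue q x fun p => Y p ω with hg
    have t1 := hT.taylor q g (x q)
    have t2 := hT.taylor q g (Y q ω)
    rw [← glue_succ] at t1
    rw [← glue_eq_update] at t2
    have t3 : K * s ^ 4 * min (Y q ω ^ 2) (|Y q ω| ^ 3 * s) ≤ K * s ^ 4 * (|Y q ω| ^ 3 * s) := by
      gcongr
      exact min_le_right _ _
    rw [← hg] at t2
    have h12 := (abs_sub _ _).trans (add_le_add t1 (t2.trans t3))
    refine le_trans (le_of_eq ?_) h12
    congr 1
    ring
  refine (integral_mono_of_nonneg (Eventually.of_forall fun _ => abs_nonneg _)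
    ((integrable_const _).add ((hY3'.mul_const s).const_mul _))
    (Eventually.of_forall hle)).trans ?_
  rw [integral_add' (integrable_const _) ((hY3'.mul_const s).const_mul _), integral_const,
    integral_const_mul, integral_mul_const]
  simp only [probReal_univ, smul_eq_mul, one_mul]
  rw [← mul_add]
  gcongr

/-- The hybrids telescope from the full Gaussian mean at `q = 0` to `T x` at `q = N`. The sequence
`x` is deterministic here; `X ω` is substituted only later. -/
theorem abs_lindeberg_le [IsProbabilityMeasure P] (hY : ∀ p, Measurable (Y p))
    (hindep : iIndepFun Y P) (hT : HasTaylorBounds s K T c₁ c₂) {N : ℕ}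
    (hN : ∀ x y : ℕ → ℝ, (∀ q < N, x q = y q) → T x = T y) {m : ℝ}
    (hY3 : ∀ q, MemLp (Y q) 3 P) (hmean : ∀ q, ∫ ω, Y q ω ∂P = 0)
    (hm : ∀ q, ∫ ω, |Y q ω| ^ 3 ∂P ≤ m) (x : ℕ → ℝ) :
    |T x - ∫ ω, T (fun p => Y p ω) ∂P - ∑ q ∈ Finset.range N, tailMean P Y q (c₁ q) x * x q
      - ∑ q ∈ Finset.range N, tailMean P Y q (c₂ q) x * (x q ^ 2 - ∫ ω, Y q ω ^ 2 ∂P)| ≤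
      K * s ^ 4 * ∑ q ∈ Finset.range N, (min (x q ^ 2) (|x q| ^ 3 * s) + m * s) := by
  have h0 : tailMean P Y 0 T x = ∫ ω, T (fun p => Y p ω) ∂P := by
    have : ∀ y, glue 0 x y = y := fun y => by ext p; simp [glue]
    simp [tailMean, this]
  have h1 : tailMean P Y N T x = T x := by
    have : ∀ ω, T (glue N x fun p => Y p ω) = T x := fun ω => hN _ _ fun q hq => by
      simp [glue, hq]
    simp [tailMean, this]
  rw [← h0, ← h1, ← Finset.sum_range_sub (fun q => tailMean P Y q T x) N,
    ← Finset.sum_sub_distrib, ← Finset.sum_sub_distrib, Finset.mul_sum]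
  exact (Finset.abs_sum_le_sum_abs _ _).trans (Finset.sum_le_sum fun q _ =>
    abs_tailMean_succ_sub_le hY hindep hT (hY3 q) (hmean q) (hm q) x)

end Lindeberg

/-! ### Exponential moments and almost sure convergence from summable means. -/

section Concentration

/-- In the application the linear term has weighted mean zero, so an exponential moment grows only
through the square. -/
theorem Real.exp_le_add_exp_sq (x : ℝ) : Real.exp x ≤ x + Real.exp (x ^ 2) := by
  have h2 := Real.add_one_le_exp (x ^ 2)
  rcases le_or_gt |x| 1 with h | h
  · have h1 := (abs_le.mp (Real.abs_exp_sub_one_sub_id_le h)).2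
    linarith
  · rcases lt_abs.mp h with h' | h'
    · have : Real.exp x ≤ Real.exp (x ^ 2) := Real.exp_le_exp.mpr (by nlinarith)
      linarith
    · have : Real.exp x ≤ 1 := Real.exp_le_one_iff.mpr (by linarith)
      nlinarith

variable {Ω : Type*} [MeasurableSpace Ω] {P : Measure Ω}

theorem ae_abs_sum_range_le {d : ℕ → Ω → ℝ} {c : ℝ} (hbd : ∀ m, ∀ᵐ ω ∂P, |d m ω| ≤ c) (m : ℕ) :
    ∀ᵐ ω ∂P, |∑ k ∈ Finset.range m, d k ω| ≤ m * c := by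
  filter_upwards [ae_all_iff.mpr hbd] with ω hω
  refine (Finset.abs_sum_le_sum_abs _ _).trans ((Finset.sum_le_sum fun k _ => hω k).trans ?_)
  simp

theorem integrable_exp_sum_range [IsFiniteMeasure P] {d : ℕ → Ω → ℝ} {c : ℝ}
    (hd : ∀ m, AEStronglyMeasurable (d m) P) (hbd : ∀ m, ∀ᵐ ω ∂P, |d m ω| ≤ c) (r : ℝ) (m : ℕ) :
    Integrable (fun ω => Real.exp (r * ∑ k ∈ Finset.range m, d k ω)) P := by
  refine Integrable.of_bound (C := Real.exp (|r| * (m * c))) ?_ ?_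
  · exact Real.continuous_exp.comp_aestronglyMeasurable
      ((Finset.aestronglyMeasurable_fun_sum _ fun k _ => hd k).const_mul r)
  · filter_upwards [ae_abs_sum_range_le hbd m] with ω hω
    rw [Real.norm_eq_abs, Real.abs_exp, Real.exp_le_exp]
    refine (le_abs_self _).trans ?_
    rw [abs_mul]
    gcongr

/-- An exponential moment bound of Azuma type. -/
theorem integral_exp_sum_range_le [IsProbabilityMeasure P] {d : ℕ → Ω → ℝ} {c : ℝ}
    (hd : ∀ m, AEStronglyMeasurable (d m) P) (hbd : ∀ m, ∀ᵐ ω ∂P, |d m ω| ≤ c) (r : ℝ) (M : ℕ)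
    (horth : ∀ m < M, ∫ ω, Real.exp (r * ∑ k ∈ Finset.range m, d k ω) * d m ω ∂P = 0) :
    ∫ ω, Real.exp (r * ∑ k ∈ Finset.range M, d k ω) ∂P ≤ Real.exp (r ^ 2 * c ^ 2 * M) := by
  induction M with
  | zero => simp
  | succ M ih =>
    have hi := integrable_exp_sum_range hd hbd r
    have hid : Integrable (fun ω => Real.exp (r * ∑ k ∈ Finset.range M, d k ω) * d M ω) P :=
      (hi M).mul_bdd (c := c) (hd M) (hbd M)
    -- The first summand integrates to zero by `horth`. Orthogonality to exponentials of partial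
    -- sums replaces a filtration, which is what the row blocks require.
    have hle : ∀ᵐ ω ∂P, Real.exp (r * ∑ k ∈ Finset.range (M + 1), d k ω) ≤
        r * (Real.exp (r * ∑ k ∈ Finset.range M, d k ω) * d M ω) +
          Real.exp (r ^ 2 * c ^ 2) * Real.exp (r * ∑ k ∈ Finset.range M, d k ω) := by
      filter_upwards [hbd M] with ω hω
      rw [Finset.sum_range_succ, mul_add, Real.exp_add]
      have h1 := Real.exp_le_add_exp_sq (r * d M ω)
      have h2 : Real.exp ((r * d M ω) ^ 2) ≤ Real.exp (r ^ 2 * c ^ 2) := by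
        rw [Real.exp_le_exp, mul_pow, ← sq_abs (d M ω)]
        gcongr
      nlinarith [Real.exp_pos (r * ∑ k ∈ Finset.range M, d k ω)]
    refine (integral_mono_ae (hi (M + 1)) ((hid.const_mul r).add ((hi M).const_mul _)) hle).trans ?_
    rw [integral_add' (hid.const_mul r) ((hi M).const_mul _), integral_const_mul,
      integral_const_mul, horth M (Nat.lt_succ_self M), mul_zero, zero_add]
    have h3 : Real.exp (r ^ 2 * c ^ 2 * (M + 1 : ℕ)) =
        Real.exp (r ^ 2 * c ^ 2) * Real.exp (r ^ 2 * c ^ 2 * M) := by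
      rw [← Real.exp_add]; push_cast; ring_nf
    rw [h3]
    exact mul_le_mul_of_nonneg_left (ih fun m hm => horth m (hm.trans (Nat.lt_succ_self M)))
      (Real.exp_pos _).le

/-- From `y ^ 8 / 8! ≤ exp |y| ≤ exp y + exp (-y)` at `y = r * S`. The parameter `r` stays free, to
be adapted to the variance scale. -/
theorem integral_sum_range_pow_eight_le [IsProbabilityMeasure P] {d : ℕ → Ω → ℝ} {c : ℝ}
    (hd : ∀ m, AEStronglyMeasurable (d m) P) (hbd : ∀ m, ∀ᵐ ω ∂P, |d m ω| ≤ c) (M : ℕ)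
    (horth : ∀ r : ℝ, ∀ m < M,
      ∫ ω, Real.exp (r * ∑ k ∈ Finset.range m, d k ω) * d m ω ∂P = 0) {r : ℝ} (hr : 0 < r) :
    Integrable (fun ω => (∑ k ∈ Finset.range M, d k ω) ^ 8) P ∧
    ∫ ω, (∑ k ∈ Finset.range M, d k ω) ^ 8 ∂P ≤
      (Nat.factorial 8 : ℝ) / r ^ 8 * (2 * Real.exp (r ^ 2 * c ^ 2 * M)) := by
  have hint : Integrable (fun ω => (∑ k ∈ Finset.range M, d k ω) ^ 8) P := by
    refine Integrable.of_bound (C := (M * c) ^ 8)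
      ((Finset.aestronglyMeasurable_fun_sum _ fun k _ => hd k).pow 8) ?_
    filter_upwards [ae_abs_sum_range_le hbd M] with ω hω
    rw [norm_pow, Real.norm_eq_abs]
    gcongr
  refine ⟨hint, ?_⟩
  have h1 := integral_exp_sum_range_le hd hbd r M (horth r)
  have h2 := integral_exp_sum_range_le hd hbd (-r) M (horth (-r))
  rw [neg_sq] at h2
  have hi := integrable_exp_sum_range hd hbd
  have hle : ∀ ω, (∑ k ∈ Finset.range M, d k ω) ^ 8 ≤ (Nat.factorial 8 : ℝ) / r ^ 8 *
      (Real.exp (r * ∑ k ∈ Finset.range M, d k ω) +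
        Real.exp (-r * ∑ k ∈ Finset.range M, d k ω)) := by
    intro ω
    set S := ∑ k ∈ Finset.range M, d k ω
    have h3 := Real.pow_div_factorial_le_exp (x := |r * S|) (abs_nonneg _) 8
    have h4 : Real.exp |r * S| ≤ Real.exp (r * S) + Real.exp (-r * S) := by
      have p1 := Real.exp_pos (r * S)
      have p2 := Real.exp_pos (-r * S)
      rcases abs_cases (r * S) with ⟨h, -⟩ | ⟨h, -⟩ <;> rw [h]
      · linarith
      · rw [← neg_mul]; linarith
    have h5 : |r * S| ^ 8 = r ^ 8 * S ^ 8 := by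
      rw [← abs_pow, mul_pow, abs_of_nonneg (by positivity)]
    rw [h5, div_le_iff₀ (by positivity)] at h3
    rw [div_mul_eq_mul_div, le_div_iff₀ (by positivity)]
    have : (0 : ℝ) < (Nat.factorial 8 : ℝ) := by positivity
    nlinarith
  refine (integral_mono hint (((hi r M).add (hi (-r) M)).const_mul _) hle).trans ?_
  rw [integral_const_mul, integral_add' (hi r M) (hi (-r) M)]
  gcongr
  linarith

/-- By Tonelli the series has finite mean, so it converges almost surely and its terms vanish. -/
theorem ae_tendsto_zero_of_summable_integral {f : ℕ → Ω → ℝ} {u : ℕ → ℝ}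
    (hf : ∀ n, Integrable (f n) P) (hnn : ∀ n, 0 ≤ᵐ[P] f n) (hu : Summable u)
    (hle : ∀ n, ∫ ω, f n ω ∂P ≤ u n) : ∀ᵐ ω ∂P, Tendsto (fun n => f n ω) atTop (𝓝 0) := by
  have h1 : ∫⁻ ω, ∑' n, ENNReal.ofReal (f n ω) ∂P ≠ ∞ := by
    rw [lintegral_tsum fun n => (hf n).aestronglyMeasurable.aemeasurable.ennreal_ofReal]
    have hs : Summable fun n => ∫ ω, f n ω ∂P :=
      Summable.of_nonneg_of_le (fun n => integral_nonneg_of_ae (hnn n)) hle hu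
    simp_rw [← ofReal_integral_eq_lintegral_ofReal (hf _) (hnn _)]
    exact hs.tsum_ofReal_ne_top
  have h2 := ae_lt_top' (AEMeasurable.tsum fun n =>
    (hf n).aestronglyMeasurable.aemeasurable.ennreal_ofReal) h1
  filter_upwards [h2, ae_all_iff.mpr hnn] with ω hω hω0
  have h3 := ENNReal.tendsto_atTop_zero_of_tsum_ne_top hω.ne
  have h4 := (ENNReal.tendsto_toReal ENNReal.zero_ne_top).comp h3
  refine h4.congr fun n => ?_
  simp [ENNReal.toReal_ofReal (hω0 n)]

end Concentration

/-! ### The truncation level and Cauchy condensation. -/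

section TruncationLevel

/-- A power of `2` of order `n ^ (1 / 8)`, constant on dyadic blocks. -/
def truncLevel (n : ℕ) : ℝ := 2 ^ (Nat.log 2 n / 8)

theorem one_le_truncLevel (n : ℕ) : 1 ≤ truncLevel n := one_le_pow₀ one_le_two

theorem truncLevel_pow_le {n : ℕ} (hn : 1 ≤ n) : truncLevel n ^ 8 ≤ n := by
  rw [truncLevel, ← pow_mul]
  have h1 : (2 : ℝ) ^ (Nat.log 2 n / 8 * 8) ≤ 2 ^ Nat.log 2 n :=
    pow_le_pow_right₀ one_le_two (Nat.div_mul_le_self _ _)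
  refine h1.trans ?_
  exact_mod_cast Nat.pow_log_le_self 2 (by omega)

theorem truncLevel_mono : Monotone truncLevel := fun _ _ h =>
  pow_le_pow_right₀ one_le_two (Nat.div_le_div_right (Nat.log_mono_right h))

theorem Summable.comp_div {g : ℕ → ℝ} (hg : Summable g) (h0 : ∀ k, 0 ≤ g k) (m : ℕ) [NeZero m] :
    Summable fun k => g (k / m) := by
  have h1 : Summable fun p : ℕ × Fin m => g p.1 * (1 : ℝ) :=
    hg.mul_of_nonneg (g := fun _ : Fin m => (1 : ℝ)) Summable.of_finite h0 fun _ => zero_le_one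
  have h2 := (Nat.divModEquiv m).summable_iff.mpr h1
  refine h2.congr fun k => ?_
  simp [Nat.divModEquiv]

variable {h : ℝ → ℝ}

/-- Condensation turns the assumption into summability of `1 / h(2 ^ k)`; replacing `k` by `k / 8`
repeats each term eight times. -/
theorem summable_inv_dyadic (h_one : ∀ x, 0 ≤ x → 1 ≤ h x) (h_mono : MonotoneOn h (Set.Ici 0))
    (h_sum : Summable fun n : ℕ => ((n : ℝ) * h n)⁻¹) :
    Summable fun k : ℕ => (h (2 ^ (k / 8)))⁻¹ := by
  have hpos : ∀ x, 0 ≤ x → 0 < h x := fun x hx => zero_lt_one.trans_le (h_one x hx)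
  have h1 := (summable_condensed_iff_of_nonneg (f := fun n : ℕ => ((n : ℝ) * h n)⁻¹)
    (fun n => inv_nonneg.mpr (mul_nonneg (Nat.cast_nonneg n) (hpos n (Nat.cast_nonneg n)).le))
    (fun m n hm hmn => by
      have hm' : (0 : ℝ) < m := by exact_mod_cast hm
      have hmn' : (m : ℝ) ≤ n := by exact_mod_cast hmn
      have := h_mono (Set.mem_Ici.mpr hm'.le) (Set.mem_Ici.mpr (hm'.le.trans hmn')) hmn'
      have := hpos m hm'.le
      gcongr)).mpr h_sum
  have h2 : Summable fun k : ℕ => (h (2 ^ k))⁻¹ := by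
    refine h1.congr fun k => ?_
    have := hpos (2 ^ k) (by positivity)
    push_cast
    field_simp
  exact h2.comp_div (fun k => inv_nonneg.mpr (hpos _ (by positivity)).le) 8

/-- Condensation in the other direction: `truncLevel (2 ^ k) = 2 ^ (k / 8)`, so the condensed series
is that of `summable_inv_dyadic`. -/
theorem summable_inv_mul_truncLevel (h_one : ∀ x, 0 ≤ x → 1 ≤ h x)
    (h_mono : MonotoneOn h (Set.Ici 0)) (h_sum : Summable fun n : ℕ => ((n : ℝ) * h n)⁻¹) :
    Summable fun n : ℕ => ((n : ℝ) * h (truncLevel n))⁻¹ := by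
  have hL : ∀ n, 0 ≤ truncLevel n := fun n => zero_le_one.trans (one_le_truncLevel n)
  have hpos : ∀ x, 0 ≤ x → 0 < h x := fun x hx => zero_lt_one.trans_le (h_one x hx)
  refine (summable_condensed_iff_of_nonneg (f := fun n : ℕ => ((n : ℝ) * h (truncLevel n))⁻¹)
    (fun n => inv_nonneg.mpr (mul_nonneg (Nat.cast_nonneg n) (hpos _ (hL n)).le))
    (fun m n hm hmn => by
      have hm' : (0 : ℝ) < m := by exact_mod_cast hm
      have hmn' : (m : ℝ) ≤ n := by exact_mod_cast hmn
      have := h_mono (Set.mem_Ici.mpr (hL m)) (Set.mem_Ici.mpr (hL n)) (truncLevel_mono hmn)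
      have := hpos _ (hL m)
      gcongr)).mp ?_
  refine (summable_inv_dyadic h_one h_mono h_sum).congr fun k => ?_
  have := hpos (2 ^ (k / 8)) (by positivity)
  simp only [truncLevel, Nat.log_pow one_lt_two]
  push_cast
  field_simp

variable {Ω : Type*} [MeasurableSpace Ω] {P : Measure Ω}

/-- Averages over triangles whose terms only change from one dyadic block to the next. -/
theorem ae_tendsto_dyadic_average {U : ℕ → ℕ → Ω → ℝ} (hU : ∀ k q, Integrable (U k q) P)
    (hU0 : ∀ k q, 0 ≤ᵐ[P] U k q) {u : ℕ → ℝ} (hu : Summable u)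
    (hle : ∀ k q, ∫ ω, U k q ω ∂P ≤ u k) :
    ∀ᵐ ω ∂P, Tendsto (fun n : ℕ => ((n : ℝ) ^ 2)⁻¹ *
      ∑ q ∈ Finset.range (triNum n), U (Nat.log 2 n) q ω) atTop (𝓝 0) := by
  have hu0 : ∀ k, 0 ≤ u k := fun k => (integral_nonneg_of_ae (hU0 k 0)).trans (hle k 0)
  -- Each block is dominated by its largest triangle divided by its smallest normalization, which
  -- costs a factor `4`. Summability is then needed over blocks `k` rather than over all `n`.
  have h1 : ∀ᵐ ω ∂P, Tendsto (fun k : ℕ => (((2 : ℝ) ^ k) ^ 2)⁻¹ *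
      ∑ q ∈ Finset.range (triNum (2 ^ (k + 1))), U k q ω) atTop (𝓝 0) := by
    refine ae_tendsto_zero_of_summable_integral (u := fun k => 4 * u k) (fun k => ?_) (fun k => ?_)
      (hu.mul_left 4) (fun k => ?_)
    · exact (integrable_finsetSum _ fun q _ => hU k q).const_mul _
    · filter_upwards [ae_all_iff.mpr (hU0 k)] with ω hω
      exact mul_nonneg (by positivity) (Finset.sum_nonneg fun q _ => hω q)
    · rw [integral_const_mul, integral_finsetSum _ fun q _ => hU k q]
      have h2 : ∑ q ∈ Finset.range (triNum (2 ^ (k + 1))), ∫ ω, U k q ω ∂P ≤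
          ((2 : ℝ) ^ (k + 1)) ^ 2 * u k := by
        refine (Finset.sum_le_sum fun q _ => hle k q).trans ?_
        rw [Finset.sum_const, Finset.card_range, nsmul_eq_mul]
        gcongr
        · exact hu0 k
        · exact_mod_cast triNum_le_sq (2 ^ (k + 1))
      calc _ ≤ (((2 : ℝ) ^ k) ^ 2)⁻¹ * (((2 : ℝ) ^ (k + 1)) ^ 2 * u k) := by gcongr
        _ = 4 * u k := by rw [pow_succ]; field_simp; ring
  filter_upwards [h1, ae_all_iff.mpr fun k => ae_all_iff.mpr (hU0 k)] with ω hω hω0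
  have hlog : Tendsto (Nat.log 2) atTop atTop :=
    tendsto_atTop_atTop.mpr fun b => ⟨2 ^ b, fun n hn => by
      have := Nat.log_mono_right (b := 2) hn
      rwa [Nat.log_pow one_lt_two] at this⟩
  refine squeeze_zero' (Eventually.of_forall fun n => ?_) ?_ (hω.comp hlog)
  · exact mul_nonneg (by positivity) (Finset.sum_nonneg fun q _ => hω0 _ q)
  · filter_upwards [eventually_ge_atTop 1] with n hn
    have h2 : (2 : ℝ) ^ Nat.log 2 n ≤ n := by
      exact_mod_cast Nat.pow_log_le_self 2 (by omega)
    have h3 : n ≤ 2 ^ (Nat.log 2 n + 1) := (Nat.lt_pow_succ_log_self one_lt_two n).le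
    simp only [Function.comp_apply]
    have h4 : ∑ q ∈ Finset.range (triNum n), U (Nat.log 2 n) q ω ≤
        ∑ q ∈ Finset.range (triNum (2 ^ (Nat.log 2 n + 1))), U (Nat.log 2 n) q ω :=
      Finset.sum_le_sum_of_subset_of_nonneg (Finset.range_mono (triNum_mono h3))
        fun q _ _ => hω0 _ q
    have h5 : 0 ≤ ∑ q ∈ Finset.range (triNum n), U (Nat.log 2 n) q ω :=
      Finset.sum_nonneg fun q _ => hω0 _ q
    gcongr

end TruncationLevel

/-! ### Splitting a real number at a level. -/

section Truncation

/-- `x` if `|x| ≤ L`, and `0` otherwise. -/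
def lowPart (L x : ℝ) : ℝ := if |x| ≤ L then x else 0

/-- `x` if `L < |x|`, and `0` otherwise. -/
def highPart (L x : ℝ) : ℝ := if |x| ≤ L then 0 else x

theorem lowPart_add_highPart (L x : ℝ) : lowPart L x + highPart L x = x := by
  unfold lowPart highPart; split_ifs <;> simp

theorem lowPart_sq_add_highPart_sq (L x : ℝ) : lowPart L x ^ 2 + highPart L x ^ 2 = x ^ 2 := by
  unfold lowPart highPart; split_ifs <;> simp

theorem abs_lowPart_le {L : ℝ} (hL : 0 ≤ L) (x : ℝ) : |lowPart L x| ≤ L := by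
  unfold lowPart; split_ifs with h
  · exact h
  · simpa using hL

theorem abs_highPart_le (L x : ℝ) : |highPart L x| ≤ |x| := by
  unfold highPart; split_ifs <;> simp

theorem measurable_lowPart (L : ℝ) : Measurable (lowPart L) :=
  Measurable.ite (measurableSet_le measurable_norm measurable_const) measurable_id measurable_const

theorem measurable_highPart (L : ℝ) : Measurable (highPart L) :=
  Measurable.ite (measurableSet_le measurable_norm measurable_const) measurable_const measurable_id

end Truncation

/-! ### Weighted martingale sums: the first-order term. -/

section MartingaleSums

variable {Ω : Type*} [mΩ : MeasurableSpace Ω] {P : Measure Ω}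

theorem integral_mul_sub_condExp_eq_zero [IsProbabilityMeasure P] {m : MeasurableSpace Ω} (hm : m ≤ mΩ) {f g : Ω → ℝ}
    (hg : StronglyMeasurable[m] g) (hf : Integrable f P) (hgf : Integrable (g * f) P) :
    ∫ ω, g ω * (f ω - P[f | m] ω) ∂P = 0 := by
  have h1 := condExp_mul_of_stronglyMeasurable_left hg hgf hf
  have h2 : Integrable (g * P[f | m]) P := integrable_condExp.congr h1
  have h3 : ∫ ω, (g * P[f | m]) ω ∂P = ∫ ω, (g * f) ω ∂P := by
    rw [← integral_congr_ae h1, integral_condExp hm]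
  calc ∫ ω, g ω * (f ω - P[f | m] ω) ∂P = ∫ ω, ((g * f) - (g * P[f | m])) ω ∂P := by
        refine integral_congr_ae (Eventually.of_forall fun ω => ?_)
        simp [mul_sub]
    _ = 0 := by rw [integral_sub' hgf h2, h3, sub_self]

theorem integral_sub_condExp_sq_le [IsProbabilityMeasure P] {m : MeasurableSpace Ω} (hm : m ≤ mΩ) {f : Ω → ℝ}
    (hf : MemLp f 2 P) : ∫ ω, (f ω - P[f | m] ω) ^ 2 ∂P ≤ ∫ ω, f ω ^ 2 ∂P := by
  have h1 := condVar_ae_le_condExp_sq hm hf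
  have h2 := integral_mono_ae integrable_condVar integrable_condExp h1
  rw [integral_condExp hm, condVar, integral_condExp hm] at h2
  exact h2

theorem integral_sum_range_sq {d : ℕ → Ω → ℝ} (hd : ∀ m, MemLp (d m) 2 P) (M : ℕ)
    (horth : ∀ m < M, ∫ ω, (∑ k ∈ Finset.range m, d k ω) * d m ω ∂P = 0) :
    ∫ ω, (∑ k ∈ Finset.range M, d k ω) ^ 2 ∂P =
      ∑ k ∈ Finset.range M, ∫ ω, d k ω ^ 2 ∂P := by
  induction M with
  | zero => simp
  | succ M ih =>
    have hS : MemLp (fun ω => ∑ k ∈ Finset.range M, d k ω) 2 P :=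
      memLp_finsetSum _ fun k _ => hd k
    have h1 : Integrable (fun ω => 2 * ((∑ k ∈ Finset.range M, d k ω) * d M ω)) P :=
      (hS.integrable_mul (hd M)).const_mul 2
    have h2 := integral_add' (hS.integrable_sq.add h1) (hd M).integrable_sq
    rw [integral_add' hS.integrable_sq h1, integral_const_mul, horth M (Nat.lt_succ_self M),
      ih fun m hm => horth m (hm.trans (Nat.lt_succ_self M)), mul_zero, add_zero] at h2
    rw [Finset.sum_range_succ, ← h2]
    refine integral_congr_ae (Eventually.of_forall fun ω => ?_)
    simp only [Pi.add_apply, Finset.sum_range_succ]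
    ring

theorem tendsto_zero_of_tendsto_pow {f : ℕ → ℝ} {k : ℕ}
    (h : Tendsto (fun n => f n ^ k) atTop (𝓝 0)) : Tendsto f atTop (𝓝 0) := by
  rw [Metric.tendsto_atTop] at h ⊢
  intro ε hε
  obtain ⟨N, hN⟩ := h (ε ^ k) (by positivity)
  refine ⟨N, fun n hn => ?_⟩
  have := hN n hn
  simp only [dist_zero_right, norm_pow] at this ⊢
  exact lt_of_pow_lt_pow_left₀ k hε.le this

/-- The inequality `L ^ 4 * s ≤ 1` is what fixes the exponent `1 / 8`: it is the exact requirement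
of the row-block estimate. -/
theorem level_bound {n : ℕ} (hn : 1 ≤ n) {s : ℝ} (hs : s = (√(n : ℝ))⁻¹) :
    0 < s ∧ s ^ 2 * n = 1 ∧ truncLevel n ^ 4 * s ≤ 1 := by
  have hn' : (0 : ℝ) < n := by exact_mod_cast hn
  have h1 : 0 < √(n : ℝ) := Real.sqrt_pos.mpr hn'
  refine ⟨by rw [hs]; positivity, ?_, ?_⟩
  · rw [hs, inv_pow, Real.sq_sqrt hn'.le, inv_mul_cancel₀ hn'.ne']
  · rw [hs, ← div_eq_mul_inv, div_le_one h1]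
    refine Real.le_sqrt_of_sq_le ?_
    rw [← pow_mul]
    exact truncLevel_pow_le hn

variable [IsProbabilityMeasure P]

/-- Sums that have bounded exponential moments at the scale `n ^ (1 / 4)` tend to zero. -/
theorem ae_tendsto_sum_of_azuma {d : ℕ → ℕ → Ω → ℝ} {c : ℕ → ℝ} {M : ℕ → ℕ} {B : ℝ}
    (hd : ∀ n m, AEStronglyMeasurable (d n m) P)
    (hbd : ∀ n, 1 ≤ n → ∀ m, ∀ᵐ ω ∂P, |d n m ω| ≤ c n)
    (hM : M 0 = 0)
    (horth : ∀ n, 1 ≤ n → ∀ r : ℝ, ∀ m < M n,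
      ∫ ω, Real.exp (r * ∑ k ∈ Finset.range m, d n k ω) * d n m ω ∂P = 0)
    (hB : ∀ n : ℕ, 1 ≤ n → √(n : ℝ) * c n ^ 2 * M n ≤ B) :
    ∀ᵐ ω ∂P, Tendsto (fun n => ∑ k ∈ Finset.range (M n), d n k ω) atTop (𝓝 0) := by
  have key : ∀ n, Integrable (fun ω => (∑ k ∈ Finset.range (M n), d n k ω) ^ 8) P ∧
      ∫ ω, (∑ k ∈ Finset.range (M n), d n k ω) ^ 8 ∂P ≤
        (Nat.factorial 8 : ℝ) * (2 * Real.exp B) * ((n : ℝ) ^ 2)⁻¹ := by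
    intro n
    rcases Nat.eq_zero_or_pos n with rfl | hn
    · simp [hM]
    · have hn' : (0 : ℝ) < n := by exact_mod_cast hn
      -- The choice `r = n ^ (1/4)` gives `r ^ 8 = n ^ 2`, hence summable eighth moments, while `hB`
      -- keeps the exponent `r ^ 2 * c ^ 2 * M` bounded.
      have hr : 0 < √√(n : ℝ) := Real.sqrt_pos.mpr (Real.sqrt_pos.mpr hn')
      have hr2 : √√(n : ℝ) ^ 2 = √(n : ℝ) := Real.sq_sqrt (Real.sqrt_nonneg _)
      obtain ⟨h1, h2⟩ := integral_sum_range_pow_eight_le (hd n) (hbd n hn) (M n)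
        (horth n hn) hr
      refine ⟨h1, h2.trans ?_⟩
      have hr8 : √√(n : ℝ) ^ 8 = (n : ℝ) ^ 2 := by
        calc √√(n : ℝ) ^ 8 = ((√√(n : ℝ) ^ 2) ^ 2) ^ 2 := by ring
          _ = _ := by rw [hr2, Real.sq_sqrt hn'.le]
      rw [hr8, hr2, div_mul_eq_mul_div, div_eq_mul_inv]
      gcongr
      exact hB n hn
  have := ae_tendsto_zero_of_summable_integral (fun n => (key n).1)
    (fun n => Eventually.of_forall fun ω => by positivity)
    ((Real.summable_nat_pow_inv.mpr one_lt_two).mul_left _) (fun n => (key n).2)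
  filter_upwards [this] with ω hω
  exact tendsto_zero_of_tendsto_pow hω

variable {x : ℕ → Ω → ℝ} {𝓕 : ℕ → MeasurableSpace Ω} {K : ℝ}

/-- Weighted sums of a martingale difference sequence with bounded weights of order
`n ^ (-3/2)`. -/
theorem ae_tendsto_sum_mul_martingale_diff (hx : ∀ q, Measurable (x q))
    (hx2 : ∀ q, MemLp (x q) 2 P)
    (h𝓕 : ∀ q, 𝓕 q ≤ mΩ) (h𝓕mono : ∀ p q, p < q → 𝓕 p ≤ 𝓕 q)
    (hadapt : ∀ p q, p < q → Measurable[𝓕 q] (x p))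
    (hmart : ∀ q, P[x q | 𝓕 q] =ᵐ[P] 0) {β : ℕ → ℕ → Ω → ℝ}
    (hβmeas : ∀ n q, Measurable[𝓕 q] (β n q)) (hK : 0 ≤ K)
    (hβ : ∀ n q ω, |β n q ω| ≤ K * (√(n : ℝ))⁻¹ ^ 3) {u : ℕ → ℝ}
    (hu : Summable fun n : ℕ => ((n : ℝ))⁻¹ * u n)
    (htail : ∀ n q, ∫ ω, highPart (truncLevel n) (x q ω) ^ 2 ∂P ≤ u n) :
    ∀ᵐ ω ∂P, Tendsto (fun n => ∑ q ∈ Finset.range (triNum n), β n q ω * x q ω) atTop (𝓝 0) := by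
  have hL0 : ∀ n, 0 ≤ truncLevel n := fun n => zero_le_one.trans (one_le_truncLevel n)
  -- Truncation destroys the martingale property, so each part is centred by its own conditional
  -- expectation; the two centrings cancel at the end.
  set lo : ℕ → ℕ → Ω → ℝ := fun n q ω => lowPart (truncLevel n) (x q ω) with hlo
  set hi : ℕ → ℕ → Ω → ℝ := fun n q ω => highPart (truncLevel n) (x q ω) with hhi
  have hloM : ∀ n q, Measurable (lo n q) := fun n q => (measurable_lowPart _).comp (hx q)
  have hhiM : ∀ n q, Measurable (hi n q) := fun n q => (measurable_highPart _).comp (hx q)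
  have hloB : ∀ n q ω, |lo n q ω| ≤ truncLevel n := fun n q ω => abs_lowPart_le (hL0 n) _
  have hlo2 : ∀ n q, MemLp (lo n q) 2 P := fun n q =>
    MemLp.of_bound (hloM n q).aestronglyMeasurable (truncLevel n)
      (Eventually.of_forall fun ω => hloB n q ω)
  have hhi2 : ∀ n q, MemLp (hi n q) 2 P := fun n q =>
    (hx2 q).of_le (hhiM n q).aestronglyMeasurable
      (Eventually.of_forall fun ω => abs_highPart_le _ _)
  have hβm : ∀ n q, Measurable (β n q) := fun n q => (hβmeas n q).mono (h𝓕 q) le_rfl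
  -- measurability of the partial sums
  have hterm : ∀ (f : ℕ → ℕ → Ω → ℝ), (∀ n p q, p < q → Measurable[𝓕 q] (f n p)) → ∀ n m,
      Measurable[𝓕 m] fun ω => ∑ k ∈ Finset.range m, β n k ω * (f n k ω - P[f n k | 𝓕 k] ω) := by
    intro f hf n m
    refine @Finset.measurable_fun_sum _ _ _ _ _ _ (𝓕 m) _ _ fun k hk => ?_
    have hk' := Finset.mem_range.mp hk
    exact ((hβmeas n k).mono (h𝓕mono k m hk') le_rfl).mul ((hf n k m hk').sub
      (stronglyMeasurable_condExp.measurable.mono (h𝓕mono k m hk') le_rfl))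
  have hloA : ∀ n p q, p < q → Measurable[𝓕 q] (lo n p) := fun n p q h =>
    (measurable_lowPart _).comp (hadapt p q h)
  have hhiA : ∀ n p q, p < q → Measurable[𝓕 q] (hi n p) := fun n p q h =>
    (measurable_highPart _).comp (hadapt p q h)
  have lowBound : ∀ n q, ∀ᵐ ω ∂P, |β n q ω * (lo n q ω - P[lo n q | 𝓕 q] ω)| ≤
      K * (√(n : ℝ))⁻¹ ^ 3 * (2 * truncLevel n) := by
    intro n q
    filter_upwards [ae_bdd_abs_condExp_of_ae_bdd_abs (m := 𝓕 q) (Eventually.of_forall (hloB n q))]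
      with ω hω
    rw [abs_mul]
    gcongr
    · exact hβ n q ω
    · refine (abs_sub _ _).trans ?_
      linarith [hloB n q ω]
  have low : ∀ᵐ ω ∂P, Tendsto (fun n => ∑ q ∈ Finset.range (triNum n),
      β n q ω * (lo n q ω - P[lo n q | 𝓕 q] ω)) atTop (𝓝 0) := by
    refine ae_tendsto_sum_of_azuma (B := 4 * K ^ 2)
      (c := fun n => K * (√(n : ℝ))⁻¹ ^ 3 * (2 * truncLevel n)) (fun n m => ?_)
      (fun n _ m => lowBound n m) (by simp [triNum]) (fun n _ r m _ => ?_) (fun n hn => ?_)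
    · exact ((hβm n m).aestronglyMeasurable).mul ((hloM n m).aestronglyMeasurable.sub
        integrable_condExp.aestronglyMeasurable)
    · simp_rw [← mul_assoc]
      have hg : Measurable[𝓕 m] fun ω => Real.exp (r * ∑ k ∈ Finset.range m,
          β n k ω * (lo n k ω - P[lo n k | 𝓕 k] ω)) * β n m ω :=
        ((hterm lo hloA n m).const_mul r).exp.mul (hβmeas n m)
      refine integral_mul_sub_condExp_eq_zero (h𝓕 m) hg.stronglyMeasurable
        ((hlo2 n m).integrable one_le_two) ?_
      have he := integrable_exp_sum_range (P := P)
        (d := fun k ω => β n k ω * (lo n k ω - P[lo n k | 𝓕 k] ω))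
        (fun k => ((hβm n k).aestronglyMeasurable).mul ((hloM n k).aestronglyMeasurable.sub
          integrable_condExp.aestronglyMeasurable)) (lowBound n) r m
      exact (he.mul_bdd (hβm n m).aestronglyMeasurable (Eventually.of_forall (hβ n m))).mul_bdd
        (hloM n m).aestronglyMeasurable (Eventually.of_forall (hloB n m))
    · obtain ⟨hs, hsn, hsL⟩ := level_bound hn rfl
      have hsqrt : √(n : ℝ) = (√(n : ℝ))⁻¹ * n := by
        have hn' : (0 : ℝ) < n := by exact_mod_cast hn
        have := Real.sqrt_pos.mpr hn'
        rw [eq_inv_mul_iff_mul_eq₀ this.ne', Real.mul_self_sqrt hn'.le]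
      have hL1 := one_le_truncLevel n
      have ht : (triNum n : ℝ) ≤ (n : ℝ) ^ 2 := by exact_mod_cast triNum_le_sq n
      set s := (√(n : ℝ))⁻¹
      set L := truncLevel n
      rw [hsqrt]
      have hL24 : L ^ 2 ≤ L ^ 4 := pow_le_pow_right₀ hL1 (by norm_num)
      calc s * n * (K * s ^ 3 * (2 * L)) ^ 2 * triNum n
          ≤ s * n * (K * s ^ 3 * (2 * L)) ^ 2 * (n : ℝ) ^ 2 := by gcongr
        _ = 4 * K ^ 2 * ((s ^ 2 * n) ^ 3 * (L ^ 2 * s)) := by ring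
        _ = 4 * K ^ 2 * (L ^ 2 * s) := by rw [hsn]; ring
        _ ≤ 4 * K ^ 2 * (L ^ 4 * s) := by gcongr
        _ ≤ 4 * K ^ 2 * 1 := by gcongr
        _ = _ := mul_one _
  have hd2 : ∀ n q, MemLp (fun ω => β n q ω * (hi n q ω - P[hi n q | 𝓕 q] ω)) 2 P := fun n q =>
    ((hhi2 n q).sub ((hhi2 n q).condExp one_le_two)).of_le_mul
      (c := K * (√(n : ℝ))⁻¹ ^ 3)
      (((hβm n q).aestronglyMeasurable).mul ((hhiM n q).aestronglyMeasurable.sub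
        integrable_condExp.aestronglyMeasurable))
      (Eventually.of_forall fun ω => by
        rw [norm_mul]
        exact mul_le_mul_of_nonneg_right (hβ n q ω) (norm_nonneg _))
  have high : ∀ᵐ ω ∂P, Tendsto (fun n => ∑ q ∈ Finset.range (triNum n),
      β n q ω * (hi n q ω - P[hi n q | 𝓕 q] ω)) atTop (𝓝 0) := by
    have hsum : ∀ n, MemLp (fun ω => ∑ q ∈ Finset.range (triNum n),
        β n q ω * (hi n q ω - P[hi n q | 𝓕 q] ω)) 2 P := fun n => memLp_finsetSum _ fun k _ => hd2 n k
    -- Orthogonality leaves at most `n ^ 2` terms of size `K ^ 2 * s ^ 6 * u n`, that is `K ^ 2 * u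
    -- n / n` in total.
    have hmom : ∀ n, ∫ ω, (∑ q ∈ Finset.range (triNum n),
        β n q ω * (hi n q ω - P[hi n q | 𝓕 q] ω)) ^ 2 ∂P ≤ K ^ 2 * ((n : ℝ)⁻¹ * u n) := by
      intro n
      rcases Nat.eq_zero_or_pos n with rfl | hn
      · simp [triNum]
      rw [integral_sum_range_sq (hd2 n) _ fun m _ => ?_]
      · obtain ⟨hs, hsn, -⟩ := level_bound hn rfl
        have ht : (triNum n : ℝ) ≤ (n : ℝ) ^ 2 := by exact_mod_cast triNum_le_sq n
        have hu0 : 0 ≤ u n := (integral_nonneg fun ω => by positivity).trans (htail n 0)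
        have hone : ∀ q, ∫ ω, (β n q ω * (hi n q ω - P[hi n q | 𝓕 q] ω)) ^ 2 ∂P ≤
            (K * (√(n : ℝ))⁻¹ ^ 3) ^ 2 * u n := by
          intro q
          have h1 : ∫ ω, (β n q ω * (hi n q ω - P[hi n q | 𝓕 q] ω)) ^ 2 ∂P ≤
              ∫ ω, (K * (√(n : ℝ))⁻¹ ^ 3) ^ 2 * (hi n q ω - P[hi n q | 𝓕 q] ω) ^ 2 ∂P := by
            refine integral_mono (hd2 n q).integrable_sq
              (((hhi2 n q).sub ((hhi2 n q).condExp one_le_two)).integrable_sq.const_mul _) ?_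
            intro ω
            simp only
            rw [mul_pow, ← sq_abs (β n q ω)]
            have := hβ n q ω
            gcongr
          refine h1.trans ?_
          rw [integral_const_mul]
          gcongr
          exact (integral_sub_condExp_sq_le (h𝓕 q) (hhi2 n q)).trans (htail n q)
        refine (Finset.sum_le_sum fun q _ => hone q).trans ?_
        rw [Finset.sum_const, Finset.card_range, nsmul_eq_mul]
        have hinv : (n : ℝ)⁻¹ = (√(n : ℝ))⁻¹ ^ 2 := by
          rw [inv_pow, Real.sq_sqrt (Nat.cast_nonneg n)]
        rw [hinv]
        set s := (√(n : ℝ))⁻¹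
        calc (triNum n : ℝ) * ((K * s ^ 3) ^ 2 * u n) ≤ (n : ℝ) ^ 2 * ((K * s ^ 3) ^ 2 * u n) := by
              gcongr
          _ = K ^ 2 * ((s ^ 2 * n) ^ 2 * (s ^ 2 * u n)) := by ring
          _ = _ := by rw [hsn]; ring
      · simp_rw [← mul_assoc]
        have hg : Measurable[𝓕 m] fun ω => (∑ k ∈ Finset.range m,
            β n k ω * (hi n k ω - P[hi n k | 𝓕 k] ω)) * β n m ω :=
          (hterm hi hhiA n m).mul (hβmeas n m)
        refine integral_mul_sub_condExp_eq_zero (h𝓕 m) hg.stronglyMeasurable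
          ((hhi2 n m).integrable one_le_two) ?_
        have hS : MemLp (fun ω => ∑ k ∈ Finset.range m,
            β n k ω * (hi n k ω - P[hi n k | 𝓕 k] ω)) 2 P := memLp_finsetSum _ fun k _ => hd2 n k
        have hbx : MemLp (fun ω => β n m ω * hi n m ω) 2 P :=
          (hhi2 n m).of_le_mul (c := K * (√(n : ℝ))⁻¹ ^ 3)
            ((hβm n m).mul (hhiM n m)).aestronglyMeasurable
            (Eventually.of_forall fun ω => by
              rw [norm_mul]
              exact mul_le_mul_of_nonneg_right (hβ n m ω) (norm_nonneg _))
        refine (hS.integrable_mul hbx).congr (Eventually.of_forall fun ω => ?_)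
        simp only [Pi.mul_apply]
        ring
    have := ae_tendsto_zero_of_summable_integral (fun n => (hsum n).integrable_sq)
      (fun n => Eventually.of_forall fun ω => by positivity) (hu.mul_left (K ^ 2)) hmom
    filter_upwards [this] with ω hω
    exact tendsto_zero_of_tendsto_pow hω
  -- The centrings add up to the conditional expectation of `x q` itself, which is zero.
  have hcond : ∀ n q, ∀ᵐ ω ∂P, P[lo n q | 𝓕 q] ω + P[hi n q | 𝓕 q] ω = 0 := by
    intro n q
    have h1 : lo n q + hi n q = x q := by
      ext ω; exact lowPart_add_highPart _ _
    have h2 := condExp_add ((hlo2 n q).integrable one_le_two) ((hhi2 n q).integrable one_le_two)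
      (𝓕 q)
    rw [h1] at h2
    filter_upwards [h2, hmart q] with ω h3 h4
    rw [h3] at h4
    exact h4
  filter_upwards [low, high, ae_all_iff.mpr fun n => ae_all_iff.mpr (hcond n)] with ω h1 h2 h3
  have h4 := h1.add h2
  rw [add_zero] at h4
  refine h4.congr fun n => ?_
  rw [← Finset.sum_add_distrib]
  refine Finset.sum_congr rfl fun q _ => ?_
  have h5 : lo n q ω + hi n q ω = x q ω := lowPart_add_highPart _ _
  rw [← h5, ← mul_add]
  congr 1
  linarith [h3 n q]

end MartingaleSums

/-! ### Row blocks: the second-order term. -/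

section RowBlocks

variable {Ω : Type*} [mΩ : MeasurableSpace Ω] {P : Measure Ω} [IsProbabilityMeasure P]

theorem sum_range_triNum_eq_sum_rows {M : Type*} [AddCommMonoid M] (Z : ℕ → M) (n : ℕ) :
    ∑ q ∈ Finset.range (triNum n), Z q =
      ∑ i ∈ Finset.range n, ∑ j ∈ Finset.range (i + 1), Z (triNum i + j) := by
  induction n with
  | zero => simp [triNum]
  | succ n ih =>
    rw [triNum_succ, Finset.sum_range_add, ih]
    conv_rhs => rw [Finset.sum_range_succ]

theorem add_le_of_mod_eq {a k m : ℕ} (hkm : k < m) (h : k % a = m % a) : k + a ≤ m := by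
  have h1 : a ∣ m - k := (Nat.modEq_iff_dvd' hkm.le).mp h
  have := Nat.le_of_dvd (by omega) h1
  omega

variable {x : ℕ → Ω → ℝ} {𝓕 : ℕ → MeasurableSpace Ω} {K : ℝ} {a : ℕ}

/-- Weighted sums of truncated squares, centred by conditional expectations that are nested only
for rows at distance at least `a`. -/
theorem ae_tendsto_sum_mul_sq_sub_condExp (hx : ∀ q, Measurable (x q)) (ha : 1 ≤ a)
    (h𝓕 : ∀ q, 𝓕 q ≤ mΩ)
    (h𝓕row : ∀ p q, (lexEnum p).1 + a ≤ (lexEnum q).1 → 𝓕 p ≤ 𝓕 q)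
    (hadapt : ∀ p q, (lexEnum p).1 + a ≤ (lexEnum q).1 → Measurable[𝓕 q] (x p))
    {b : ℕ → ℕ → Ω → ℝ} (hbmeas : ∀ n q, Measurable[𝓕 q] (b n q)) (hK : 0 ≤ K)
    (hb : ∀ n q ω, |b n q ω| ≤ K * (√(n : ℝ))⁻¹ ^ 4) :
    ∀ᵐ ω ∂P, Tendsto (fun n => ∑ q ∈ Finset.range (triNum n), b n q ω *
      (lowPart (truncLevel n) (x q ω) ^ 2 -
        P[fun ω' => lowPart (truncLevel n) (x q ω') ^ 2 | 𝓕 q] ω)) atTop (𝓝 0) := by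
  have hL0 : ∀ n, 0 ≤ truncLevel n := fun n => zero_le_one.trans (one_le_truncLevel n)
  set w : ℕ → ℕ → Ω → ℝ := fun n q ω => lowPart (truncLevel n) (x q ω) ^ 2 with hw
  have hwM : ∀ n q, Measurable (w n q) := fun n q =>
    ((measurable_lowPart _).comp (hx q)).pow_const 2
  have hwB : ∀ n q ω, |w n q ω| ≤ truncLevel n ^ 2 := fun n q ω => by
    simp only [hw, abs_pow]
    have := abs_lowPart_le (hL0 n) (x q ω)
    gcongr
  have hwI : ∀ n q, Integrable (w n q) P := fun n q =>
    Integrable.of_bound (hwM n q).aestronglyMeasurable (truncLevel n ^ 2)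
      (Eventually.of_forall fun ω => hwB n q ω)
  have hbm : ∀ n q, Measurable (b n q) := fun n q => (hbmeas n q).mono (h𝓕 q) le_rfl
  set Z : ℕ → ℕ → Ω → ℝ := fun n q ω => b n q ω * (w n q ω - P[w n q | 𝓕 q] ω) with hZ
  have hZM : ∀ n q, AEStronglyMeasurable (Z n q) P := fun n q =>
    (hbm n q).aestronglyMeasurable.mul ((hwM n q).aestronglyMeasurable.sub
      integrable_condExp.aestronglyMeasurable)
  have hZB : ∀ n q, ∀ᵐ ω ∂P, |Z n q ω| ≤ K * (√(n : ℝ))⁻¹ ^ 4 * (2 * truncLevel n ^ 2) := by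
    intro n q
    filter_upwards [ae_bdd_abs_condExp_of_ae_bdd_abs (m := 𝓕 q) (Eventually.of_forall (hwB n q))]
      with ω hω
    rw [hZ, abs_mul]
    gcongr
    · exact hb n q ω
    · refine (abs_sub _ _).trans ?_
      linarith [hwB n q ω]
  have hZA : ∀ n p q, (lexEnum p).1 + a ≤ (lexEnum q).1 → Measurable[𝓕 q] (Z n p) :=
    fun n p q hpq => ((hbmeas n p).mono (h𝓕row p q hpq) le_rfl).mul
      ((((measurable_lowPart _).comp (hadapt p q hpq)).pow_const 2).sub
        (stronglyMeasurable_condExp.measurable.mono (h𝓕row p q hpq) le_rfl))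
  -- An increment is a whole row in the residue class `r` modulo `a`; earlier rows of the same class
  -- are at least `a` above it.
  set d : ℕ → ℕ → ℕ → Ω → ℝ := fun r n i ω =>
    if i < n ∧ i % a = r then ∑ j ∈ Finset.range (i + 1), Z n (triNum i + j) ω else 0 with hd
  have hdM : ∀ r n i, AEStronglyMeasurable (d r n i) P := by
    intro r n i
    simp only [hd]
    split_ifs
    · exact Finset.aestronglyMeasurable_fun_sum _ fun j _ => hZM n _
    · exact aestronglyMeasurable_const
  have hdB : ∀ r n i, ∀ᵐ ω ∂P, |d r n i ω| ≤
      n * (K * (√(n : ℝ))⁻¹ ^ 4 * (2 * truncLevel n ^ 2)) := by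
    intro r n i
    filter_upwards [ae_all_iff.mpr (hZB n)] with ω hω
    simp only [hd]
    split_ifs with h
    · refine (Finset.abs_sum_le_sum_abs _ _).trans ((Finset.sum_le_sum fun j _ => hω _).trans ?_)
      rw [Finset.sum_const, Finset.card_range, nsmul_eq_mul]
      have : ((i + 1 : ℕ) : ℝ) ≤ n := by exact_mod_cast h.1
      gcongr
    · rw [abs_zero]; positivity
  have main : ∀ r, ∀ᵐ ω ∂P, Tendsto (fun n => ∑ i ∈ Finset.range n, d r n i ω) atTop (𝓝 0) := by
    intro r
    refine ae_tendsto_sum_of_azuma (M := fun n => n) (B := 4 * K ^ 2) (hdM r)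
      (fun n _ => hdB r n) rfl (fun n _ y m hm => ?_) (fun n hn => ?_)
    · by_cases hr : m % a = r
      · have hdm : d r n m = fun ω => ∑ j ∈ Finset.range (m + 1), Z n (triNum m + j) ω := by
          ext ω; simp only [hd]; rw [if_pos ⟨hm, hr⟩]
        have he := integrable_exp_sum_range (hdM r n) (hdB r n) y m
        have hint : ∀ j, Integrable (fun ω => Real.exp (y * ∑ k ∈ Finset.range m, d r n k ω) *
            Z n (triNum m + j) ω) P := fun j => he.mul_bdd (hZM n _) (hZB n _)
        rw [hdm]
        simp_rw [Finset.mul_sum] at *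
        -- Each entry of row `m` is conditioned on its own sigma-algebra. All these contain the
        -- earlier rows of the class, so orthogonality is checked entry by entry without a common
        -- filtration.
        rw [integral_finsetSum _ fun j _ => hint j]
        refine Finset.sum_eq_zero fun j hj => ?_
        have hj' : j ≤ m := by have := Finset.mem_range.mp hj; omega
        simp only [hZ, ← mul_assoc]
        have hSA : Measurable[𝓕 (triNum m + j)] fun ω =>
            Real.exp (∑ k ∈ Finset.range m, y * d r n k ω) := by
          refine Measurable.exp ?_
          refine @Finset.measurable_fun_sum _ _ _ _ _ _ (𝓕 (triNum m + j)) _ _ fun k hk => ?_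
          refine Measurable.const_mul ?_ y
          have hk' := Finset.mem_range.mp hk
          simp only [hd]
          split_ifs with h
          · refine @Finset.measurable_fun_sum _ _ _ _ _ _ (𝓕 (triNum m + j)) _ _ fun l hl => ?_
            refine hZA n _ _ ?_
            have hl' := Finset.mem_range.mp hl
            rw [lexEnum_triNum_add hj', lexEnum_triNum_add (by omega)]
            have := add_le_of_mod_eq hk' (h.2.trans hr.symm)
            simp only
            omega
          · exact measurable_const
        exact integral_mul_sub_condExp_eq_zero (h𝓕 _)
          (hSA.mul (hbmeas n _)).stronglyMeasurable (hwI n _)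
          ((he.mul_bdd (hbm n _).aestronglyMeasurable (Eventually.of_forall (hb n _))).mul_bdd
            (hwM n _).aestronglyMeasurable (Eventually.of_forall (hwB n _)))
      · have hdm : d r n m = fun ω => 0 := by
          ext ω; simp only [hd]; rw [if_neg fun h => hr h.2]
        simp [hdm]
    · obtain ⟨hs, hsn, hsL⟩ := level_bound hn rfl
      have hsqrt : √(n : ℝ) = (√(n : ℝ))⁻¹ * n := by
        have hn' : (0 : ℝ) < n := by exact_mod_cast hn
        have := Real.sqrt_pos.mpr hn'
        rw [eq_inv_mul_iff_mul_eq₀ this.ne', Real.mul_self_sqrt hn'.le]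
      set s := (√(n : ℝ))⁻¹
      set L := truncLevel n
      rw [hsqrt]
      -- A row of `n` terms is bounded only by the triangle inequality, which uses up the whole
      -- bound `L ^ 4 * s ≤ 1`.
      calc s * n * (n * (K * s ^ 4 * (2 * L ^ 2))) ^ 2 * n
          = 4 * K ^ 2 * ((s ^ 2 * n) ^ 4 * (L ^ 4 * s)) := by ring
        _ = 4 * K ^ 2 * (L ^ 4 * s) := by rw [hsn]; ring
        _ ≤ 4 * K ^ 2 * 1 := by gcongr
        _ = _ := mul_one _
  filter_upwards [ae_all_iff.mpr main] with ω hω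
  have h1 := tendsto_finsetSum (Finset.range a) fun r _ => hω r
  rw [Finset.sum_const_zero] at h1
  refine h1.congr fun n => ?_
  rw [sum_range_triNum_eq_sum_rows (fun q => Z n q ω), Finset.sum_comm]
  refine Finset.sum_congr rfl fun i hi => ?_
  have hi' := Finset.mem_range.mp hi
  simp only [hd, hi', true_and]
  rw [Finset.sum_ite_eq, if_pos (Finset.mem_range.mpr (Nat.mod_lt _ ha))]

end RowBlocks

/-! ### Counting neighbours in the lattice. -/

section Neighbours

/-- The indices before `q` whose positions are at distance less than `a` from that of `q`. -/
def nearSet (a q : ℕ) : Finset ℕ := (Finset.range q).filter fun p =>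
  max |((lexEnum p).1 : ℤ) - (lexEnum q).1| |((lexEnum p).2 : ℤ) - (lexEnum q).2| < a

theorem lexEnum_injective : Function.Injective lexEnum := fun p q h => by
  have h1 := (lexEnum_spec p).2.2
  have h2 := (lexEnum_spec q).2.2
  rw [h] at h1
  exact h1.symm.trans h2

theorem card_near_le (a q : ℕ) (S : Finset ℕ) (hS : ∀ p ∈ S,
    max |((lexEnum p).1 : ℤ) - (lexEnum q).1| |((lexEnum p).2 : ℤ) - (lexEnum q).2| < a) :
    S.card ≤ (2 * a + 1) ^ 2 := by
  have h1 : S.card ≤ ((Finset.Icc (((lexEnum q).1 : ℤ) - a) ((lexEnum q).1 + a)) ×ˢ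
      (Finset.Icc (((lexEnum q).2 : ℤ) - a) ((lexEnum q).2 + a))).card := by
    refine Finset.card_le_card_of_injOn
      (fun p => (((lexEnum p).1 : ℤ), ((lexEnum p).2 : ℤ))) (fun p hp => ?_) ?_
    · have := hS p hp
      rw [max_lt_iff, abs_lt, abs_lt] at this
      simp only [Finset.coe_product, Finset.coe_Icc, Set.mem_prod, Set.mem_Icc]
      omega
    · intro p _ r _ h
      simp only [Prod.mk.injEq, Nat.cast_inj] at h
      exact lexEnum_injective (Prod.ext h.1 h.2)
  refine h1.trans (le_of_eq ?_)
  rw [Finset.card_product, Int.card_Icc, Int.card_Icc, sq]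
  congr 1 <;> omega

theorem sum_nearSet_left_le (a N : ℕ) {f : ℕ → ℝ} (hf : ∀ p, 0 ≤ f p) :
    ∑ q ∈ Finset.range N, ∑ _p ∈ nearSet a q, f q ≤
      ((2 * a + 1) ^ 2 : ℕ) * ∑ q ∈ Finset.range N, f q := by
  rw [Finset.mul_sum]
  refine Finset.sum_le_sum fun q _ => ?_
  rw [Finset.sum_const, nsmul_eq_mul]
  have := card_near_le a q (nearSet a q) fun p hp => (Finset.mem_filter.mp hp).2
  exact mul_le_mul_of_nonneg_right (by exact_mod_cast this) (hf q)

/-- Exchange the sums: being near is symmetric, so each `p` is a neighbour of at most `(2 * a + 1) ^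
2` indices `q`. -/
theorem sum_nearSet_right_le (a N : ℕ) {f : ℕ → ℝ} (hf : ∀ p, 0 ≤ f p) :
    ∑ q ∈ Finset.range N, ∑ p ∈ nearSet a q, f p ≤
      ((2 * a + 1) ^ 2 : ℕ) * ∑ q ∈ Finset.range N, f q := by
  have h1 : ∑ q ∈ Finset.range N, ∑ p ∈ nearSet a q, f p =
      ∑ p ∈ Finset.range N, ∑ _q ∈ (Finset.range N).filter (fun q => p ∈ nearSet a q), f p := by
    refine Finset.sum_comm' fun q p => ?_
    simp only [nearSet, Finset.mem_filter, Finset.mem_range]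
    constructor
    · rintro ⟨h1, h2, h3⟩
      exact ⟨⟨h1, h2, h3⟩, h2.trans h1⟩
    · rintro ⟨⟨h1, h2, h3⟩, -⟩
      exact ⟨h1, h2, h3⟩
  rw [h1, Finset.mul_sum]
  refine Finset.sum_le_sum fun p _ => ?_
  rw [Finset.sum_const, nsmul_eq_mul]
  refine mul_le_mul_of_nonneg_right ?_ (hf p)
  have := card_near_le a p ((Finset.range N).filter (fun q => p ∈ nearSet a q)) fun q hq => by
    have := (Finset.mem_filter.mp (Finset.mem_filter.mp hq).2).2
    rwa [abs_sub_comm, abs_sub_comm ((lexEnum q).2 : ℤ)]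
  exact_mod_cast this

end Neighbours

/-! ### Past sigma-algebras along the enumeration. -/

section PastSigma

variable {Ω : Type*} {X : ℤ → ℤ → Ω → ℝ}

/-- The past sigma-algebra of the entry with index `q`. -/
abbrev seqPast (X : ℤ → ℤ → Ω → ℝ) (a q : ℕ) : MeasurableSpace Ω :=
  pastSigma X (lexEnum q).1 (lexEnum q).2 a

/-- The entry with index `q`. -/
def seqField (X : ℤ → ℤ → Ω → ℝ) (q : ℕ) : Ω → ℝ := X (lexEnum q).1 (lexEnum q).2

theorem seqPast_le [mΩ : MeasurableSpace Ω] (hX : ∀ i j, Measurable (X i j)) (a q : ℕ) : seqPast X a q ≤ mΩ :=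
  iSup_le fun p => by
    rw [← BorelSpace.measurable_eq (α := ℝ)]
    exact (hX _ _).comap_le

theorem measurable_pastSigma {i j u v : ℤ} {a : ℕ} (h : (u, v) ∈ lexPast i j a) (hvu : v ≤ u) :
    Measurable[pastSigma X i j a] (X u v) := by
  refine Measurable.mono (comap_measurable (X u v)) ?_ le_rfl
  rw [BorelSpace.measurable_eq (α := ℝ)]
  exact le_iSup (fun p : {p : ℤ × ℤ // p ∈ lexPast i j a ∧ p.2 ≤ p.1} =>
    MeasurableSpace.comap (X p.1.1 p.1.2) (borel ℝ)) ⟨(u, v), h, hvu⟩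

theorem pastSigma_le_pastSigma {i j i' j' : ℤ} {a a' : ℕ}
    (h : lexPast i j a ⊆ lexPast i' j' a') : pastSigma X i j a ≤ pastSigma X i' j' a' :=
  iSup_le fun p => le_iSup (fun p : {p : ℤ × ℤ // p ∈ lexPast i' j' a' ∧ p.2 ≤ p.1} =>
    MeasurableSpace.comap (X p.1.1 p.1.2) (borel ℝ)) ⟨p.1, h p.2.1, p.2.2⟩

/-- An index earlier than `q` is lexicographically smaller, so it can escape the past sigma-algebra
only by being too close. -/
theorem measurable_seqField_of_notMem_nearSet {a p q : ℕ} (hpq : p < q) (h : p ∉ nearSet a q) :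
    Measurable[seqPast X a q] (seqField X p) := by
  refine measurable_pastSigma ⟨?_, ?_⟩ (by exact_mod_cast (lexEnum_spec p).2.1)
  · by_contra hlt
    exact h (Finset.mem_filter.mpr ⟨Finset.mem_range.mpr hpq, not_le.mp hlt⟩)
  · simp only
    have := lexEnum_lt hpq
    omega

theorem nearSet_one (q : ℕ) : nearSet 1 q = ∅ := by
  ext p
  simp only [nearSet, Finset.mem_filter, Finset.mem_range, Finset.notMem_empty, iff_false, not_and,
    not_lt]
  intro hpq
  have := lexEnum_lt hpq
  rw [le_max_iff, le_abs, le_abs]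
  push_cast
  omega

theorem measurable_seqField_one {p q : ℕ} (hpq : p < q) :
    Measurable[seqPast X 1 q] (seqField X p) :=
  measurable_seqField_of_notMem_nearSet hpq (by simp [nearSet_one])

/-- At `a = 1` the distance condition removes only the index itself, so the past is everything
strictly earlier. -/
theorem seqPast_one_mono {p q : ℕ} (hpq : p < q) : seqPast X 1 p ≤ seqPast X 1 q := by
  refine pastSigma_le_pastSigma fun z hz => ?_
  simp only [lexPast, Set.mem_ofPred_eq, le_max_iff, le_abs] at hz ⊢
  have := lexEnum_lt hpq
  push_cast at hz ⊢
  omega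

/-- A site in the past of `p` lies in a row at most that of `p`, so the gap between the rows alone
puts it at distance `a` from `q`. -/
theorem seqPast_row_mono {a p q : ℕ} (ha : 1 ≤ a) (h : (lexEnum p).1 + a ≤ (lexEnum q).1) :
    seqPast X a p ≤ seqPast X a q := by
  refine pastSigma_le_pastSigma fun z hz => ?_
  simp only [lexPast, Set.mem_ofPred_eq, le_max_iff, le_abs] at hz ⊢
  omega

theorem measurable_seqField_row {a p q : ℕ} (ha : 1 ≤ a)
    (h : (lexEnum p).1 + a ≤ (lexEnum q).1) : Measurable[seqPast X a q] (seqField X p) := by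
  refine measurable_pastSigma ⟨?_, ?_⟩ (by exact_mod_cast (lexEnum_spec p).2.1)
  · simp only [le_max_iff, le_abs]
    omega
  · simp only
    omega

end PastSigma

/-! ### Deterministic estimates for the error terms. -/

section Pathwise

theorem sq_le_sq_add_highPart_sq {L : ℝ} (hL : 0 ≤ L) (x : ℝ) :
    x ^ 2 ≤ L ^ 2 + highPart L x ^ 2 := by
  rw [← lowPart_sq_add_highPart_sq L x]
  have := sq_le_sq' (by linarith [(abs_le.mp (abs_lowPart_le hL x)).1])
    (abs_le.mp (abs_lowPart_le hL x)).2
  linarith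

/-- This uncouples two different entries without a joint moment. If `|y| ≤ L` the minimum is at most
`L * s`, which absorbs `L ^ 2`; if `|y| > L` then `highPart L y ^ 2` itself dominates `L ^ 2`. -/
theorem min_mul_sq_add_le {L s C : ℝ} (hL : 1 ≤ L) (hs : 0 ≤ s) (hC : 0 ≤ C) (x y : ℝ) :
    min 1 (|y| * s) * (x ^ 2 + C) ≤
      (1 + C) * (L ^ 3 * s + (highPart L y ^ 2 + highPart L x ^ 2)) := by
  have hL0 : 0 ≤ L := zero_le_one.trans hL
  have hx := sq_le_sq_add_highPart_sq hL0 x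
  have hV : 0 ≤ highPart L x ^ 2 := sq_nonneg _
  have hW : 0 ≤ highPart L y ^ 2 := sq_nonneg _
  have hm0 : 0 ≤ min 1 (|y| * s) := le_min zero_le_one (by positivity)
  have hm1 : min 1 (|y| * s) ≤ 1 := min_le_left _ _
  have hL2 : 1 ≤ L ^ 2 := one_le_pow₀ hL
  rcases le_or_gt |y| L with h | h
  · have h1 : min 1 (|y| * s) ≤ L * s := (min_le_right _ _).trans (by gcongr)
    have h2 : L * s ≤ L ^ 3 * s := by
      have : L ≤ L ^ 3 := le_self_pow₀ hL (by norm_num)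
      gcongr
    have a1 : min 1 (|y| * s) * L ^ 2 ≤ L ^ 3 * s := by
      calc _ ≤ L * s * L ^ 2 := by gcongr
        _ = _ := by ring
    have a2 : min 1 (|y| * s) * highPart L x ^ 2 ≤ highPart L x ^ 2 := mul_le_of_le_one_left hV hm1
    have a3 : min 1 (|y| * s) * C ≤ C * (L ^ 3 * s) := by
      rw [mul_comm]
      gcongr
      exact h1.trans h2
    have a4 : min 1 (|y| * s) * (x ^ 2 + C) ≤
        min 1 (|y| * s) * (L ^ 2 + highPart L x ^ 2 + C) := by gcongr
    have a5 : 0 ≤ C * (highPart L y ^ 2 + highPart L x ^ 2) := by positivity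
    nlinarith
  · have h1 : highPart L y ^ 2 = y ^ 2 := by rw [highPart, if_neg (not_le.mpr h)]
    have h2 : L ^ 2 ≤ highPart L y ^ 2 := by
      rw [h1, ← sq_abs y]; gcongr
    have a1 : min 1 (|y| * s) * (x ^ 2 + C) ≤ x ^ 2 + C :=
      mul_le_of_le_one_left (by positivity) hm1
    have a2 : C ≤ C * highPart L y ^ 2 := le_mul_of_one_le_right hC (hL2.trans h2)
    have a3 : 0 ≤ C * highPart L x ^ 2 := by positivity
    have a4 : 0 ≤ (1 + C) * (L ^ 3 * s) := by positivity
    nlinarith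

theorem min_sq_cube_le {L s : ℝ} (hL : 1 ≤ L) (hs : 0 ≤ s) (x : ℝ) :
    min (x ^ 2) (|x| ^ 3 * s) ≤ L ^ 3 * s + highPart L x ^ 2 := by
  have hL0 : 0 ≤ L := zero_le_one.trans hL
  rcases le_or_gt |x| L with h | h
  · have : |x| ^ 3 * s ≤ L ^ 3 * s := by gcongr
    have hV : 0 ≤ highPart L x ^ 2 := sq_nonneg _
    linarith [min_le_right (x ^ 2) (|x| ^ 3 * s)]
  · have h1 : highPart L x ^ 2 = x ^ 2 := by rw [highPart, if_neg (not_le.mpr h)]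
    have : 0 ≤ L ^ 3 * s := by positivity
    linarith [min_le_left (x ^ 2) (|x| ^ 3 * s)]

/-- The eighth power is at most `n ^ 3 * n ^ (-4) = n ^ (-1)`. -/
theorem tendsto_truncLevel_cube_mul :
    Tendsto (fun n : ℕ => truncLevel n ^ 3 * (√(n : ℝ))⁻¹) atTop (𝓝 0) := by
  refine tendsto_zero_of_tendsto_pow (k := 8) ?_
  refine squeeze_zero' (Eventually.of_forall fun n => by positivity) ?_
    tendsto_inv_atTop_nhds_zero_nat
  filter_upwards [eventually_ge_atTop 1] with n hn
  have hL := truncLevel_pow_le hn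
  have hL0 := zero_le_one.trans (one_le_truncLevel n)
  obtain ⟨hs, hsn, -⟩ := level_bound hn rfl
  have hn' : (0 : ℝ) < n := by exact_mod_cast hn
  have hinv : (n : ℝ)⁻¹ = (√(n : ℝ))⁻¹ ^ 2 := by
    rw [inv_pow, Real.sq_sqrt hn'.le]
  rw [hinv]
  set s := (√(n : ℝ))⁻¹
  set L := truncLevel n
  calc (L ^ 3 * s) ^ 8 = (L ^ 8) ^ 3 * s ^ 8 := by ring
    _ ≤ (n : ℝ) ^ 3 * s ^ 8 := by gcongr
    _ = (s ^ 2 * n) ^ 3 * s ^ 2 := by ring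
    _ = s ^ 2 := by rw [hsn]; ring

/-- This bounds the total cost of zeroing the neighbours in the quadratic weights: a vanishing term
plus an average of large squares, up to a constant depending on `a` and `C`. -/
theorem sum_near_le {a n : ℕ} {C : ℝ} (hC : 0 ≤ C) (x : ℕ → ℝ) :
    (√(n : ℝ))⁻¹ ^ 4 * ∑ q ∈ Finset.range (triNum n),
      (∑ p ∈ nearSet a q, min 1 (|x p| * (√(n : ℝ))⁻¹)) * (x q ^ 2 + C) ≤
    (1 + C) * ((2 * a + 1) ^ 2 : ℕ) * (truncLevel n ^ 3 * (√(n : ℝ))⁻¹ +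
      2 * ((√(n : ℝ))⁻¹ ^ 4 *
        ∑ q ∈ Finset.range (triNum n), highPart (truncLevel n) (x q) ^ 2)) := by
  set s := (√(n : ℝ))⁻¹ with hs_def
  have hs : 0 ≤ s := by positivity
  have hL := one_le_truncLevel n
  set L := truncLevel n
  have hsN : s ^ 4 * triNum n ≤ 1 := by
    rcases Nat.eq_zero_or_pos n with rfl | hn
    · simp [triNum]
    obtain ⟨-, hsn, -⟩ := level_bound hn hs_def
    have ht : (triNum n : ℝ) ≤ (n : ℝ) ^ 2 := by exact_mod_cast triNum_le_sq n
    calc s ^ 4 * triNum n ≤ s ^ 4 * (n : ℝ) ^ 2 := by gcongr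
      _ = (s ^ 2 * n) ^ 2 := by ring
      _ = 1 := by rw [hsn]; ring
  have h1 : ∑ q ∈ Finset.range (triNum n), (∑ p ∈ nearSet a q, min 1 (|x p| * s)) * (x q ^ 2 + C) ≤
      (1 + C) * ∑ q ∈ Finset.range (triNum n), ∑ p ∈ nearSet a q,
        (L ^ 3 * s + (highPart L (x p) ^ 2 + highPart L (x q) ^ 2)) := by
    rw [Finset.mul_sum]
    refine Finset.sum_le_sum fun q _ => ?_
    rw [Finset.sum_mul, Finset.mul_sum]
    exact Finset.sum_le_sum fun p _ => min_mul_sq_add_le hL hs hC _ _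
  have h2 := sum_nearSet_left_le a (triNum n) (f := fun _ => L ^ 3 * s) (fun _ => by positivity)
  have h3 := sum_nearSet_left_le a (triNum n) (f := fun q => highPart L (x q) ^ 2)
    (fun _ => sq_nonneg _)
  have h4 := sum_nearSet_right_le a (triNum n) (f := fun q => highPart L (x q) ^ 2)
    (fun _ => sq_nonneg _)
  simp only [Finset.sum_add_distrib] at h1
  rw [Finset.sum_const (s := Finset.range (triNum n)), Finset.card_range, nsmul_eq_mul] at h2
  set V := ∑ q ∈ Finset.range (triNum n), highPart L (x q) ^ 2
  set R : ℝ := (((2 * a + 1) ^ 2 : ℕ) : ℝ)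
  have hR : 0 ≤ R := Nat.cast_nonneg _
  calc _ ≤ s ^ 4 * ((1 + C) * (R * (triNum n * (L ^ 3 * s)) + (R * V + R * V))) := by
        refine mul_le_mul_of_nonneg_left (h1.trans ?_) (by positivity)
        gcongr
    _ = (1 + C) * R * ((s ^ 4 * triNum n) * (L ^ 3 * s) + 2 * (s ^ 4 * V)) := by ring
    _ ≤ (1 + C) * R * (1 * (L ^ 3 * s) + 2 * (s ^ 4 * V)) := by gcongr
    _ = _ := by rw [one_mul]

theorem sum_remainder_le {n : ℕ} {m : ℝ} (hm : 0 ≤ m) (x : ℕ → ℝ) :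
    (√(n : ℝ))⁻¹ ^ 4 * ∑ q ∈ Finset.range (triNum n),
      (min (x q ^ 2) (|x q| ^ 3 * (√(n : ℝ))⁻¹) + m * (√(n : ℝ))⁻¹) ≤
    (1 + m) * (truncLevel n ^ 3 * (√(n : ℝ))⁻¹) +
      (√(n : ℝ))⁻¹ ^ 4 * ∑ q ∈ Finset.range (triNum n), highPart (truncLevel n) (x q) ^ 2 := by
  set s := (√(n : ℝ))⁻¹ with hs_def
  have hs : 0 ≤ s := by positivity
  have hL := one_le_truncLevel n
  set L := truncLevel n
  have hsN : s ^ 4 * triNum n ≤ 1 := by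
    rcases Nat.eq_zero_or_pos n with rfl | hn
    · simp [triNum]
    obtain ⟨-, hsn, -⟩ := level_bound hn hs_def
    have ht : (triNum n : ℝ) ≤ (n : ℝ) ^ 2 := by exact_mod_cast triNum_le_sq n
    calc s ^ 4 * triNum n ≤ s ^ 4 * (n : ℝ) ^ 2 := by gcongr
      _ = (s ^ 2 * n) ^ 2 := by ring
      _ = 1 := by rw [hsn]; ring
  have hL3 : s ≤ L ^ 3 * s := le_mul_of_one_le_left hs (one_le_pow₀ hL)
  have h1 : ∑ q ∈ Finset.range (triNum n), (min (x q ^ 2) (|x q| ^ 3 * s) + m * s) ≤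
      ∑ q ∈ Finset.range (triNum n), ((1 + m) * (L ^ 3 * s) + highPart L (x q) ^ 2) := by
    refine Finset.sum_le_sum fun q _ => ?_
    have := min_sq_cube_le hL hs (x q)
    have : m * s ≤ m * (L ^ 3 * s) := by gcongr
    linarith
  conv_rhs at h1 => rw [Finset.sum_add_distrib, Finset.sum_const, Finset.card_range, nsmul_eq_mul]
  set V := ∑ q ∈ Finset.range (triNum n), highPart L (x q) ^ 2
  calc _ ≤ s ^ 4 * (triNum n * ((1 + m) * (L ^ 3 * s)) + V) := by gcongr
    _ = (s ^ 4 * triNum n) * ((1 + m) * (L ^ 3 * s)) + s ^ 4 * V := by ring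
    _ ≤ 1 * ((1 + m) * (L ^ 3 * s)) + s ^ 4 * V := by gcongr
    _ = _ := by rw [one_mul]

/-- Replacing weights and splitting centred squares in a weighted sum. -/
theorem abs_sum_mul_centred_sq_le {N : ℕ} {k C : ℝ} (hk : 0 ≤ k) {c b g w v ew ev ex x2 σ : ℕ → ℝ}
    (hx2 : ∀ q, x2 q = w q + v q) (hx0 : ∀ q, 0 ≤ x2 q) (hσ0 : ∀ q, 0 ≤ σ q) (hσ : ∀ q, σ q ≤ C)
    (hv : ∀ q, 0 ≤ v q) (hev : ∀ q, 0 ≤ ev q) (hex : ∀ q, ex q = ew q + ev q - σ q)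
    (hb : ∀ q, |b q| ≤ k) (hcb : ∀ q, |c q - b q| ≤ k * g q) (hg : ∀ q, 0 ≤ g q) :
    |∑ q ∈ Finset.range N, c q * (x2 q - σ q)| ≤
      k * ∑ q ∈ Finset.range N, g q * (x2 q + C) + |∑ q ∈ Finset.range N, b q * (w q - ew q)|
      + k * (∑ q ∈ Finset.range N, v q + ∑ q ∈ Finset.range N, ev q)
      + k * ∑ q ∈ Finset.range N, |ex q| := by
  -- The four sums are the change of weights, the centred truncated squares, the centred large
  -- squares, and the conditional variances.
  have h1 : ∑ q ∈ Finset.range N, c q * (x2 q - σ q) =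
      ∑ q ∈ Finset.range N, (c q - b q) * (x2 q - σ q) + ∑ q ∈ Finset.range N, b q * (w q - ew q)
      + ∑ q ∈ Finset.range N, b q * (v q - ev q) + ∑ q ∈ Finset.range N, b q * ex q := by
    simp only [← Finset.sum_add_distrib]
    refine Finset.sum_congr rfl fun q _ => ?_
    rw [hx2, hex]; ring
  have b1 : |∑ q ∈ Finset.range N, (c q - b q) * (x2 q - σ q)| ≤
      k * ∑ q ∈ Finset.range N, g q * (x2 q + C) := by
    rw [Finset.mul_sum]
    refine (Finset.abs_sum_le_sum_abs _ _).trans (Finset.sum_le_sum fun q _ => ?_)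
    rw [abs_mul, ← mul_assoc]
    refine mul_le_mul (hcb q) ?_ (abs_nonneg _) (mul_nonneg hk (hg q))
    rw [abs_le]
    constructor <;> linarith [hx0 q, hσ0 q, hσ q]
  have b3 : |∑ q ∈ Finset.range N, b q * (v q - ev q)| ≤
      k * (∑ q ∈ Finset.range N, v q + ∑ q ∈ Finset.range N, ev q) := by
    rw [← Finset.sum_add_distrib, Finset.mul_sum]
    refine (Finset.abs_sum_le_sum_abs _ _).trans (Finset.sum_le_sum fun q _ => ?_)
    rw [abs_mul]
    refine mul_le_mul (hb q) ?_ (abs_nonneg _) hk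
    rw [abs_le]
    constructor <;> linarith [hv q, hev q]
  have b4 : |∑ q ∈ Finset.range N, b q * ex q| ≤ k * ∑ q ∈ Finset.range N, |ex q| := by
    rw [Finset.mul_sum]
    refine (Finset.abs_sum_le_sum_abs _ _).trans (Finset.sum_le_sum fun q _ => ?_)
    rw [abs_mul]
    exact mul_le_mul_of_nonneg_right (hb q) (abs_nonneg _)
  rw [h1]
  refine (abs_add_le _ _).trans (add_le_add ((abs_add_le _ _).trans (add_le_add
    ((abs_add_le _ _).trans (add_le_add b1 le_rfl)) b3)) b4)

end Pathwise

/-! ### Consequences of the moment condition. -/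

section MomentBounds

variable {Ω : Type*} [mΩ : MeasurableSpace Ω] {P : Measure Ω}

/-- `ENNReal.ofReal` forgets the negative part of `C`, so the real bound involves `max C 0`. -/
theorem integral_le_div_of_lintegral_le {f g : Ω → ℝ} {k C : ℝ} (hk : 0 < k) (hf0 : ∀ ω, 0 ≤ f ω)
    (hf : AEStronglyMeasurable f P) (hfg : ∀ ω, k * f ω ≤ g ω)
    (hg : ∫⁻ ω, ENNReal.ofReal (g ω) ∂P ≤ ENNReal.ofReal C) :
    ∫ ω, f ω ∂P ≤ max C 0 * k⁻¹ := by
  have h1 : ENNReal.ofReal k * ∫⁻ ω, ENNReal.ofReal (f ω) ∂P ≤ ENNReal.ofReal (max C 0) := by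
    rw [← lintegral_const_mul' _ _ ENNReal.ofReal_ne_top, ENNReal.ofReal_max, ENNReal.ofReal_zero]
    refine (lintegral_mono fun ω => ?_).trans (hg.trans (le_max_left _ _))
    rw [← ENNReal.ofReal_mul hk.le]
    exact ENNReal.ofReal_le_ofReal (hfg ω)
  rw [integral_eq_lintegral_of_nonneg_ae (Eventually.of_forall hf0) hf]
  have h2 := ENNReal.toReal_mono ENNReal.ofReal_ne_top h1
  rw [ENNReal.toReal_mul, ENNReal.toReal_ofReal hk.le,
    ENNReal.toReal_ofReal (le_max_right _ _)] at h2
  rwa [← div_eq_mul_inv, le_div_iff₀ hk, mul_comm]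

/-- Markov's inequality with weight `h`: where `|x| > L`, monotonicity gives `h L ≤ h |x|`. -/
theorem integral_highPart_sq_le {h : ℝ → ℝ} (h_one : ∀ x, 0 ≤ x → 1 ≤ h x)
    (h_mono : MonotoneOn h (Set.Ici 0)) {C : ℝ} {x : Ω → ℝ} (hx : Measurable x)
    (hC : ∫⁻ ω, ENNReal.ofReal (x ω ^ 2 * h |x ω|) ∂P ≤ ENNReal.ofReal C) {L : ℝ} (hL : 0 ≤ L) :
    ∫ ω, highPart L (x ω) ^ 2 ∂P ≤ max C 0 * (h L)⁻¹ := by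
  refine integral_le_div_of_lintegral_le (zero_lt_one.trans_le (h_one L hL)) (fun ω => sq_nonneg _)
    (((measurable_highPart L).comp hx).pow_const 2).aestronglyMeasurable (fun ω => ?_) hC
  unfold highPart
  split_ifs with hω
  · have := h_one |x ω| (abs_nonneg _)
    have : 0 ≤ x ω ^ 2 * h |x ω| := by positivity
    simpa using this
  · have := h_mono (Set.mem_Ici.mpr hL) (Set.mem_Ici.mpr (abs_nonneg (x ω))) (not_le.mp hω).le
    rw [mul_comm]
    gcongr

theorem integral_sq_le {h : ℝ → ℝ} (h_one : ∀ x, 0 ≤ x → 1 ≤ h x) {C : ℝ} {x : Ω → ℝ}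
    (hx : Measurable x)
    (hC : ∫⁻ ω, ENNReal.ofReal (x ω ^ 2 * h |x ω|) ∂P ≤ ENNReal.ofReal C) :
    ∫ ω, x ω ^ 2 ∂P ≤ max C 0 := by
  have := integral_le_div_of_lintegral_le (f := fun ω => x ω ^ 2) zero_lt_one
    (fun ω => sq_nonneg _) (hx.pow_const 2).aestronglyMeasurable (fun ω => ?_) hC
  · simpa using this
  · rw [one_mul]
    exact le_mul_of_one_le_right (sq_nonneg _) (h_one _ (abs_nonneg _))

end MomentBounds

/-- The mean depends only on coordinates before `q`, and those in `S` are erased, so the remaining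
entries determine it. -/
theorem measurable_tailMean_zeroOn {Ω : Type*} {m : MeasurableSpace Ω} [mΩ : MeasurableSpace Ω]
    {P : Measure Ω} [IsProbabilityMeasure P] {Y : ℕ → Ω → ℝ}
    (hY : ∀ p, Measurable (Y p)) {c : (ℕ → ℝ) → ℝ} (hc : Measurable c) {q : ℕ} {S : Finset ℕ}
    {x : ℕ → Ω → ℝ} (hx : ∀ p < q, p ∉ S → Measurable[m] (x p)) :
    Measurable[m] fun ω => tailMean P Y q c (zeroOn S fun p => x p ω) := by
  have h1 : (fun ω => tailMean P Y q c (zeroOn S fun p => x p ω)) =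
      fun ω => tailMean P Y q c (fun p => if p < q ∧ p ∉ S then x p ω else 0) := by
    ext ω
    refine tailMean_congr c fun p hp => ?_
    by_cases hS : p ∈ S <;> simp [zeroOn, hS, hp]
  rw [h1]
  refine (measurable_tailMean hY hc q).comp ((@measurable_pi_iff _ _ _ (_) _ _).mpr fun p => ?_)
  split_ifs with h
  · exact hx p h.1 h.2
  · exact measurable_const

/-! ### Comparison of the statistic with its Gaussian mean. -/

section LindebergConvergence

variable {Ω : Type*} [mΩ : MeasurableSpace Ω] {P : Measure Ω}

theorem condVarAverage_eq (X : ℤ → ℤ → Ω → ℝ) (a n : ℕ) (ω : Ω) :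
    condVarAverage P X a n ω = ((n : ℝ) ^ 2)⁻¹ * ∑ q ∈ Finset.range (triNum n),
      |(P[fun ω' => seqField X q ω' ^ 2 - ∫ ω'', seqField X q ω'' ^ 2 ∂P | seqPast X a q]) ω| := by
  rw [condVarAverage]
  congr 1
  exact (sum_range_triNum (fun i j : ℕ =>
    |(P[fun ω' => X i j ω' ^ 2 - ∫ ω'', X i j ω'' ^ 2 ∂P | pastSigma X i j a]) ω|) n).symm

theorem inv_sqrt_pow_four (n : ℕ) : (√(n : ℝ))⁻¹ ^ 4 = ((n : ℝ) ^ 2)⁻¹ := by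
  calc (√(n : ℝ))⁻¹ ^ 4 = ((√(n : ℝ) ^ 2) ^ 2)⁻¹ := by rw [inv_pow]; ring
    _ = _ := by rw [Real.sq_sqrt (Nat.cast_nonneg n)]

variable [IsProbabilityMeasure P] {X : ℤ → ℤ → Ω → ℝ} {Y : ℕ → Ω → ℝ}

/-- Up to an error tending to zero, the difference between the statistic of `X` and its Gaussian
mean is controlled by the averaged conditional variances. -/
theorem ae_exists_error_spectralStat
    (hXmeas : ∀ i j, Measurable (X i j)) (hXsq : ∀ i j, MemLp (X i j) 2 P)
    (hYmeas : ∀ q, Measurable (Y q)) (hYindep : iIndepFun Y P) (hY3 : ∀ q, MemLp (Y q) 3 P)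
    (hYmean : ∀ q, ∫ ω, Y q ω ∂P = 0)
    (hYvar : ∀ q, ∫ ω, Y q ω ^ 2 ∂P = ∫ ω, seqField X q ω ^ 2 ∂P)
    {m : ℝ} (hYm : ∀ q, ∫ ω, |Y q ω| ^ 3 ∂P ≤ m)
    (hmart : ∀ q, P[seqField X q | seqPast X 1 q] =ᵐ[P] 0)
    {h : ℝ → ℝ} (h_one : ∀ x, 0 ≤ x → 1 ≤ h x) (h_mono : MonotoneOn h (Set.Ici 0))
    (h_sum : Summable fun n : ℕ => ((n : ℝ) * h n)⁻¹) {C : ℝ}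
    (hmoment : ∀ q, ∫⁻ ω, ENNReal.ofReal (seqField X q ω ^ 2 * h |seqField X q ω|) ∂P ≤
      ENNReal.ofReal C)
    {z : ℂ} (hz : 0 < z.im) {a : ℕ} (ha : 1 ≤ a) :
    ∀ᵐ ω ∂P, ∃ e : ℕ → ℝ, Tendsto e atTop (𝓝 0) ∧ ∀ n,
      |spectralStat n z (fun q => seqField X q ω) -
        ∫ ω', spectralStat n z (fun q => Y q ω') ∂P| ≤
      e n + spectralStatConst z * condVarAverage P X a n ω := by
  have hT := fun n => hasTaylorBounds_spectralStat n hz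
  set K := spectralStatConst z
  have hK : 0 ≤ K := (hT 0).const_nonneg
  have hm : 0 ≤ m := (integral_nonneg fun ω => by positivity).trans (hYm 0)
  set x : ℕ → Ω → ℝ := fun q => seqField X q with hx_def
  have hx : ∀ q, Measurable (x q) := fun q => hXmeas _ _
  have hx2 : ∀ q, MemLp (x q) 2 P := fun q => hXsq _ _
  have hL0 : ∀ n, 0 ≤ truncLevel n := fun n => zero_le_one.trans (one_le_truncLevel n)
  set C' := max C 0
  have hC' : 0 ≤ C' := le_max_right _ _
  -- first-order term
  have first : ∀ᵐ ω ∂P, Tendsto (fun n => ∑ q ∈ Finset.range (triNum n),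
      tailMean P Y q (spectralStatOne n z q) (fun p => x p ω) * x q ω) atTop (𝓝 0) := by
    refine ae_tendsto_sum_mul_martingale_diff (𝓕 := seqPast X 1) (K := K)
      (u := fun n => C' * (h (truncLevel n))⁻¹) hx hx2 (seqPast_le hXmeas 1)
      (fun p q hpq => seqPast_one_mono hpq) (fun p q hpq => measurable_seqField_one hpq) hmart
      (fun n q => ?_) hK (fun n q ω => abs_tailMean_le ((hT n).bound_one q) q _) ?_
      (fun n q => integral_highPart_sq_le h_one h_mono (hx q) (hmoment q) (hL0 n))
    · have h1 : ∀ y : ℕ → ℝ, zeroOn ∅ y = y := fun y => by ext p; simp [zeroOn]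
      have h2 := measurable_tailMean_zeroOn (P := P) (m := seqPast X 1 q) hYmeas
        ((hT n).measurable_one q) (S := ∅) (x := x) (q := q)
        (fun p hp _ => measurable_seqField_one hp)
      simpa only [h1] using h2
    · refine ((summable_inv_mul_truncLevel h_one h_mono h_sum).mul_left C').congr fun n => ?_
      rw [mul_inv]; ring
  -- second-order martingale term
  have second : ∀ᵐ ω ∂P, Tendsto (fun n => ∑ q ∈ Finset.range (triNum n),
      tailMean P Y q (spectralStatTwo n z q) (zeroOn (nearSet a q) fun p => x p ω) *
      (lowPart (truncLevel n) (x q ω) ^ 2 -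
        P[fun ω' => lowPart (truncLevel n) (x q ω') ^ 2 | seqPast X a q] ω)) atTop (𝓝 0) := by
    refine ae_tendsto_sum_mul_sq_sub_condExp (𝓕 := seqPast X a) (K := K) hx ha
      (seqPast_le hXmeas a) (fun p q hpq => seqPast_row_mono ha hpq)
      (fun p q hpq => measurable_seqField_row ha hpq) (fun n q => ?_) hK
      (fun n q ω => abs_tailMean_le ((hT n).bound_two q) q _)
    exact measurable_tailMean_zeroOn (P := P) hYmeas ((hT n).measurable_two q)
        (fun p hp hS => measurable_seqField_of_notMem_nearSet hp hS)
  -- large values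
  have hVint : ∀ L q, Integrable (fun ω => highPart L (x q ω) ^ 2) P := fun L q =>
    ((hx2 q).of_le ((measurable_highPart L).comp (hx q)).aestronglyMeasurable
      (Eventually.of_forall fun ω => abs_highPart_le _ _)).integrable_sq
  have hWint : ∀ L q, Integrable (fun ω => lowPart L (x q ω) ^ 2) P := fun L q => by
    refine ((hx2 q).integrable_sq.sub (hVint L q)).congr (Eventually.of_forall fun ω => ?_)
    have := lowPart_sq_add_highPart_sq L (x q ω)
    simp only [Pi.sub_apply]
    linarith
  have hVle : ∀ k q : ℕ, ∫ ω, highPart (2 ^ (k / 8)) (x q ω) ^ 2 ∂P ≤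
      C' * (h (2 ^ (k / 8)))⁻¹ := fun k q =>
    integral_highPart_sq_le h_one h_mono (hx q) (hmoment q) (by positivity)
  have hu : Summable fun k : ℕ => C' * (h (2 ^ (k / 8)))⁻¹ :=
    (summable_inv_dyadic h_one h_mono h_sum).mul_left C'
  have high : ∀ᵐ ω ∂P, Tendsto (fun n : ℕ => ((n : ℝ) ^ 2)⁻¹ * ∑ q ∈ Finset.range (triNum n),
      highPart (truncLevel n) (x q ω) ^ 2) atTop (𝓝 0) :=
    ae_tendsto_dyadic_average (U := fun k q ω => highPart (2 ^ (k / 8)) (x q ω) ^ 2)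
      (fun k q => hVint _ q) (fun k q => Eventually.of_forall fun ω => sq_nonneg _) hu hVle
  have hEV0 : ∀ (L : ℝ) (q : ℕ), 0 ≤ᵐ[P] P[fun ω' => highPart L (x q ω') ^ 2 | seqPast X a q] :=
    fun L q => condExp_nonneg (Eventually.of_forall fun ω => sq_nonneg _)
  have highCond : ∀ᵐ ω ∂P, Tendsto (fun n : ℕ => ((n : ℝ) ^ 2)⁻¹ *
      ∑ q ∈ Finset.range (triNum n),
        P[fun ω' => highPart (truncLevel n) (x q ω') ^ 2 | seqPast X a q] ω) atTop (𝓝 0) :=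
    ae_tendsto_dyadic_average
      (U := fun k q => P[fun ω' => highPart (2 ^ (k / 8)) (x q ω') ^ 2 | seqPast X a q])
      (fun k q => integrable_condExp) (fun k q => hEV0 _ q) hu
      (fun k q => by rw [integral_condExp (seqPast_le hXmeas a q)]; exact hVle k q)
  -- The conditional variance does not involve the truncation level; it splits at any level into the
  -- centrings of the small and the large squares.
  have hcond : ∀ (n q : ℕ), ∀ᵐ ω ∂P,
      (P[fun ω' => x q ω' ^ 2 - ∫ ω'', x q ω'' ^ 2 ∂P | seqPast X a q]) ω =
      P[fun ω' => lowPart (truncLevel n) (x q ω') ^ 2 | seqPast X a q] ω +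
        P[fun ω' => highPart (truncLevel n) (x q ω') ^ 2 | seqPast X a q] ω -
        ∫ ω'', x q ω'' ^ 2 ∂P := by
    intro n q
    have hle := seqPast_le hXmeas a q
    have h1 := condExp_sub (hx2 q).integrable_sq (integrable_const (μ := P)
      (∫ ω'', x q ω'' ^ 2 ∂P)) (seqPast X a q)
    have h2 := condExp_add (hWint (truncLevel n) q) (hVint (truncLevel n) q) (seqPast X a q)
    have h3 : ((fun ω => lowPart (truncLevel n) (x q ω) ^ 2) +
        fun ω => highPart (truncLevel n) (x q ω) ^ 2) = fun ω => x q ω ^ 2 := by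
      ext ω; exact lowPart_sq_add_highPart_sq _ _
    rw [h3] at h2
    rw [condExp_const hle] at h1
    filter_upwards [h1, h2] with ω e1 e2
    rw [Pi.sub_apply, e2, Pi.add_apply] at e1
    exact e1
  filter_upwards [first, second, high, highCond,
    ae_all_iff.mpr fun n => ae_all_iff.mpr (hcond n),
    ae_all_iff.mpr fun n : ℕ => ae_all_iff.mpr fun q => hEV0 (truncLevel n) q]
    with ω h1 h2 h3 h4 h5 h6
  set R : ℝ := (((2 * a + 1) ^ 2 : ℕ) : ℝ)
  have hl := tendsto_truncLevel_cube_mul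
  -- In order: the linear martingale, the quadratic martingale, the zeroing of neighbours, the large
  -- squares with their conditional means, and the Taylor remainder.
  refine ⟨fun n =>
    |∑ q ∈ Finset.range (triNum n),
      tailMean P Y q (spectralStatOne n z q) (fun p => x p ω) * x q ω| +
    |∑ q ∈ Finset.range (triNum n),
      tailMean P Y q (spectralStatTwo n z q) (zeroOn (nearSet a q) fun p => x p ω) *
      (lowPart (truncLevel n) (x q ω) ^ 2 -
        P[fun ω' => lowPart (truncLevel n) (x q ω') ^ 2 | seqPast X a q] ω)| +
    K * ((1 + C') * R * (truncLevel n ^ 3 * (√(n : ℝ))⁻¹ + 2 * (((n : ℝ) ^ 2)⁻¹ *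
      ∑ q ∈ Finset.range (triNum n), highPart (truncLevel n) (x q ω) ^ 2))) +
    K * (((n : ℝ) ^ 2)⁻¹ * ∑ q ∈ Finset.range (triNum n), highPart (truncLevel n) (x q ω) ^ 2 +
      ((n : ℝ) ^ 2)⁻¹ * ∑ q ∈ Finset.range (triNum n),
        P[fun ω' => highPart (truncLevel n) (x q ω') ^ 2 | seqPast X a q] ω) +
    K * ((1 + m) * (truncLevel n ^ 3 * (√(n : ℝ))⁻¹) + ((n : ℝ) ^ 2)⁻¹ *
      ∑ q ∈ Finset.range (triNum n), highPart (truncLevel n) (x q ω) ^ 2), ?_, fun n => ?_⟩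
  · have t1 := ((h1.abs.add h2.abs).add (((hl.add (h3.const_mul 2)).const_mul
      ((1 + C') * R)).const_mul K)).add ((h3.add h4).const_mul K)
    have t2 := t1.add (((hl.const_mul (1 + m)).add h3).const_mul K)
    simpa using t2
  · have hs : (0 : ℝ) ≤ (√(n : ℝ))⁻¹ := by positivity
    have lind := abs_lindeberg_le (P := P) hYmeas hYindep (hT n) (N := triNum n)
      (fun y y' hy => by simp only [spectralStat, seqMatrix_congr hy]) hY3 hYmean hYm
      (fun p => x p ω)
    simp only [hYvar] at lind
    have rem := sum_remainder_le (n := n) hm (fun p => x p ω)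
    have near := sum_near_le (a := a) (n := n) hC' (fun p => x p ω)
    have split := abs_sum_mul_centred_sq_le (N := triNum n) (k := K * (√(n : ℝ))⁻¹ ^ 4) (C := C')
      (c := fun q => tailMean P Y q (spectralStatTwo n z q) fun p => x p ω)
      (b := fun q => tailMean P Y q (spectralStatTwo n z q) (zeroOn (nearSet a q) fun p => x p ω))
      (g := fun q => ∑ p ∈ nearSet a q, min 1 (|x p ω| * (√(n : ℝ))⁻¹))
      (w := fun q => lowPart (truncLevel n) (x q ω) ^ 2)
      (v := fun q => highPart (truncLevel n) (x q ω) ^ 2)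
      (ew := fun q => P[fun ω' => lowPart (truncLevel n) (x q ω') ^ 2 | seqPast X a q] ω)
      (ev := fun q => P[fun ω' => highPart (truncLevel n) (x q ω') ^ 2 | seqPast X a q] ω)
      (ex := fun q => (P[fun ω' => x q ω' ^ 2 - ∫ ω'', x q ω'' ^ 2 ∂P | seqPast X a q]) ω)
      (x2 := fun q => x q ω ^ 2) (σ := fun q => ∫ ω'', x q ω'' ^ 2 ∂P)
      (by positivity) (fun q => (lowPart_sq_add_highPart_sq _ _).symm) (fun q => sq_nonneg _)
      (fun q => integral_nonneg fun ω => sq_nonneg _)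
      (fun q => integral_sq_le h_one (hx q) (hmoment q)) (fun q => sq_nonneg _)
      (fun q => h6 n q) (fun q => h5 n q) (fun q => abs_tailMean_le ((hT n).bound_two q) q _)
      (fun q => abs_tailMean_two_zeroOn_sub_le hYmeas (hT n) q _ _)
      (fun q => Finset.sum_nonneg fun p _ => le_min zero_le_one (by positivity))
    rw [condVarAverage_eq]
    rw [inv_sqrt_pow_four] at lind rem near split
    have rem' := mul_le_mul_of_nonneg_left rem hK
    have near' := mul_le_mul_of_nonneg_left near hK
    have tri : ∀ A B D : ℝ, |A| ≤ |A - B - D| + |B| + |D| := fun A B D => by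
      have h7 := abs_add_three (A - B - D) B D
      have h8 : A - B - D + B + D = A := by ring
      rwa [h8] at h7
    refine (tri _ _ _).trans ((add_le_add (add_le_add lind le_rfl) split).trans ?_)
    simp only [← mul_assoc] at rem' near' ⊢
    simp only [mul_add, ← mul_assoc] at rem' near' ⊢
    linarith

/-- For fixed `a` the limsup in `n` is at most a constant times that of the averaged conditional
variance, and the latter is small for large `a`. -/
theorem ae_tendsto_spectralStat_sub
    (hXmeas : ∀ i j, Measurable (X i j)) (hXsq : ∀ i j, MemLp (X i j) 2 P)
    (hYmeas : ∀ q, Measurable (Y q)) (hYindep : iIndepFun Y P) (hY3 : ∀ q, MemLp (Y q) 3 P)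
    (hYmean : ∀ q, ∫ ω, Y q ω ∂P = 0)
    (hYvar : ∀ q, ∫ ω, Y q ω ^ 2 ∂P = ∫ ω, seqField X q ω ^ 2 ∂P)
    {m : ℝ} (hYm : ∀ q, ∫ ω, |Y q ω| ^ 3 ∂P ≤ m)
    (hmart : ∀ q, P[seqField X q | seqPast X 1 q] =ᵐ[P] 0)
    {h : ℝ → ℝ} (h_one : ∀ x, 0 ≤ x → 1 ≤ h x) (h_mono : MonotoneOn h (Set.Ici 0))
    (h_sum : Summable fun n : ℕ => ((n : ℝ) * h n)⁻¹) {C : ℝ}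
    (hmoment : ∀ q, ∫⁻ ω, ENNReal.ofReal (seqField X q ω ^ 2 * h |seqField X q ω|) ∂P ≤
      ENNReal.ofReal C)
    (hmix : ∀ᵐ ω ∂P, Tendsto
      (fun a : ℕ => limsup (fun n : ℕ => ENNReal.ofReal (condVarAverage P X a n ω)) atTop)
      atTop (𝓝 0))
    {z : ℂ} (hz : 0 < z.im) :
    ∀ᵐ ω ∂P, Tendsto (fun n => spectralStat n z (fun q => seqField X q ω) -
        ∫ ω', spectralStat n z (fun q => Y q ω') ∂P) atTop (𝓝 0) := by
  -- The shift to `a + 1` supplies the positive distance that the row-block argument needs.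
  have h1 : ∀ a : ℕ, _ := fun a => ae_exists_error_spectralStat hXmeas hXsq hYmeas hYindep hY3
    hYmean hYvar hYm hmart h_one h_mono h_sum hmoment hz (a := a + 1) (by omega)
  have hK : 0 ≤ spectralStatConst z := (hasTaylorBounds_spectralStat 0 hz).const_nonneg
  filter_upwards [ae_all_iff.mpr h1, hmix] with ω h2 h3
  rw [Metric.tendsto_atTop]
  intro ε hε
  set K := spectralStatConst z
  have hδ : 0 < ε / (2 * (K + 1)) := by positivity
  have h4 := (h3.comp (tendsto_add_atTop_nat 1)).eventually
    (gt_mem_nhds (ENNReal.ofReal_pos.mpr hδ))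
  obtain ⟨a, ha⟩ := h4.exists
  have h5 := eventually_lt_of_limsup_lt ha
  obtain ⟨e, he, hle⟩ := h2 a
  have h6 := he.eventually (gt_mem_nhds (half_pos hε))
  obtain ⟨N, hN⟩ := eventually_atTop.mp (h5.and h6)
  refine ⟨N, fun n hn => ?_⟩
  obtain ⟨h7, h8⟩ := hN n hn
  rw [dist_zero_right, Real.norm_eq_abs]
  have h9 : condVarAverage P X (a + 1) n ω < ε / (2 * (K + 1)) :=
    (ENNReal.ofReal_lt_ofReal_iff hδ).mp h7
  refine (hle n).trans_lt ?_
  have h10 : K * condVarAverage P X (a + 1) n ω ≤ K * (ε / (2 * (K + 1))) := by gcongr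
  have h11 : K * (ε / (2 * (K + 1))) ≤ ε / 2 := by
    rw [mul_div_assoc', div_le_div_iff₀ (by positivity) (by positivity)]
    nlinarith
  linarith

end LindebergConvergence

/-! ### Lévy distance and pointwise comparison. -/

section LevyDistance

variable {F G : ℝ → ℝ}

theorem IsDistributionFunction.nonneg (hF : IsDistributionFunction F) (x : ℝ) : 0 ≤ F x :=
  hF.mono.le_of_tendsto hF.tendsto_atBot x

theorem IsDistributionFunction.le_one (hF : IsDistributionFunction F) (x : ℝ) : F x ≤ 1 :=
  hF.mono.ge_of_tendsto hF.tendsto_atTop x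

/-- Monotonicity makes the admissible `ε` upward closed, and `ε = 1` is always admissible, so the
infimum is not a default value. -/
theorem sandwich_of_levyDist_lt (hG : Monotone G) (hG0 : ∀ x, 0 ≤ G x) (hG1 : ∀ x, G x ≤ 1)
    (hF : IsDistributionFunction F) {ε : ℝ} (h : levyDist G F < ε) (x : ℝ) :
    G (x - ε) - ε ≤ F x ∧ F x ≤ G (x + ε) + ε := by
  have hne : {ε : ℝ | 0 < ε ∧ ∀ x : ℝ, G (x - ε) - ε ≤ F x ∧ F x ≤ G (x + ε) + ε}.Nonempty :=
    ⟨1, one_pos, fun x => ⟨by linarith [hG1 (x - 1), hF.nonneg x],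
      by linarith [hG0 (x + 1), hF.le_one x]⟩⟩
  obtain ⟨δ, ⟨-, hδ⟩, hδε⟩ := exists_lt_of_csInf_lt hne h
  have h1 := hG (show x - ε ≤ x - δ by linarith)
  have h2 := hG (show x + δ ≤ x + ε by linarith)
  obtain ⟨h3, h4⟩ := hδ x
  exact ⟨by linarith, by linarith⟩

theorem levyDist_nonneg (F G : ℝ → ℝ) : 0 ≤ levyDist F G :=
  Real.sInf_nonneg fun _ h => h.1.le

theorem levyDist_le {ε : ℝ} (hε : 0 < ε)
    (h : ∀ x, G (x - ε) - ε ≤ F x ∧ F x ≤ G (x + ε) + ε) : levyDist G F ≤ ε :=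
  csInf_le ⟨0, fun _ h => h.1.le⟩ ⟨hε, h⟩

/-- Pointwise comparison, up to small shifts, implies convergence in the Lévy distance. -/
theorem tendsto_levyDist_of_eventually {G : ℕ → ℝ → ℝ} (hG : ∀ n, Monotone (G n))
    (hG0 : ∀ n x, 0 ≤ G n x) (hG1 : ∀ n x, G n x ≤ 1) (hF : IsDistributionFunction F)
    (h : ∀ x δ, 0 < δ → ∀ᶠ n in atTop, G n x ≤ F (x + δ) + δ ∧ F (x - δ) - δ ≤ G n x) :
    Tendsto (fun n => levyDist (G n) F) atTop (𝓝 0) := by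
  rw [Metric.tendsto_atTop]
  intro ε hε
  set δ := ε / 4 with hδ_def
  have hδ : 0 < δ := by positivity
  have hlo : ∀ᶠ y in atBot, F y < δ := hF.tendsto_atBot.eventually (gt_mem_nhds hδ)
  have hhi : ∀ᶠ y in atTop, 1 - δ < F y :=
    hF.tendsto_atTop.eventually (lt_mem_nhds (by linarith))
  obtain ⟨b, hb⟩ := eventually_atBot.mp hlo
  obtain ⟨t, ht⟩ := eventually_atTop.mp hhi
  -- The grid of mesh `δ` reaches one step beyond both `b` and `t`, since the comparison at an
  -- endpoint shifts the argument by `δ`.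
  obtain ⟨N, hN⟩ := exists_nat_gt (max (-b / δ) (t / δ) + 1)
  have hNb : -(N : ℝ) * δ + δ ≤ b := by
    have h1 : -b / δ < N - 1 := by linarith [le_max_left (-b / δ) (t / δ)]
    rw [div_lt_iff₀ hδ] at h1
    linarith
  have hNt : t ≤ (N : ℝ) * δ - δ := by
    have h1 : t / δ < N - 1 := by linarith [le_max_right (-b / δ) (t / δ)]
    rw [div_lt_iff₀ hδ] at h1
    linarith
  have hgrid : ∀ᶠ n in atTop, ∀ j ∈ Finset.Icc (-(N : ℤ)) N,
      G n (j * δ) ≤ F (j * δ + δ) + δ ∧ F (j * δ - δ) - δ ≤ G n (j * δ) :=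
    (Finset.eventually_all _).mpr fun j _ => h _ δ hδ
  obtain ⟨n₀, hn₀⟩ := eventually_atTop.mp hgrid
  refine ⟨n₀, fun n hn => ?_⟩
  have hg := hn₀ n hn
  rw [dist_zero_right, Real.norm_eq_abs, abs_of_nonneg (levyDist_nonneg _ _)]
  refine (levyDist_le (ε := 3 * δ) (by positivity) fun x => ?_).trans_lt (by
    rw [hδ_def]; linarith)
  have hNδ : 0 ≤ (N : ℝ) * δ := by positivity
  constructor
  -- Round `y` up to the grid. Left of the grid `G n y` is small, right of it `F x` is close to `1`,
  -- and in between the grid comparison applies.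
  · set y := x - 3 * δ
    have hy1 : y ≤ ⌈y / δ⌉ * δ := by
      rw [← div_le_iff₀ hδ]; exact Int.le_ceil _
    have hy2 : ⌈y / δ⌉ * δ < y + δ := by
      have := Int.ceil_lt_add_one (y / δ)
      rw [← lt_div_iff₀ hδ, add_div, div_self hδ.ne']
      exact this
    have hx0 := hF.nonneg x
    rcases lt_or_ge ⌈y / δ⌉ (-(N : ℤ)) with hj | hj
    · have h1 : (⌈y / δ⌉ : ℝ) ≤ -(N : ℝ) := by exact_mod_cast hj.le
      have h2 : y ≤ ((-(N : ℤ) : ℤ) : ℝ) * δ := by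
        push_cast
        exact hy1.trans (by gcongr)
      have h3 := (hg (-(N : ℤ)) (by simp)).1
      have h4 := hG n h2
      have h5 := hb (((-(N : ℤ) : ℤ) : ℝ) * δ + δ) (by push_cast; linarith)
      linarith
    · rcases le_or_gt ⌈y / δ⌉ (N : ℤ) with hj' | hj'
      · have h1 := (hg _ (Finset.mem_Icc.mpr ⟨hj, hj'⟩)).1
        have h2 := hG n hy1
        have h3 := hF.mono (show (⌈y / δ⌉ : ℝ) * δ + δ ≤ x by linarith)
        linarith
      · have h1 : (N : ℝ) + 1 ≤ ⌈y / δ⌉ := by exact_mod_cast hj'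
        have h2 : ((N : ℝ) + 1) * δ ≤ ⌈y / δ⌉ * δ := by gcongr
        have h3 := ht x (by linarith)
        linarith [hG1 n y]
  · set y := x + 3 * δ
    have hy1 : ⌊y / δ⌋ * δ ≤ y := by
      rw [← le_div_iff₀ hδ]; exact Int.floor_le _
    have hy2 : y < ⌊y / δ⌋ * δ + δ := by
      have := Int.lt_floor_add_one (y / δ)
      rw [div_lt_iff₀ hδ] at this
      linarith
    have hx1 := hF.le_one x
    rcases lt_or_ge ⌊y / δ⌋ (-(N : ℤ)) with hj | hj
    · have h1 : (⌊y / δ⌋ : ℝ) ≤ -(N : ℝ) := by exact_mod_cast hj.le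
      have h2 : (⌊y / δ⌋ : ℝ) * δ ≤ -(N : ℝ) * δ := by gcongr
      have h3 := hb x (by linarith)
      linarith [hG0 n y]
    · rcases le_or_gt ⌊y / δ⌋ (N : ℤ) with hj' | hj'
      · have h1 := (hg _ (Finset.mem_Icc.mpr ⟨hj, hj'⟩)).2
        have h2 := hG n hy1
        have h3 := hF.mono (show x ≤ (⌊y / δ⌋ : ℝ) * δ - δ by linarith)
        linarith
      · have h1 : (N : ℝ) ≤ ⌊y / δ⌋ := by exact_mod_cast hj'.le
        have h2 : ((N : ℤ) : ℝ) * δ ≤ y := by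
          push_cast
          exact le_trans (by gcongr) hy1
        have h3 := (hg (N : ℤ) (by simp)).2
        have h4 := hG n h2
        have h5 := ht (((N : ℤ) : ℝ) * δ - δ) (by push_cast; linarith)
        linarith

theorem tendsto_of_tendsto_levyDist {G : ℕ → ℝ → ℝ} (hG : ∀ n, Monotone (G n))
    (hG0 : ∀ n x, 0 ≤ G n x) (hG1 : ∀ n x, G n x ≤ 1) (hF : IsDistributionFunction F)
    (h : Tendsto (fun n => levyDist (G n) F) atTop (𝓝 0)) {x : ℝ} (hx : ContinuousAt F x) :
    Tendsto (fun n => G n x) atTop (𝓝 (F x)) := by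
  rw [Metric.tendsto_atTop]
  intro ε hε
  obtain ⟨δ, hδ, hδF⟩ := Metric.continuousAt_iff.mp hx (ε / 2) (by positivity)
  set η := min (δ / 2) (ε / 2) with hη_def
  have hη : 0 < η := by positivity
  have hη1 : η ≤ δ / 2 := min_le_left _ _
  have hη2 : η ≤ ε / 2 := min_le_right _ _
  obtain ⟨N, hN⟩ := eventually_atTop.mp (h.eventually (gt_mem_nhds hη))
  refine ⟨N, fun n hn => ?_⟩
  have h1 := (sandwich_of_levyDist_lt (hG n) (hG0 n) (hG1 n) hF (hN n hn) (x + η)).1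
  have h2 := (sandwich_of_levyDist_lt (hG n) (hG0 n) (hG1 n) hF (hN n hn) (x - η)).2
  rw [add_sub_cancel_right] at h1
  rw [sub_add_cancel] at h2
  have h3 := hδF (x := x + η) (by rw [Real.dist_eq]; simp [abs_of_pos hη]; linarith)
  have h4 := hδF (x := x - η) (by rw [Real.dist_eq]; simp [abs_of_pos hη]; linarith)
  rw [Real.dist_eq, abs_lt] at h3 h4 ⊢
  constructor <;> linarith

end LevyDistance

/-! ### The Cauchy kernel. -/

section CauchyKernel

/-- The unnormalized Cauchy kernel. -/
def cauchyKernel (v t : ℝ) : ℝ := v / (t ^ 2 + v ^ 2)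

/-- Minus the derivative of the Cauchy kernel. -/
def cauchyKernelDeriv (v t : ℝ) : ℝ := 2 * v * t / (t ^ 2 + v ^ 2) ^ 2

variable {v : ℝ}

theorem cauchyKernel_nonneg (hv : 0 < v) (t : ℝ) : 0 ≤ cauchyKernel v t := by
  unfold cauchyKernel; positivity

theorem cauchyKernel_le (hv : 0 < v) (t : ℝ) : cauchyKernel v t ≤ v⁻¹ := by
  unfold cauchyKernel
  rw [div_le_iff₀ (by positivity), inv_mul_eq_div, le_div_iff₀ hv]
  nlinarith [sq_nonneg t]

theorem continuous_cauchyKernel (hv : 0 < v) : Continuous (cauchyKernel v) :=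
  continuous_const.div (by fun_prop) fun t => by positivity

theorem abs_cauchyKernelDeriv_le (hv : 0 < v) (t : ℝ) :
    |cauchyKernelDeriv v t| ≤ (t ^ 2 + v ^ 2)⁻¹ := by
  have hp : 0 < t ^ 2 + v ^ 2 := by positivity
  unfold cauchyKernelDeriv
  rw [abs_div, abs_of_pos (pow_pos hp 2), div_le_iff₀ (by positivity), sq (t ^ 2 + v ^ 2),
    inv_mul_cancel_left₀ hp.ne', abs_mul, abs_of_pos (by positivity : 0 < 2 * v)]
  nlinarith [sq_nonneg (v - |t|), sq_abs t]

theorem hasDerivAt_cauchyKernel (hv : 0 < v) (u t : ℝ) :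
    HasDerivAt (fun t => -cauchyKernel v (t - u)) (cauchyKernelDeriv v (t - u)) t := by
  have hp : (t - u) ^ 2 + v ^ 2 ≠ 0 := by positivity
  have h1 : HasDerivAt (fun t => (t - u) ^ 2 + v ^ 2) (2 * (t - u)) t := by
    have := (((hasDerivAt_id t).sub_const u).pow 2).add_const (v ^ 2)
    simpa using this
  have h2 := ((hasDerivAt_const t v).div h1 hp).neg
  unfold cauchyKernel cauchyKernelDeriv
  refine h2.congr_deriv ?_
  field_simp
  ring

theorem abs_cauchyKernel_sub_le (hv : 0 < v) (s t : ℝ) :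
    |cauchyKernel v s - cauchyKernel v t| ≤ (v ^ 2)⁻¹ * |s - t| := by
  have h := Convex.norm_image_sub_le_of_norm_hasDerivWithin_le
    (f := fun t => -cauchyKernel v (t - 0)) (s := Set.univ) (x := s) (y := t) (C := (v ^ 2)⁻¹)
    (fun x _ => (hasDerivAt_cauchyKernel hv 0 x).hasDerivWithinAt) (fun x _ => ?_) convex_univ
    (Set.mem_univ _) (Set.mem_univ _)
  · simp only [sub_zero, Real.norm_eq_abs] at h
    rw [abs_sub_comm t s] at h
    refine le_trans (le_of_eq ?_) h
    congr 1; ring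
  · rw [Real.norm_eq_abs, sub_zero]
    refine (abs_cauchyKernelDeriv_le hv x).trans ?_
    gcongr
    nlinarith [sq_nonneg x]

theorem integrable_inv_sq_add_sq (hv : 0 < v) : Integrable fun t : ℝ => (t ^ 2 + v ^ 2)⁻¹ := by
  have h := (integrable_inv_one_add_sq.comp_div hv.ne').const_mul (v ^ 2)⁻¹
  refine h.congr (Eventually.of_forall fun t => ?_)
  simp only
  rw [← mul_inv]
  congr 1
  field_simp
  ring

theorem integrable_cauchyKernelDeriv (hv : 0 < v) (u : ℝ) :
    Integrable fun t => cauchyKernelDeriv v (t - u) := by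
  refine ((integrable_inv_sq_add_sq hv).comp_sub_right u).mono ?_
    (Eventually.of_forall fun t => ?_)
  · refine (Continuous.div (by fun_prop) (by fun_prop) fun t => ?_).aestronglyMeasurable
    positivity
  · rw [Real.norm_eq_abs]
    exact (abs_cauchyKernelDeriv_le hv _).trans (le_abs_self _)

theorem tendsto_cauchyKernel (v u : ℝ) :
    Tendsto (fun t => -cauchyKernel v (t - u)) atTop (𝓝 0) := by
  rw [← neg_zero]
  refine Tendsto.neg ?_
  unfold cauchyKernel
  refine Tendsto.const_div_atTop ?_ v
  refine tendsto_atTop_add_const_right _ _ ?_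
  exact (tendsto_pow_atTop two_ne_zero).comp (tendsto_atTop_add_const_right _ (-u) tendsto_id)

/-- Integration by parts for a single eigenvalue. Summed over the spectrum, it expresses the Cauchy
mean as a Lebesgue integral of the distribution function. -/
theorem integral_cauchyKernelDeriv_mul_indicator (hv : 0 < v) (u l : ℝ) :
    ∫ t, cauchyKernelDeriv v (t - u) * (if l ≤ t then 1 else 0) = cauchyKernel v (l - u) := by
  have h1 : ∀ t, cauchyKernelDeriv v (t - u) * (if l ≤ t then 1 else 0) =
      (Set.Ici l).indicator (fun t => cauchyKernelDeriv v (t - u)) t := by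
    intro t
    simp only [Set.indicator, Set.mem_Ici]
    split_ifs <;> simp
  simp_rw [h1]
  rw [integral_indicator measurableSet_Ici, integral_Ici_eq_integral_Ioi,
    integral_Ioi_of_hasDerivAt_of_tendsto' (fun t _ => hasDerivAt_cauchyKernel hv u t)
      (integrable_cauchyKernelDeriv hv u).integrableOn (tendsto_cauchyKernel v u)]
  simp

end CauchyKernel

/-! ### Cauchy means of spectral distributions. -/

section SpectralDF

variable {n : ℕ} {A : Matrix (Fin n) (Fin n) ℝ}

theorem spectralDF_eq_sum (hA : A.IsHermitian) (t : ℝ) :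
    spectralDF hA t = (n : ℝ)⁻¹ * ∑ k, if hA.eigenvalues k ≤ t then (1 : ℝ) else 0 := by
  simp [spectralDF]

theorem spectralDF_mono (hA : A.IsHermitian) : Monotone (spectralDF hA) := fun s t hst => by
  rw [spectralDF, spectralDF]
  gcongr with k

theorem spectralDF_nonneg (hA : A.IsHermitian) (t : ℝ) : 0 ≤ spectralDF hA t := by
  unfold spectralDF; positivity

theorem inv_mul_sum_le_of_le {f : Fin n → ℝ} {c : ℝ} (hc : 0 ≤ c) (hf : ∀ k, f k ≤ c) :
    (n : ℝ)⁻¹ * ∑ k, f k ≤ c := by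
  rcases Nat.eq_zero_or_pos n with rfl | hn
  · simpa using hc
  · rw [inv_mul_le_iff₀ (by positivity)]
    refine (Finset.sum_le_sum fun k _ => hf k).trans ?_
    simp

theorem spectralDF_le_one (hA : A.IsHermitian) (t : ℝ) : spectralDF hA t ≤ 1 := by
  rw [spectralDF_eq_sum]
  exact inv_mul_sum_le_of_le zero_le_one fun k => by split_ifs <;> simp

/-- The mean of the Cauchy kernel centred at `u` over the eigenvalues. -/
def cauchyMean (hA : A.IsHermitian) (v u : ℝ) : ℝ :=
  (n : ℝ)⁻¹ * ∑ k, cauchyKernel v (hA.eigenvalues k - u)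

theorem cauchyMean_eq_integral (hA : A.IsHermitian) {v : ℝ} (hv : 0 < v) (u : ℝ) :
    cauchyMean hA v u = ∫ t, cauchyKernelDeriv v (t - u) * spectralDF hA t := by
  simp_rw [spectralDF_eq_sum, mul_left_comm _ (n : ℝ)⁻¹, Finset.mul_sum]
  rw [integral_finsetSum]
  · simp_rw [integral_const_mul, integral_cauchyKernelDeriv_mul_indicator hv]
    rw [cauchyMean, Finset.mul_sum]
  · intro k _
    refine Integrable.const_mul ((integrable_cauchyKernelDeriv hv u).mul_bdd (c := 1) ?_ ?_) _
    · exact (Measurable.ite measurableSet_Ici measurable_const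
        measurable_const).aestronglyMeasurable
    · exact Eventually.of_forall fun t => by split_ifs <;> simp

theorem abs_cauchyMean_le (hA : A.IsHermitian) {v : ℝ} (hv : 0 < v) (u : ℝ) :
    |cauchyMean hA v u| ≤ v⁻¹ := by
  unfold cauchyMean
  rw [abs_of_nonneg (mul_nonneg (by positivity)
    (Finset.sum_nonneg fun k _ => cauchyKernel_nonneg hv _))]
  exact inv_mul_sum_le_of_le (by positivity) fun k => cauchyKernel_le hv _

theorem abs_cauchyMean_sub_le (hA : A.IsHermitian) {v : ℝ} (hv : 0 < v) (u u' : ℝ) :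
    |cauchyMean hA v u - cauchyMean hA v u'| ≤ (v ^ 2)⁻¹ * |u - u'| := by
  unfold cauchyMean
  rw [← mul_sub, ← Finset.sum_sub_distrib, abs_mul, abs_of_nonneg (by positivity)]
  refine (mul_le_mul_of_nonneg_left (Finset.abs_sum_le_sum_abs _ _) (by positivity)).trans ?_
  refine inv_mul_sum_le_of_le (by positivity) fun k => ?_
  refine (abs_cauchyKernel_sub_le hv _ _).trans (le_of_eq ?_)
  rw [abs_sub_comm u u']
  congr 2; ring

/-- For real `λ`, the imaginary part of `1 / (λ - z)` is `Im z / |λ - z| ^ 2`. -/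
theorem imTrace_resolventMatrix_eq (hA : A.IsHermitian) {z : ℂ} (hz : 0 < z.im) :
    imTrace (resolventMatrix A z) = cauchyMean hA z.im z.re := by
  rw [imTrace, trace_resolventMatrix hA hz, cauchyMean, Complex.im_sum]
  congr 1
  refine Finset.sum_congr rfl fun k _ => ?_
  rw [Complex.inv_im, cauchyKernel, Complex.normSq_apply]
  simp only [Complex.sub_im, Complex.sub_re, Complex.ofReal_im, Complex.ofReal_re]
  ring_nf

/-- Lévy convergence gives pointwise convergence off the countably many jumps of `F`, and the
integrable kernel derivative dominates. -/
theorem tendsto_cauchyMean_of_levyDist {A : ∀ n : ℕ, Matrix (Fin n) (Fin n) ℝ}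
    (hA : ∀ n, (A n).IsHermitian) {F : ℝ → ℝ} (hF : IsDistributionFunction F)
    (h : Tendsto (fun n => levyDist (spectralDF (hA n)) F) atTop (𝓝 0)) {v : ℝ} (hv : 0 < v)
    (u : ℝ) :
    Tendsto (fun n => cauchyMean (hA n) v u) atTop
      (𝓝 (∫ t, cauchyKernelDeriv v (t - u) * F t)) := by
  simp_rw [cauchyMean_eq_integral (hA _) hv]
  refine tendsto_integral_of_dominated_convergence (fun t => |cauchyKernelDeriv v (t - u)|)
    (fun n => (integrable_cauchyKernelDeriv hv u).aestronglyMeasurable.mul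
      (spectralDF_mono (hA n)).measurable.aestronglyMeasurable)
    (integrable_cauchyKernelDeriv hv u).abs (fun n => Eventually.of_forall fun t => ?_) ?_
  · rw [norm_mul, Real.norm_eq_abs, Real.norm_eq_abs, abs_of_nonneg (spectralDF_nonneg (hA n) t)]
    exact mul_le_of_le_one_right (abs_nonneg _) (spectralDF_le_one (hA n) t)
  · have hc : {x | ¬ContinuousAt F x}.Countable := hF.mono.countable_not_continuousAt
    have hae : ∀ᵐ t : ℝ, t ∉ {x | ¬ContinuousAt F x} := hc.ae_notMem _
    filter_upwards [hae] with t ht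
    refine Tendsto.const_mul _ ?_
    exact tendsto_of_tendsto_levyDist (fun n => spectralDF_mono (hA n))
      (fun n => spectralDF_nonneg (hA n)) (fun n => spectralDF_le_one (hA n)) hF h
      (by simpa using ht)

end SpectralDF

/-! ### Stieltjes inversion by Cauchy smoothing. -/

section Smoothing

/-- The distribution function of the standard Cauchy law. -/
def cauchyDF (t : ℝ) : ℝ := 1 / 2 + Real.arctan t / Real.pi

theorem cauchyDF_mono : Monotone cauchyDF := fun s t hst => by
  unfold cauchyDF
  have := Real.pi_pos
  have := Real.arctan_mono hst
  gcongr

theorem cauchyDF_neg (t : ℝ) : cauchyDF (-t) = 1 - cauchyDF t := by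
  unfold cauchyDF; rw [Real.arctan_neg]; ring

theorem cauchyDF_le_one (t : ℝ) : cauchyDF t ≤ 1 := by
  unfold cauchyDF
  have h := (Real.arctan_lt_pi_div_two t).le
  have hp := Real.pi_pos
  have : Real.arctan t / Real.pi ≤ 1 / 2 := by
    rw [div_le_div_iff₀ hp two_pos]; linarith
  linarith

theorem cauchyDF_nonneg (t : ℝ) : 0 ≤ cauchyDF t := by
  have h := cauchyDF_le_one (-t)
  rw [cauchyDF_neg] at h
  linarith

theorem tendsto_cauchyDF_atTop : Tendsto cauchyDF atTop (𝓝 1) := by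
  have h1 : Tendsto Real.arctan atTop (𝓝 (Real.pi / 2)) :=
    tendsto_nhds_of_tendsto_nhdsWithin Real.tendsto_arctan_atTop
  have h2 := (h1.div_const Real.pi).const_add (1 / 2)
  have h3 : 1 / 2 + Real.pi / 2 / Real.pi = 1 := by
    field_simp [Real.pi_ne_zero]; norm_num
  rwa [h3] at h2

theorem hasDerivAt_cauchyDF {v : ℝ} (hv : 0 < v) (l u : ℝ) :
    HasDerivAt (fun u => cauchyDF ((u - l) / v)) (Real.pi⁻¹ * cauchyKernel v (l - u)) u := by
  have h1 : HasDerivAt (fun u : ℝ => (u - l) / v) (1 / v) u :=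
    ((hasDerivAt_id u).sub_const l).div_const v
  have h2 := ((h1.arctan).div_const Real.pi).const_add (1 / 2)
  refine h2.congr_deriv ?_
  unfold cauchyKernel
  have hp : (l - u) ^ 2 + v ^ 2 ≠ 0 := by positivity
  have hp' : 1 + ((u - l) / v) ^ 2 ≠ 0 := by positivity
  have e : 1 + ((u - l) / v) ^ 2 = ((l - u) ^ 2 + v ^ 2) / v ^ 2 := by
    field_simp; ring
  rw [e]
  field_simp

variable {n : ℕ} {A : Matrix (Fin n) (Fin n) ℝ}

/-- The spectral distribution function smoothed by a Cauchy law of scale `v`. -/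
def smoothDF (hA : A.IsHermitian) (v b : ℝ) : ℝ :=
  (n : ℝ)⁻¹ * ∑ k, cauchyDF ((b - hA.eigenvalues k) / v)

theorem smoothDF_nonneg (hA : A.IsHermitian) (v b : ℝ) : 0 ≤ smoothDF hA v b :=
  mul_nonneg (by positivity) (Finset.sum_nonneg fun _ _ => cauchyDF_nonneg _)

theorem smoothDF_le_one (hA : A.IsHermitian) (v b : ℝ) : smoothDF hA v b ≤ 1 :=
  inv_mul_sum_le_of_le zero_le_one fun _ => cauchyDF_le_one _

theorem continuous_cauchyMean (hA : A.IsHermitian) {v : ℝ} (hv : 0 < v) :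
    Continuous (cauchyMean hA v) := by
  unfold cauchyMean
  have := continuous_cauchyKernel hv
  fun_prop

/-- Stieltjes inversion at fixed height: Cauchy means determine only increments of the smoothed
distribution function. -/
theorem smoothDF_sub (hA : A.IsHermitian) {v : ℝ} (hv : 0 < v) (a b : ℝ) :
    smoothDF hA v b - smoothDF hA v a = Real.pi⁻¹ * ∫ u in a..b, cauchyMean hA v u := by
  rw [← intervalIntegral.integral_const_mul]
  symm
  refine intervalIntegral.integral_eq_sub_of_hasDerivAt (fun u _ => ?_)
    ((continuous_cauchyMean hA hv).const_mul _ |>.intervalIntegrable _ _)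
  have h := (HasDerivAt.fun_sum (u := Finset.univ)
    fun k _ => hasDerivAt_cauchyDF hv (hA.eigenvalues k) u).const_mul (n : ℝ)⁻¹
  refine h.congr_deriv ?_
  rw [cauchyMean, ← Finset.mul_sum]
  ring

/-- An eigenvalue at most `b - δ` already carries Cauchy mass at least `cauchyDF (δ / v)` to the
left of `b`, close to `1` for small `v`. -/
theorem spectralDF_le_smoothDF_add (hA : A.IsHermitian) {v : ℝ} (hv : 0 < v) (b δ : ℝ) :
    spectralDF hA (b - δ) ≤ smoothDF hA v b + (1 - cauchyDF (δ / v)) := by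
  rw [spectralDF_eq_sum, smoothDF, ← sub_le_iff_le_add', ← mul_sub, ← Finset.sum_sub_distrib]
  have h1 := cauchyDF_le_one (δ / v)
  refine inv_mul_sum_le_of_le (by linarith) fun k => ?_
  split_ifs with h
  · have : cauchyDF (δ / v) ≤ cauchyDF ((b - hA.eigenvalues k) / v) :=
      cauchyDF_mono (by gcongr; linarith)
    linarith
  · linarith [cauchyDF_nonneg ((b - hA.eigenvalues k) / v)]

theorem smoothDF_le_spectralDF_add (hA : A.IsHermitian) {v : ℝ} (hv : 0 < v) (b δ : ℝ) :
    smoothDF hA v b ≤ spectralDF hA (b + δ) + (1 - cauchyDF (δ / v)) := by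
  rw [spectralDF_eq_sum, smoothDF, ← sub_le_iff_le_add', ← mul_sub, ← Finset.sum_sub_distrib]
  have h1 := cauchyDF_le_one (δ / v)
  refine inv_mul_sum_le_of_le (by linarith) fun k => ?_
  split_ifs with h
  · linarith [cauchyDF_le_one ((b - hA.eigenvalues k) / v)]
  · have : cauchyDF ((b - hA.eigenvalues k) / v) ≤ cauchyDF (-(δ / v)) := by
      refine cauchyDF_mono ?_
      rw [← neg_div]
      gcongr
      linarith
    rw [cauchyDF_neg] at this
    linarith

/-- Convergence of Cauchy means transfers convergence in the Lévy distance. -/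
theorem tendsto_levyDist_of_cauchyMean {A B : ∀ n : ℕ, Matrix (Fin n) (Fin n) ℝ}
    (hA : ∀ n, (A n).IsHermitian) (hB : ∀ n, (B n).IsHermitian) {F : ℝ → ℝ}
    (hF : IsDistributionFunction F)
    (hBF : Tendsto (fun n => levyDist (spectralDF (hB n)) F) atTop (𝓝 0))
    (hAB : ∀ m : ℕ, ∀ u : ℝ, Tendsto (fun n => cauchyMean (hA n) ((m : ℝ) + 1)⁻¹ u -
      cauchyMean (hB n) ((m : ℝ) + 1)⁻¹ u) atTop (𝓝 0)) :
    Tendsto (fun n => levyDist (spectralDF (hA n)) F) atTop (𝓝 0) := by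
  refine tendsto_levyDist_of_eventually (fun n => spectralDF_mono (hA n))
    (fun n => spectralDF_nonneg (hA n)) (fun n => spectralDF_le_one (hA n)) hF fun x ε hε => ?_
  -- Each of the two bounds below uses seven errors `δ` and a total shift `3 * δ`.
  set δ := ε / 8 with hδ_def
  have hδ : 0 < δ := by positivity
  have hη : ∃ m : ℕ, 1 - cauchyDF (δ / ((m : ℝ) + 1)⁻¹) < δ := by
    have h1 : Tendsto (fun m : ℕ => δ / ((m : ℝ) + 1)⁻¹) atTop atTop := by
      simp_rw [div_inv_eq_mul]
      exact (tendsto_atTop_add_const_right _ 1 tendsto_natCast_atTop_atTop).const_mul_atTop hδ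
    have h2 := (tendsto_cauchyDF_atTop.comp h1).const_sub 1
    rw [sub_self] at h2
    exact (h2.eventually (gt_mem_nhds hδ)).exists
  obtain ⟨m, hm⟩ := hη
  set v := ((m : ℝ) + 1)⁻¹ with hv_def
  have hv : 0 < v := by positivity
  have hdiff : ∀ a b : ℝ, Tendsto (fun n => (smoothDF (hA n) v b - smoothDF (hA n) v a) -
      (smoothDF (hB n) v b - smoothDF (hB n) v a)) atTop (𝓝 0) := by
    intro a b
    have h1 : Tendsto (fun n => ∫ u in a..b, (cauchyMean (hA n) v u - cauchyMean (hB n) v u)) atTop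
        (𝓝 (∫ _u in a..b, (0 : ℝ))) := by
      refine intervalIntegral.tendsto_integral_filter_of_dominated_convergence
        (fun _ => v⁻¹ + v⁻¹) (Eventually.of_forall fun n => ?_)
        (Eventually.of_forall fun n => Eventually.of_forall fun u _ => ?_)
        (by simp) (Eventually.of_forall fun u _ => hAB m u)
      · exact ((continuous_cauchyMean (hA n) hv).sub
          (continuous_cauchyMean (hB n) hv)).aestronglyMeasurable
      · exact (abs_sub _ _).trans
          (add_le_add (abs_cauchyMean_le (hA n) hv u) (abs_cauchyMean_le (hB n) hv u))
    have h2 := h1.const_mul Real.pi⁻¹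
    simp only [intervalIntegral.integral_zero, mul_zero] at h2
    refine h2.congr fun n => ?_
    rw [smoothDF_sub (hA n) hv, smoothDF_sub (hB n) hv, ← mul_sub,
      ← intervalIntegral.integral_sub ((continuous_cauchyMean (hA n) hv).intervalIntegrable _ _)
        ((continuous_cauchyMean (hB n) hv).intervalIntegrable _ _)]
  -- Only increments are comparable, so they are anchored where `F` is nearly `1` or nearly `0`.
  -- There the smoothed function of `A` needs only its trivial bounds, and no tightness of `A` is
  -- required.
  obtain ⟨t, ht⟩ := (hF.tendsto_atTop.eventually (lt_mem_nhds (by linarith : 1 - δ < 1))).exists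
  obtain ⟨b, hb⟩ := (hF.tendsto_atBot.eventually (gt_mem_nhds hδ)).exists
  have e1 := (hdiff (x + δ) (t + 2 * δ)).eventually (lt_mem_nhds (neg_lt_zero.mpr hδ))
  have e2 := (hdiff (b - 2 * δ) (x - δ)).eventually (lt_mem_nhds (neg_lt_zero.mpr hδ))
  filter_upwards [e1, e2, hBF.eventually (gt_mem_nhds hδ)] with n h1 h2 h3
  have lev := sandwich_of_levyDist_lt (spectralDF_mono (hB n)) (spectralDF_nonneg (hB n))
    (spectralDF_le_one (hB n)) hF h3
  constructor
  · have s1 := spectralDF_le_smoothDF_add (hA n) hv (x + δ) δ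
    have s2 := smoothDF_le_one (hA n) v (t + 2 * δ)
    have s3 := spectralDF_le_smoothDF_add (hB n) hv (t + 2 * δ) δ
    have s4 := smoothDF_le_spectralDF_add (hB n) hv (x + δ) δ
    have l1 := (lev t).2
    have l2 := (lev (x + δ + δ + δ)).1
    have l3 := hF.mono (show x + δ + δ + δ ≤ x + ε by linarith)
    rw [add_sub_cancel_right] at s1 l2
    have r1 : t + 2 * δ - δ = t + δ := by ring
    rw [r1] at s3
    linarith
  · have s1 := smoothDF_le_spectralDF_add (hA n) hv (x - δ) δ
    have s2 := smoothDF_nonneg (hA n) v (b - 2 * δ)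
    have s3 := smoothDF_le_spectralDF_add (hB n) hv (b - 2 * δ) δ
    have s4 := spectralDF_le_smoothDF_add (hB n) hv (x - δ) δ
    have l1 := (lev b).1
    have l2 := (lev (x - δ - δ - δ)).2
    have l3 := hF.mono (show x - ε ≤ x - δ - δ - δ by linarith)
    rw [sub_add_cancel] at s1 l2
    have r1 : b - 2 * δ + δ = b - δ := by ring
    rw [r1] at s3
    linarith

/-- Convergence at rational points suffices, by equicontinuity. -/
theorem tendsto_cauchyMean_sub_of_rat {A B : ∀ n : ℕ, Matrix (Fin n) (Fin n) ℝ}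
    (hA : ∀ n, (A n).IsHermitian) (hB : ∀ n, (B n).IsHermitian) {v : ℝ} (hv : 0 < v)
    (h : ∀ r : ℚ, Tendsto (fun n => cauchyMean (hA n) v r - cauchyMean (hB n) v r) atTop (𝓝 0))
    (u : ℝ) : Tendsto (fun n => cauchyMean (hA n) v u - cauchyMean (hB n) v u) atTop (𝓝 0) := by
  rw [Metric.tendsto_atTop]
  intro ε hε
  set η := v ^ 2 * (ε / 4) with hη_def
  have hη : 0 < η := by positivity
  obtain ⟨r, hr⟩ := Rat.denseRange_cast.exists_dist_lt u hη
  obtain ⟨N, hN⟩ := Metric.tendsto_atTop.mp (h r) (ε / 2) (by positivity)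
  refine ⟨N, fun n hn => ?_⟩
  have h1 := hN n hn
  have h2 := abs_cauchyMean_sub_le (hA n) hv u r
  have h3 := abs_cauchyMean_sub_le (hB n) hv u r
  have h4 : (v ^ 2)⁻¹ * |u - r| < ε / 4 := by
    rw [inv_mul_lt_iff₀ (by positivity)]
    rwa [Real.dist_eq] at hr
  rw [dist_zero_right, Real.norm_eq_abs] at h1 ⊢
  rw [abs_lt] at h1 ⊢
  have h5 := abs_le.mp (h2.trans h4.le)
  have h6 := abs_le.mp (h3.trans h4.le)
  constructor <;> linarith

end Smoothing

/-! ### Moments of the Gaussian entries. -/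

section GaussianMoments

theorem integral_abs_pow_three_gaussianReal (v : NNReal) :
    ∫ y, |y| ^ 3 ∂(gaussianReal 0 v) = √(v : ℝ) ^ 3 * ∫ y, |y| ^ 3 ∂(gaussianReal 0 1) := by
  have h1 := gaussianReal_map_const_mul (μ := 0) (v := 1) (√(v : ℝ))
  have h2 : NNReal.mk (√(v : ℝ) ^ 2) (sq_nonneg _) * 1 = v := by
    rw [mul_one]
    ext
    exact Real.sq_sqrt v.2
  rw [mul_zero, h2] at h1
  rw [← h1, integral_map (by fun_prop) (by fun_prop), ← integral_const_mul]
  refine integral_congr_ae (Eventually.of_forall fun y => ?_)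
  simp only
  rw [abs_mul, mul_pow, abs_of_nonneg (Real.sqrt_nonneg _)]

variable {Ω : Type*} [MeasurableSpace Ω] {P : Measure Ω}

theorem gaussian_moments {Y : Ω → ℝ} (hY : Measurable Y) {v : NNReal}
    (h : P.map Y = gaussianReal 0 v) :
    MemLp Y 3 P ∧ ∫ ω, Y ω ∂P = 0 ∧ ∫ ω, Y ω ^ 2 ∂P = v ∧
      ∫ ω, |Y ω| ^ 3 ∂P = √(v : ℝ) ^ 3 * ∫ y, |y| ^ 3 ∂(gaussianReal 0 1) := by
  refine ⟨?_, ?_, ?_, ?_⟩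
  · have h1 : MemLp id 3 (P.map Y) := by
      rw [h]; exact memLp_id_gaussianReal' 3 (by norm_num)
    exact (memLp_map_measure_iff (by fun_prop) hY.aemeasurable).mp h1
  · rw [← integral_map (f := fun y => y) hY.aemeasurable (by fun_prop), h,
      integral_id_gaussianReal]
  · rw [← integral_map (f := fun y => y ^ 2) hY.aemeasurable (by fun_prop), h]
    have h1 := variance_fun_id_gaussianReal (μ := 0) (v := v)
    rw [variance_of_integral_eq_zero (by fun_prop) integral_id_gaussianReal] at h1
    exact h1
  · rw [← integral_map (f := fun y => |y| ^ 3) hY.aemeasurable (by fun_prop), h,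
      integral_abs_pow_three_gaussianReal]

end GaussianMoments

end
-- Assembly of the universality theorem.
theorem mainTheorem9 {Ω : Type*} [MeasurableSpace Ω] (P : Measure Ω) [IsProbabilityMeasure P]
    -- the random field and the Gaussian array
    (X : ℤ → ℤ → Ω → ℝ) (Y : ℕ → ℕ → Ω → ℝ)
    (hXmeas : ∀ i j, Measurable (X i j))
    (hXsq : ∀ i j, MemLp (X i j) 2 P)
    (hXmean : ∀ i j, ∫ ω, X i j ω ∂P = 0)
    (hYmeas : ∀ i j, Measurable (Y i j))
    (hYlaw : ∀ i j : ℕ, 1 ≤ i → 1 ≤ j →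
      P.map (Y i j) = gaussianReal 0 (∫ ω, X i j ω ^ 2 ∂P).toNNReal)
    (hYindep : iIndepFun (fun (p : ℕ × ℕ) => Y p.1 p.2) P)
    (hXY : IndepFun (fun ω (p : ℤ × ℤ) => X p.1 p.2 ω) (fun ω (p : ℕ × ℕ) => Y p.1 p.2 ω) P)
    -- the martingale difference condition
    (hmart : ∀ i j : ℕ, 1 ≤ j → j ≤ i → P[X i j | pastSigma X i j 1] =ᵐ[P] 0)
    -- the moment condition
    (h : ℝ → ℝ)
    (h_one : ∀ x, 0 ≤ x → 1 ≤ h x)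
    (h_mono : MonotoneOn h (Set.Ici 0))
    (h_anti : AntitoneOn (fun x => x⁻¹ * h x) (Set.Ioi 0))
    (h_sum : Summable fun n : ℕ => ((n : ℝ) * h n)⁻¹)
    (C : ℝ)
    (hmoment : ∀ i j : ℕ, 1 ≤ j → j ≤ i →
      ∫⁻ ω, ENNReal.ofReal (X i j ω ^ 2 * h |X i j ω|) ∂P ≤ ENNReal.ofReal C)
    -- the mixing condition, almost surely
    (hmix : ∀ᵐ ω ∂P, Tendsto
      (fun a : ℕ => limsup (fun n : ℕ => ENNReal.ofReal (condVarAverage P X a n ω)) atTop)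
      atTop (𝓝 0))
    -- almost sure convergence of the Gaussian spectral distributions
    (F : ℝ → ℝ) (hF : IsDistributionFunction F)
    (hY : ∀ᵐ ω ∂P, Tendsto (fun n : ℕ =>
      levyDist (spectralDF (wignerMatrix_isHermitian (fun i j => Y i j ω) n)) F) atTop (𝓝 0)) :
    ∀ᵐ ω ∂P, Tendsto (fun n : ℕ =>
      levyDist (spectralDF (wignerMatrix_isHermitian (fun i j => X i j ω) n)) F) atTop (𝓝 0) := by
  have hmoment' : ∀ q, ∫⁻ ω, ENNReal.ofReal (seqField X q ω ^ 2 * h |seqField X q ω|) ∂P ≤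
      ENNReal.ofReal C := fun q => hmoment _ _ (lexEnum_spec q).1 (lexEnum_spec q).2.1
  have hmart' : ∀ q, P[seqField X q | seqPast X 1 q] =ᵐ[P] 0 := fun q =>
    hmart _ _ (lexEnum_spec q).1 (lexEnum_spec q).2.1
  set y : ℕ → Ω → ℝ := fun q => Y (lexEnum q).1 (lexEnum q).2 with hy_def
  have hymeas : ∀ q, Measurable (y q) := fun q => hYmeas _ _
  have hygauss := fun q => gaussian_moments (hymeas q)
    (hYlaw _ _ ((lexEnum_spec q).1.trans (lexEnum_spec q).2.1) (lexEnum_spec q).1)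
  have hvar : ∀ q, ((∫ ω, X (lexEnum q).1 (lexEnum q).2 ω ^ 2 ∂P).toNNReal : ℝ) =
      ∫ ω, seqField X q ω ^ 2 ∂P := fun q =>
    Real.coe_toNNReal _ (integral_nonneg fun ω => sq_nonneg _)
  have hyindep : iIndepFun y P := hYindep.precomp lexEnum_injective
  -- Since `h ≥ 1`, the moment condition bounds all variances, so Gaussian scaling bounds the third
  -- moments uniformly.
  have hym : ∀ q, ∫ ω, |y q ω| ^ 3 ∂P ≤
      √(max C 0) ^ 3 * ∫ t, |t| ^ 3 ∂(gaussianReal 0 1) := fun q => by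
    rw [(hygauss q).2.2.2, hvar]
    have h1 := integral_sq_le h_one (x := seqField X q) (hXmeas _ _) (hmoment' q)
    have h2 : 0 ≤ ∫ t, |t| ^ 3 ∂(gaussianReal 0 1) := integral_nonneg fun t => by positivity
    gcongr
  have hlim : ∀ z : ℂ, 0 < z.im → ∀ᵐ ω ∂P, Tendsto (fun n =>
      spectralStat n z (fun q => seqField X q ω) -
        ∫ ω', spectralStat n z (fun q => y q ω') ∂P) atTop (𝓝 0) := fun z hz =>
    ae_tendsto_spectralStat_sub hXmeas hXsq hymeas hyindep (fun q => (hygauss q).1)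
      (fun q => (hygauss q).2.1) (fun q => (hygauss q).2.2.1.trans (hvar q)) hym hmart' h_one
      h_mono h_sum hmoment' hmix hz
  have hstatX : ∀ (z : ℂ), 0 < z.im → ∀ n ω, spectralStat n z (fun q => seqField X q ω) =
      cauchyMean (wignerMatrix_isHermitian (fun i j => X i j ω) n) z.im z.re := by
    intro z hz n ω
    rw [← imTrace_resolventMatrix_eq _ hz, spectralStat,
      ← seqMatrix_comp_lexEnum n (fun i j => X i j ω)]
    rfl
  have hstatY : ∀ (z : ℂ), 0 < z.im → ∀ n ω, spectralStat n z (fun q => y q ω) =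
      cauchyMean (wignerMatrix_isHermitian (fun i j => Y i j ω) n) z.im z.re := by
    intro z hz n ω
    rw [← imTrace_resolventMatrix_eq _ hz, spectralStat,
      ← seqMatrix_comp_lexEnum n (fun i j => Y i j ω)]
  -- The almost sure limit is deterministic and the statistic is uniformly bounded, so the Gaussian
  -- means have the same limit.
  have hmeanY : ∀ z : ℂ, 0 < z.im → Tendsto (fun n =>
      ∫ ω', spectralStat n z (fun q => y q ω') ∂P) atTop
      (𝓝 (∫ t, cauchyKernelDeriv z.im (t - z.re) * F t)) := by
    intro z hz
    have h1 := tendsto_integral_of_dominated_convergence (μ := P)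
      (F := fun n ω' => spectralStat n z (fun q => y q ω'))
      (f := fun _ => ∫ t, cauchyKernelDeriv z.im (t - z.re) * F t)
      (fun _ => spectralStatConst z)
      (fun n => ((hasTaylorBounds_spectralStat n hz).measurable.comp
        (measurable_pi_iff.mpr hymeas)).aestronglyMeasurable)
      (integrable_const _)
      (fun n => Eventually.of_forall fun ω => (hasTaylorBounds_spectralStat n hz).bound _)
      (by
        filter_upwards [hY] with ω hω
        simp_rw [hstatY z hz]
        exact tendsto_cauchyMean_of_levyDist _ hF hω hz _)
    simpa using h1
  -- A single good realization of the Gaussian matrices serves as a deterministic comparison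
  -- sequence for almost every `ω`.
  obtain ⟨ω₀, hω₀⟩ := hY.exists
  -- Heights `1 / (m + 1)` and rational abscissae keep the exceptional null sets countable;
  -- equicontinuity recovers real abscissae.
  have hz : ∀ (m : ℕ) (r : ℚ), 0 < (Complex.mk (r : ℝ) ((m : ℝ) + 1)⁻¹).im := fun m r => by
    simp only
    positivity
  have hall := ae_all_iff.mpr fun m : ℕ => ae_all_iff.mpr fun r : ℚ => hlim _ (hz m r)
  filter_upwards [hall] with ω hω
  refine tendsto_levyDist_of_cauchyMean _ (fun n => wignerMatrix_isHermitian
    (fun i j => Y i j ω₀) n) hF hω₀ fun m u => ?_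
  refine tendsto_cauchyMean_sub_of_rat _ _ (by positivity) (fun r => ?_) u
  have h1 := hω m r
  simp_rw [hstatX _ (hz m r)] at h1
  have h2 := tendsto_cauchyMean_of_levyDist _ hF hω₀ (hz m r) (r : ℝ)
  have h3 := (h1.add (hmeanY _ (hz m r))).sub h2
  simpa using h3
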